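/- **Setting.** Let $\mathcal D$ be a distribution on $\mathcal X\times\{\pm1\}$ with marginal $\mathcal D_X$ on $\mathcal X$, and let $\mathcal H\subseteq\{\pm1\}^{\mathcal X}$ be a finite set of classifiers. Put $\mathrm{err}(h)=\Pr_{(X,Y)\sim\mathcal D}(h(X)\ne Y)$, let $h^*\in\arg\min_{h\in\mathcal H}\mathrm{err}(h)$, and $\mathrm{reg}(h,h^*)=\mathrm{err}(h)-\mathrm{err}(h^*)$. For a multiset $S$ of weighted examples $(x,y,w)$ let $\mathrm{err}(h,S)=\frac1{|S|}\sum_{(x,y,w)\in S}w\,\mathbf 1(h(x)\ne y)$. For $A\subseteq\mathcal H$ let $\mathrm{DIS}(A)=\{x:\exists h,h'\in A,\ h(x)\ne h'(x)\}$. The disagreement coefficient is $$\theta=\sup_{r>0}\frac{\mathcal D_X\{x:\exists h\in\mathcal H,\ h(x)\neq h^*(x),\ \mathcal D_X\{h\ne h^*\}\le r\}}{r}\quad(\le|\mathcal H|).$$ **Algorithm (Active Cover).** Inputs: an epoch schedule $0=\tau_0<3=\tau_1<\tau_2<\dots<\tau_M=n$ ($M\ge1$) with $\tau_{m+1}\le2\tau_m$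 for $m\ge1$; a confidence $0<\delta<1/e$ with $|\mathcal H|/\delta>\sqrt{192}$; with $\epsilon_m=32(\log(|\mathcal H|/\delta)+\log\tau_m)/\tau_m$, constants satisfying $\alpha\ge1$, $\eta\ge864$, $\xi\le\frac1{8n\epsilon_M\log n}$, $\beta^2\le\frac{\eta}{864\gamma n\epsilon_M\log n}$, $\gamma\ge\eta/4$, $c_1\ge2\alpha\sqrt6$, $c_2\ge\eta c_1^2/4$, $c_3\ge1$. The examples $(X_i,Y_i)$, $1\le i\le n$, are drawn i.i.d. from $\mathcal D$. The first three labels are queried, and $\tilde Z_1=\{(X_i,Y_i,1):i\le3\}$. For $1\le m\le M$, at the end of epoch $m$ (i.e. after example $\tau_m$), compute $$h_{m+1}\in\arg\min_{h\in\mathcal H}\mathrm{err}(h,\tilde Z_m),\qquad \Delta_m=c_1\sqrt{\epsilon_m\,\mathrm{err}(h_{m+1},\tilde Z_m)}+c_2\epsilon_m\log\tau_m,$$ $$A_{m+1}=\{h\in\mathcal H:\mathrm{err}(h,\tilde Z_m)-\mathrm{err}(h_{m+1},\tilde Z_m)\le\gamma\Delta_m\}\ \text{(the version space)},\qquad D_{m+1}=\mathrm{DIS}(A_{m+1}),$$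 and, if $m<M$, a query probability function $P_{m+1}:\mathcal X\to[0,1]$ minimizing $\mathbb E_X[1/(1-P(X))]$ over all measurable $P:\mathcal X\to[0,1]$ such that $P\ge P_{\min,m+1}$ on $D_{m+1}$ and, for all $h\in\mathcal H$, $$\mathbb E_X\Big[\tfrac{\mathbf 1(h(X)\ne h_{m+1}(X)\wedge X\in D_{m+1})}{P(X)}\Big]\le 2\alpha^2\Pr(h(X)\ne h_{m+1}(X)\wedge X\in D_{m+1})+2\beta^2\gamma\big(\mathrm{err}(h,\tilde Z_m)-\mathrm{err}(h_{m+1},\tilde Z_m)\big)\tau_m\Delta_m+\xi\tau_m\Delta_m^2,$$ where $P_{\min,m+1}=\min\Big(c_3\Big/\Big(\sqrt{\tfrac{\tau_m\mathrm{err}(h_{m+1},\tilde Z_m)}{n\epsilon_M}}+\log\tau_m\Big),\ \tfrac12\Big)$. The sample $\tilde Z_{m+1}$ is $\tilde Z_m$ together with one weighted example for each $\tau_m<i\le\tau_{m+1}$: if $X_i\in D_{m+1}$, draw $Q_i\sim\mathrm{Bernoulli}(P_{m+1}(X_i))$ and add $(X_i,Y_i,1/P_{m+1}(X_i))$ if $Q_i=1$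 and $(X_i,1,0)$ if $Q_i=0$; if $X_i\notin D_{m+1}$, add $(X_i,h_{m+1}(X_i),1)$. The choices of minimizers $h_{m+1}$, $P_{m+1}$ are arbitrary (measurable) functions of the information available after $\tau_m$ examples. **Corollary.** Suppose that Tsybakov's low-noise condition with $\varepsilon_0=1$ holds for some $\zeta>0$ and $0<\omega\le1$, that is, $$\Pr(h(X)\ne h^*(X))\le\zeta\,(\mathrm{err}(h)-\mathrm{err}(h^*))^\omega\quad\text{for all }h\in\mathcal H\text{ with }\mathrm{err}(h)-\mathrm{err}(h^*)\le1.$$ Then, with probability at least $1-\delta$, simultaneously for all epochs $m=1,\dots,M$ and all $h\in A_{m+1}$, $$\mathrm{reg}(h,h^*)\ \le\ C\,\tau_m^{-\frac1{2-\omega}}\,\log(|\mathcal H|/\delta)\,(\log\tau_m)^2,$$ where $C$ depends only on $c_1,c_2,\gamma,\zeta,\omega$ and $\theta$, and is nondecreasing in $\theta$. In particular $\mathrm{reg}(h,h^*)=\tilde O\big(\tau_m^{-1/(2-\omega)}\log(|\mathcal H|/\delta)\big)$. -/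

import Mathlib

open MeasureTheory ProbabilityTheory

noncomputable section

namespace ActiveCover

/-! Binary labels are modelled by `Bool` (`true` is `+1`, `false` is `-1`), a classifier on `𝒳`
is a function `𝒳 → Bool`, and an importance weighted example is a triple `(x, y, w)`. -/

/-- Expected error `err(h) = Pr_{(X,Y) ∼ D}(h(X) ≠ Y)`. -/
def err {𝒳 : Type*} [MeasurableSpace 𝒳] (D : Measure (𝒳 × Bool)) (h : 𝒳 → Bool) : ℝ :=
  D.real {p | h p.1 ≠ p.2}

/-- Regret `reg(h, h') = err(h) - err(h')`. -/
def reg {𝒳 : Type*} [MeasurableSpace 𝒳] (D : Measure (𝒳 × Bool)) (h h' : 𝒳 → Bool) : ℝ :=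
  err D h - err D h'

/-- `h` is an error minimizer in `H`. -/
def IsErrMinimizer {𝒳 : Type*} [MeasurableSpace 𝒳] (D : Measure (𝒳 × Bool))
    (H : Finset (𝒳 → Bool)) (h : 𝒳 → Bool) : Prop :=
  h ∈ H ∧ ∀ f ∈ H, err D h ≤ err D f

/-- Importance weighted empirical error `∑_{(x,y,w) ∈ S} w · 1(h(x) ≠ y) / |S|`. -/
def empErr {𝒳 : Type*} (S : Multiset (𝒳 × Bool × ℝ)) (h : 𝒳 → Bool) : ℝ :=
  (S.map fun z => z.2.2 * (if h z.1 ≠ z.2.1 then 1 else 0)).sum / (Multiset.card S : ℝ)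

/-- Disagreement region of a set of classifiers. -/
def DIS {𝒳 : Type*} (A : Set (𝒳 → Bool)) : Set 𝒳 :=
  {x | ∃ h ∈ A, ∃ h' ∈ A, h x ≠ h' x}

/-- Disagreement coefficient of `hstar`:
`sup_{r > 0} D_X{x | ∃ h ∈ H, hstar(x) ≠ h(x), D_X{h ≠ hstar} ≤ r} / r`.
It is at most `|H|`, by a union bound, so that passing to a real number loses nothing. -/
def disagreementCoeff {𝒳 : Type*} [MeasurableSpace 𝒳] (D : Measure (𝒳 × Bool))
    (H : Finset (𝒳 → Bool)) (hstar : 𝒳 → Bool) : ℝ :=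
  (⨆ (r : ℝ) (_ : 0 < r),
    D.fst {x | ∃ h ∈ H, hstar x ≠ h x ∧ D.fst {x' | h x' ≠ hstar x'} ≤ ENNReal.ofReal r}
      / ENNReal.ofReal r).toReal

/-- Tsybakov's low-noise condition with parameters `ζ`, `ω`, `ε₀`. -/
def TsybakovCondition {𝒳 : Type*} [MeasurableSpace 𝒳] (D : Measure (𝒳 × Bool))
    (H : Finset (𝒳 → Bool)) (hstar : 𝒳 → Bool) (ζ ω ε₀ : ℝ) : Prop :=
  ∀ h ∈ H, err D h - err D hstar ≤ ε₀ →
    D.fst.real {x | h x ≠ hstar x} ≤ ζ * (err D h - err D hstar) ^ ω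

/-- Inputs of the algorithm: its constants, the confidence `δ`, the number `M` of epochs, and the
epoch schedule, where `τ m` is the index of the last example of epoch `m`. -/
structure Params where
  c₁ : ℝ
  c₂ : ℝ
  c₃ : ℝ
  α : ℝ
  β : ℝ
  γ : ℝ
  η : ℝ
  ξ : ℝ
  δ : ℝ
  M : ℕ
  τ : ℕ → ℕ

namespace Params

/-- The total number of examples. -/
def n (par : Params) : ℕ := par.τ par.M

/-- `ε_m = 32 (log(|H|/δ) + log τ_m) / τ_m`, where `N = |H|`. -/
def eps (par : Params) (N m : ℕ) : ℝ :=
  32 * (Real.log (N / par.δ) + Real.log (par.τ m)) / par.τ m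

/-- The standing requirements on the inputs, where `N = |H|`. -/
structure Admissible (par : Params) (N : ℕ) : Prop where
  one_le_M : 1 ≤ par.M
  τ_zero : par.τ 0 = 0
  τ_one : par.τ 1 = 3
  τ_lt : ∀ m, 1 ≤ m → m < par.M → par.τ m < par.τ (m + 1)
  τ_le : ∀ m, 1 ≤ m → m < par.M → par.τ (m + 1) ≤ 2 * par.τ m
  δ_pos : 0 < par.δ
  δ_lt : par.δ < 1 / Real.exp 1
  card_div_δ : Real.sqrt 192 < N / par.δ
  α_ge : 1 ≤ par.α
  η_ge : 864 ≤ par.η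
  ξ_le : par.ξ ≤ 1 / (8 * par.n * par.eps N par.M * Real.log par.n)
  β_le : par.β ^ 2 ≤ par.η / (864 * par.γ * par.n * par.eps N par.M * Real.log par.n)
  γ_ge : par.η / 4 ≤ par.γ
  c₁_ge : 2 * par.α * Real.sqrt 6 ≤ par.c₁
  c₂_ge : par.η * par.c₁ ^ 2 / 4 ≤ par.c₂
  c₃_ge : 1 ≤ par.c₃

end Params

section Epoch

/-! In this section `S` is the sample `Z̃_m` at the end of epoch `m ≥ 1`, and `g` is the empirical
error minimizer `h_{m+1}` on it. -/

variable {𝒳 : Type*}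

/-- `Δ_m = c₁ √(ε_m err(h_{m+1}, Z̃_m)) + c₂ ε_m log τ_m`. -/
def radius (par : Params) (H : Finset (𝒳 → Bool)) (m : ℕ) (S : Multiset (𝒳 × Bool × ℝ))
    (g : 𝒳 → Bool) : ℝ :=
  par.c₁ * Real.sqrt (par.eps H.card m * empErr S g)
    + par.c₂ * par.eps H.card m * Real.log (par.τ m)

/-- The version space `A_{m+1}`. -/
def goodSet (par : Params) (H : Finset (𝒳 → Bool)) (m : ℕ) (S : Multiset (𝒳 × Bool × ℝ))
    (g : 𝒳 → Bool) : Set (𝒳 → Bool) :=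
  {h | h ∈ H ∧ empErr S h - empErr S g ≤ par.γ * radius par H m S g}

/-- The region `D_{m+1} = DIS(A_{m+1})`. -/
def region (par : Params) (H : Finset (𝒳 → Bool)) (m : ℕ) (S : Multiset (𝒳 × Bool × ℝ))
    (g : 𝒳 → Bool) : Set 𝒳 :=
  DIS (goodSet par H m S g)

/-- The minimum query probability `P_{min,m+1}`. -/
def pMin (par : Params) (H : Finset (𝒳 → Bool)) (m : ℕ) (S : Multiset (𝒳 × Bool × ℝ))
    (g : 𝒳 → Bool) : ℝ :=
  min (par.c₃ / (Real.sqrt (par.τ m * empErr S g / (par.n * par.eps H.card par.M))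
    + Real.log (par.τ m))) (1 / 2)

/-- The variance budget `b_{m+1}(h)`; `ν` is the marginal distribution of the data points. -/
def budget [MeasurableSpace 𝒳] (par : Params) (H : Finset (𝒳 → Bool)) (ν : Measure 𝒳) (m : ℕ)
    (S : Multiset (𝒳 × Bool × ℝ)) (g h : 𝒳 → Bool) : ℝ :=
  2 * par.α ^ 2 * ν.real {x | h x ≠ g x ∧ x ∈ region par H m S g}
    + 2 * par.β ^ 2 * par.γ * (empErr S h - empErr S g) * par.τ m * radius par H m S g
    + par.ξ * par.τ m * radius par H m S g ^ 2

/-- Feasibility of a query probability function for the optimization problem of epoch `m + 1`. -/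
structure OPFeasible [MeasurableSpace 𝒳] (par : Params) (H : Finset (𝒳 → Bool)) (ν : Measure 𝒳)
    (m : ℕ) (S : Multiset (𝒳 × Bool × ℝ)) (g : 𝒳 → Bool) (P : 𝒳 → ℝ) : Prop where
  measurable : Measurable P
  variance_le : ∀ h ∈ H,
    ∫ x, Set.indicator {x | h x ≠ g x ∧ x ∈ region par H m S g} (fun x => 1 / P x) x ∂ν
      ≤ budget par H ν m S g h
  mem_Icc : ∀ x, 0 ≤ P x ∧ P x ≤ 1
  pMin_le : ∀ x ∈ region par H m S g, pMin par H m S g ≤ P x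

/-- The objective `E_X[1 / (1 - P(X))]`, which is allowed to be infinite. -/
def opObjective [MeasurableSpace 𝒳] (ν : Measure 𝒳) (P : 𝒳 → ℝ) : ENNReal :=
  ∫⁻ x, (1 - ENNReal.ofReal (P x))⁻¹ ∂ν

/-- `P` solves the optimization problem of epoch `m + 1`. -/
def IsOPSolution [MeasurableSpace 𝒳] (par : Params) (H : Finset (𝒳 → Bool)) (ν : Measure 𝒳)
    (m : ℕ) (S : Multiset (𝒳 × Bool × ℝ)) (g : 𝒳 → Bool) (P : 𝒳 → ℝ) : Prop :=
  OPFeasible par H ν m S g P ∧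
    ∀ P', OPFeasible par H ν m S g P' → opObjective ν P ≤ opObjective ν P'

end Epoch

/-- One realization of a run: the examples `(X i, Y i)`, the numbers `U i ∈ [0, 1]` used for the
coin flips, the classifiers `h m` and the query probability functions `P m`. Examples and epochs
are numbered from `1` on; `h 1`, `P 0`, `P 1` are not used. -/
structure Realization (𝒳 : Type*) where
  X : ℕ → 𝒳
  Y : ℕ → Bool
  U : ℕ → ℝ
  h : ℕ → 𝒳 → Bool
  P : ℕ → 𝒳 → ℝ

namespace Realization

variable {𝒳 : Type*}

open Classical in
/-- The sample `Z̃_m` after epoch `m`. The labels of the first three examples are always queried.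
In epoch `m ≥ 2`, an example with `X i ∈ D_m` is queried if the coin `Q i`, which is `1` when
`U i < P m (X i)`, comes up `1`, and is given weight `0` otherwise; an example outside `D_m` gets
the label predicted by `h m` and weight `1`. -/
def sample (par : Params) (H : Finset (𝒳 → Bool)) (r : Realization 𝒳) :
    ℕ → Multiset (𝒳 × Bool × ℝ)
  | 0 => 0
  | 1 => (Finset.Ioc (par.τ 0) (par.τ 1)).val.map fun i => (r.X i, r.Y i, 1)
  | m + 2 =>
    r.sample par H (m + 1) + (Finset.Ioc (par.τ (m + 1)) (par.τ (m + 2))).val.map fun i =>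
      if r.X i ∈ region par H (m + 1) (r.sample par H (m + 1)) (r.h (m + 2)) then
        if r.U i < r.P (m + 2) (r.X i) then (r.X i, r.Y i, 1 / r.P (m + 2) (r.X i))
        else (r.X i, true, 0)
      else (r.X i, r.h (m + 2) (r.X i), 1)

/-- `r.versionSpace par H m` is the version space `A_{m+1}` computed at the end of epoch `m`. -/
def versionSpace (par : Params) (H : Finset (𝒳 → Bool)) (r : Realization 𝒳) (m : ℕ) :
    Set (𝒳 → Bool) :=
  goodSet par H m (r.sample par H m) (r.h (m + 1))

end Realization

/-- `r` is a run of the algorithm on an i.i.d. stream from `D`. The σ-algebra `ℱ i` is the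
information available after `i` examples. The draws `((X i, Y i), U i)` are i.i.d. with `(X i, Y i)`
distributed as `D` and `U i` independent of it and uniform on `[0, 1]`; so given the past and
`(X i, Y i)`, the coin `Q i = 1(U i < P m (X i))` is Bernoulli with parameter `P m (X i)`.
Any empirical error minimizers `h (m + 1)` and any solutions `P (m + 1)` of the optimization
problems may be used, as long as they are measurable functions of the information at hand. -/
structure IsRun {𝒳 Ω : Type*} [MeasurableSpace 𝒳] [mΩ : MeasurableSpace Ω] (par : Params)
    (H : Finset (𝒳 → Bool)) (D : Measure (𝒳 × Bool)) (μ : Measure Ω) (ℱ : Filtration ℕ mΩ)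
    (r : Ω → Realization 𝒳) : Prop where
  draw_measurable : ∀ i, i < par.n →
    Measurable[ℱ (i + 1)] fun ω => (((r ω).X (i + 1), (r ω).Y (i + 1)), (r ω).U (i + 1))
  draw_indep : ∀ i, i < par.n →
    Indep (MeasurableSpace.comap
      (fun ω => (((r ω).X (i + 1), (r ω).Y (i + 1)), (r ω).U (i + 1))) inferInstance) (ℱ i) μ
  draw_law : ∀ i, i < par.n →
    μ.map (fun ω => (((r ω).X (i + 1), (r ω).Y (i + 1)), (r ω).U (i + 1)))
      = D.prod (volume.restrict (Set.Icc (0 : ℝ) 1))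
  erm : ∀ ω m, 1 ≤ m → m ≤ par.M → (r ω).h (m + 1) ∈ H ∧
    ∀ f ∈ H, empErr ((r ω).sample par H m) ((r ω).h (m + 1)) ≤ empErr ((r ω).sample par H m) f
  erm_measurable : ∀ m, 1 ≤ m → m ≤ par.M → ∀ f ∈ H,
    MeasurableSet[ℱ (par.τ m)] {ω | (r ω).h (m + 1) = f}
  solution : ∀ ω m, 1 ≤ m → m < par.M →
    IsOPSolution par H D.fst m ((r ω).sample par H m) ((r ω).h (m + 1)) ((r ω).P (m + 1))
  solution_measurable : ∀ m, 1 ≤ m → m < par.M →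
    Measurable[(ℱ (par.τ m)).prod inferInstance] fun p : Ω × 𝒳 => (r p.1).P (m + 1) p.2

end ActiveCover

end

noncomputable section

namespace ActiveCover

/-! ### A Freedman type inequality for increments chosen at the start of each epoch -/

section Concentration

open scoped ENNReal

/-! Notation: X_m = τ_m Δ_m (`cumRadius`), e_m = τ_m ε_m, y_m is the weighted number of errors of
the empirical minimizer on the sample of epoch m, and μ_m (`cumMean`) sums the expected losses of h*
over the first τ_m examples, each taken given the past at the start of its epoch.

Filled-in labels are harmless. While h* stays in the version space, it agrees with the predictor
outside the disagreement region. Hence in every epoch the expected excess loss of h over h* is at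
least reg(h, h*) (`IsQueryWeight.reg_le`), and h* incurs loss only inside the region.

Concentration. Given the past, the query weights of an epoch are unbiased, and an exponential
supermartingale gives Freedman type bounds for the loss of h* and for all excess losses
(`IsRun.measure_not_concentrated_le`). The inverse temperature that suits epoch m is of order e_m /
(η X_m) and depends on the data, so the bounds are proved for a finite grid of rates. Everything
after this event is deterministic.

Induction over epochs. The constraints of the optimization problem bound the second moments of the
excess losses by μ_m, X_m and the accumulated expected regret ρ (`sum_second_moment_le`). With the
suitable rate, the deviation is at most ρ/2 + η X_m/4 (`accurate_step`). This keeps h* in the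
version space and yields τ_m reg(h, h*) ≤ 4 γ X_m on it (`τ_mul_reg_le_of_mem`).

Rate. By the low-noise condition and the disagreement coefficient, the region used after epoch j has
mass at most θ ζ (4 γ X_j/τ_j)^ω, which also bounds the expected loss of h* there. So μ_m is
controlled by earlier radii, while y_m ≤ 2 μ_m + γ X_m and the definition of Δ_m bound X_m² by e_m
μ_m and (e_m log τ_m)², up to constants. The exponent 1/(2-ω) is the fixed point of this recursion.
The induction in `cumRadius_le` closes because μ_m is affine in the inductive constant K, whereas
X_m² is compared with K². -/

theorem lintegral_comp_prodMk_of_indepFun {Ω Ω' 𝒵 : Type*} [MeasurableSpace Ω]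
    [MeasurableSpace Ω'] [MeasurableSpace 𝒵] {μ : Measure Ω} [IsProbabilityMeasure μ]
    {X : Ω → Ω'} {Z : Ω → 𝒵} (hX : Measurable X) (hZ : Measurable Z) (h : IndepFun X Z μ)
    {G : Ω' × 𝒵 → ℝ≥0∞} (hG : Measurable G) :
    ∫⁻ ω, G (X ω, Z ω) ∂μ = ∫⁻ ω, ∫⁻ z, G (X ω, z) ∂(μ.map Z) ∂μ := by
  have : IsProbabilityMeasure (μ.map Z) := Measure.isProbabilityMeasure_map hZ.aemeasurable
  rw [← lintegral_map (f := G) (g := fun ω => (X ω, Z ω)) hG (hX.prodMk hZ),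
    (indepFun_iff_map_prod_eq_prod_map_map hX.aemeasurable hZ.aemeasurable).1 h,
    lintegral_prod _ hG.aemeasurable, lintegral_map hG.lintegral_prod_right' hX]

/-- The first variable is the identity, regarded as a map into Ω with the σ-algebra `ℱ i`. A fresh
draw can thus be integrated out while everything known at time i is frozen. -/
theorem lintegral_comp_prodMk_of_indep_filtration {Ω 𝒵 : Type*} [mΩ : MeasurableSpace Ω]
    [MeasurableSpace 𝒵] {μ : Measure Ω} [IsProbabilityMeasure μ] (ℱ : Filtration ℕ mΩ) (i : ℕ)
    {Z : Ω → 𝒵} (hZ : Measurable Z)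
    (h : Indep (MeasurableSpace.comap Z inferInstance) (ℱ i) μ)
    {G : Ω × 𝒵 → ℝ≥0∞} (hG : Measurable[(ℱ i).prod inferInstance] G) :
    ∫⁻ ω, G (ω, Z ω) ∂μ = ∫⁻ ω, ∫⁻ z, G (ω, z) ∂(μ.map Z) ∂μ := by
  refine @lintegral_comp_prodMk_of_indepFun Ω Ω 𝒵 mΩ (ℱ i) _ μ _ (fun ω => ω) Z (ℱ.le i) hZ ?_ G hG
  refine (@IndepFun_iff_Indep Ω Ω 𝒵 mΩ (ℱ i) _ (fun ω => ω) Z μ).2 ?_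
  have : MeasurableSpace.comap (fun ω : Ω => ω) (ℱ i) = ℱ i := MeasurableSpace.comap_id
  rw [this]
  exact h.symm

theorem measurable_integral_snd {Ω 𝒵 : Type*} [MeasurableSpace Ω] [MeasurableSpace 𝒵]
    {ν : Measure 𝒵} [SFinite ν] {f : Ω → 𝒵 → ℝ} (hf : Measurable fun p : Ω × 𝒵 => f p.1 p.2) :
    Measurable fun ω => ∫ z, f ω z ∂ν :=
  (StronglyMeasurable.integral_prod_right hf.stronglyMeasurable).measurable

theorem measurable_exp_sub_sq {Ω 𝒵 : Type*} [MeasurableSpace Ω] [MeasurableSpace 𝒵]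
    {ν : Measure 𝒵} [SFinite ν] {f : Ω → 𝒵 → ℝ} (hf : Measurable fun p : Ω × 𝒵 => f p.1 p.2)
    {R : Ω → ℝ} (hR : Measurable R) (l : ℝ) :
    Measurable fun p : Ω × 𝒵 => {ω | l * R ω ≤ 1}.indicator
      (fun ω => l * (f ω p.2 - ∫ z, f ω z ∂ν) - l ^ 2 * ∫ z, f ω z ^ 2 ∂ν) p.1 := by
  have h1 := measurable_integral_snd (ν := ν) hf
  have h2 := measurable_integral_snd (ν := ν) (f := fun ω z => f ω z ^ 2) (hf.pow_const 2)
  have h3 : MeasurableSet {p : Ω × 𝒵 | l * R p.1 ≤ 1} :=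
    measurableSet_le ((hR.comp measurable_fst).const_mul l) measurable_const
  exact Measurable.indicator (s := {p : Ω × 𝒵 | l * R p.1 ≤ 1})
    (((hf.sub (h1.comp measurable_fst)).const_mul l).sub ((h2.comp measurable_fst).const_mul _)) h3

theorem measurable_mul_exp {Ω : Type*} [MeasurableSpace Ω] {W : Ω → ℝ≥0∞} {f : Ω → ℝ}
    (hW : Measurable W) (hf : Measurable f) :
    Measurable fun ω => W ω * ENNReal.ofReal (Real.exp (f ω)) := by
  fun_prop

/-- Fresh draws, independent of the past, do not increase the integral of an exponential weight
whose exponent has at most unit exponential moment given the past. -/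
theorem lintegral_mul_exp_sum_le {Ω 𝒵 : Type*} [mΩ : MeasurableSpace Ω] [MeasurableSpace 𝒵]
    {μ : Measure Ω} [IsProbabilityMeasure μ] {ℱ : Filtration ℕ mΩ} {Z : ℕ → Ω → 𝒵}
    {ν : Measure 𝒵} {n : ℕ}
    (hZm : ∀ i, i < n → Measurable[ℱ (i + 1)] (Z (i + 1)))
    (hZi : ∀ i, i < n → Indep (MeasurableSpace.comap (Z (i + 1)) inferInstance) (ℱ i) μ)
    (hZl : ∀ i, i < n → μ.map (Z (i + 1)) = ν)
    {a b : ℕ} (hab : a ≤ b) (hbn : b ≤ n) {W : Ω → ℝ≥0∞} (hW : Measurable[ℱ a] W)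
    {F : Ω × 𝒵 → ℝ} (hF : Measurable[(ℱ a).prod inferInstance] F)
    (hF1 : ∀ ω, ∫⁻ z, ENNReal.ofReal (Real.exp (F (ω, z))) ∂ν ≤ 1) :
    Measurable[ℱ b] (fun ω => W ω *
      ENNReal.ofReal (Real.exp (∑ i ∈ Finset.Ioc a b, F (ω, Z i ω)))) ∧
    ∫⁻ ω, W ω * ENNReal.ofReal (Real.exp (∑ i ∈ Finset.Ioc a b, F (ω, Z i ω))) ∂μ
      ≤ ∫⁻ ω, W ω ∂μ := by
  induction b, hab using Nat.le_induction with
  | base => simpa using hW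
  | succ b hab ih =>
    obtain ⟨ihm, ihl⟩ := ih (by omega)
    have hb : b < n := by omega
    set V : Ω → ℝ≥0∞ := fun ω => W ω *
      ENNReal.ofReal (Real.exp (∑ i ∈ Finset.Ioc a b, F (ω, Z i ω))) with hV
    have hsplit : ∀ ω, W ω * ENNReal.ofReal (Real.exp (∑ i ∈ Finset.Ioc a (b + 1), F (ω, Z i ω)))
        = V ω * ENNReal.ofReal (Real.exp (F (ω, Z (b + 1) ω))) := by
      intro ω
      rw [Finset.sum_Ioc_succ_top hab, Real.exp_add, ENNReal.ofReal_mul (Real.exp_pos _).le,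
        ← mul_assoc]
    have hFb : Measurable[(ℱ b).prod inferInstance] F := by
      refine hF.mono ?_ le_rfl
      exact sup_le_sup (MeasurableSpace.comap_mono (ℱ.mono hab)) le_rfl
    simp_rw [hsplit]
    constructor
    · refine @measurable_mul_exp _ (ℱ (b + 1)) _ _ ?_ ?_
      · exact ihm.mono (ℱ.mono (Nat.le_succ b)) le_rfl
      · refine hFb.comp ?_
        exact @Measurable.prodMk Ω (ℱ (b + 1)) Ω 𝒵 (ℱ b) _ _ _ (ℱ.mono (Nat.le_succ b)) (hZm b hb)
    · have hG : Measurable[(ℱ b).prod inferInstance] fun p : Ω × 𝒵 =>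
          V p.1 * ENNReal.ofReal (Real.exp (F p)) := by
        exact @measurable_mul_exp _ ((ℱ b).prod inferInstance) _ _
          (ihm.comp (@measurable_fst Ω 𝒵 (ℱ b) _)) hFb
      have key := lintegral_comp_prodMk_of_indep_filtration (μ := μ) ℱ b
        ((hZm b hb).mono (ℱ.le (b + 1)) le_rfl) (hZi b hb) hG
      simp only at key
      rw [key, hZl b hb]
      refine le_trans (lintegral_mono fun ω => ?_) ihl
      have hm : Measurable fun z => ENNReal.ofReal (Real.exp (F (ω, z))) :=
        ENNReal.measurable_ofReal.comp (Real.measurable_exp.comp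
          (hF.comp (@measurable_prodMk_left Ω 𝒵 (ℱ a) _ ω)))
      calc ∫⁻ z, V ω * ENNReal.ofReal (Real.exp (F (ω, z))) ∂ν
          = V ω * ∫⁻ z, ENNReal.ofReal (Real.exp (F (ω, z))) ∂ν := lintegral_const_mul _ hm
        _ ≤ V ω * 1 := by gcongr; exact hF1 ω
        _ = V ω := mul_one _

theorem exp_le_one_add_add_sq {x : ℝ} (hx : |x| ≤ 1) : Real.exp x ≤ 1 + x + x ^ 2 := by
  have := (abs_le.1 (Real.abs_exp_sub_one_sub_id_le hx)).2
  linarith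

theorem integrable_of_abs_le {𝒵 : Type*} [MeasurableSpace 𝒵] {ν : Measure 𝒵} [IsFiniteMeasure ν]
    {f : 𝒵 → ℝ} (hf : Measurable f) {R : ℝ} (hR : ∀ z, |f z| ≤ R) : Integrable f ν :=
  Integrable.of_bound hf.aestronglyMeasurable R (Filter.Eventually.of_forall hR)

/-- By exp x ≤ 1 + x + x² on [-1, 1], the mean of exp(l f) is at most 1 + lA + l²B ≤ exp(lA + l²B),
with A and B the first two moments of f; the normalization divides by this. -/
theorem lintegral_exp_le_one {𝒵 : Type*} [MeasurableSpace 𝒵] {ν : Measure 𝒵}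
    [IsProbabilityMeasure ν] {f : 𝒵 → ℝ} (hf : Measurable f) {R l : ℝ} (hR : ∀ z, |f z| ≤ R)
    (hl : 0 ≤ l) (hlR : l * R ≤ 1) :
    ∫⁻ z, ENNReal.ofReal (Real.exp (l * (f z - ∫ z, f z ∂ν) - l ^ 2 * ∫ z, f z ^ 2 ∂ν)) ∂ν ≤ 1 := by
  have hi : Integrable f ν := integrable_of_abs_le hf hR
  have hi2 : Integrable (fun z => f z ^ 2) ν :=
    integrable_of_abs_le (hf.pow_const 2) (R := R ^ 2) fun z => by
      rw [abs_pow]; exact pow_le_pow_left₀ (abs_nonneg _) (hR z) 2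
  set A := ∫ z, f z ∂ν
  set B := ∫ z, f z ^ 2 ∂ν
  have hpt : ∀ z, Real.exp (l * (f z - A) - l ^ 2 * B)
      ≤ Real.exp (-(l * A + l ^ 2 * B)) * (1 + l * f z + l ^ 2 * f z ^ 2) := by
    intro z
    have h1 : |l * f z| ≤ 1 := by
      rw [abs_mul, abs_of_nonneg hl]
      exact (mul_le_mul_of_nonneg_left (hR z) hl).trans hlR
    have h2 := exp_le_one_add_add_sq h1
    have : l * (f z - A) - l ^ 2 * B = -(l * A + l ^ 2 * B) + l * f z := by ring
    rw [this, Real.exp_add]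
    refine mul_le_mul_of_nonneg_left ?_ (Real.exp_pos _).le
    rw [mul_pow] at h2
    exact h2
  have hi3 : Integrable (fun z => 1 + l * f z + l ^ 2 * f z ^ 2) ν :=
    ((integrable_const _).add (hi.const_mul l)).add (hi2.const_mul _)
  have hint : ∫ z, (1 + l * f z + l ^ 2 * f z ^ 2) ∂ν = 1 + l * A + l ^ 2 * B := by
    have h1 : Integrable (fun z => 1 + l * f z) ν := (integrable_const _).add (hi.const_mul l)
    rw [integral_add h1 (hi2.const_mul _),
      integral_add (integrable_const _) (hi.const_mul l), integral_const_mul, integral_const_mul]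
    simp [A, B]
  calc ∫⁻ z, ENNReal.ofReal (Real.exp (l * (f z - A) - l ^ 2 * B)) ∂ν
      ≤ ∫⁻ z, ENNReal.ofReal
          (Real.exp (-(l * A + l ^ 2 * B)) * (1 + l * f z + l ^ 2 * f z ^ 2)) ∂ν :=
        lintegral_mono fun z => ENNReal.ofReal_le_ofReal (hpt z)
    _ = ENNReal.ofReal (∫ z, Real.exp (-(l * A + l ^ 2 * B)) *
          (1 + l * f z + l ^ 2 * f z ^ 2) ∂ν) := by
        rw [ofReal_integral_eq_lintegral_ofReal (hi3.const_mul _)]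
        exact Filter.Eventually.of_forall fun z => (Real.exp_pos _).le.trans (hpt z)
    _ ≤ 1 := by
        rw [integral_const_mul, hint, Real.exp_neg, ← ENNReal.ofReal_one]
        refine ENNReal.ofReal_le_ofReal ?_
        rw [inv_mul_le_iff₀ (Real.exp_pos _), mul_one]
        linarith [Real.add_one_le_exp (l * A + l ^ 2 * B)]

/-- A Freedman type tail bound for a process whose increments in epoch `j` are given by a function
`f j` which is known when the epoch begins. -/
theorem measure_epochSum_deviation_le {Ω 𝒵 : Type*} [mΩ : MeasurableSpace Ω] [MeasurableSpace 𝒵]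
    {μ : Measure Ω} [IsProbabilityMeasure μ] {ℱ : Filtration ℕ mΩ} {Z : ℕ → Ω → 𝒵}
    {ν : Measure 𝒵} [IsProbabilityMeasure ν] {n : ℕ}
    (hZm : ∀ i, i < n → Measurable[ℱ (i + 1)] (Z (i + 1)))
    (hZi : ∀ i, i < n → Indep (MeasurableSpace.comap (Z (i + 1)) inferInstance) (ℱ i) μ)
    (hZl : ∀ i, i < n → μ.map (Z (i + 1)) = ν)
    {t : ℕ → ℕ} {m : ℕ} (ht : ∀ j, j < m → t j ≤ t (j + 1)) (htn : ∀ j, j < m → t (j + 1) ≤ n)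
    {f : ℕ → Ω → 𝒵 → ℝ}
    (hf : ∀ j, j < m → Measurable[(ℱ (t j)).prod inferInstance] fun p : Ω × 𝒵 => f j p.1 p.2)
    {R : ℕ → Ω → ℝ} (hR : ∀ j, j < m → Measurable[ℱ (t j)] (R j))
    (hfR : ∀ j, j < m → ∀ ω z, |f j ω z| ≤ R j ω) {l : ℝ} (hl : 0 ≤ l) (a : ℝ) :
    μ {ω | (∀ j, j < m → l * R j ω ≤ 1) ∧
        a + l ^ 2 * ∑ j ∈ Finset.range m, ((t (j + 1) : ℝ) - t j) * ∫ z, f j ω z ^ 2 ∂ν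
          ≤ l * (∑ j ∈ Finset.range m, ∑ i ∈ Finset.Ioc (t j) (t (j + 1)), f j ω (Z i ω)
            - ∑ j ∈ Finset.range m, ((t (j + 1) : ℝ) - t j) * ∫ z, f j ω z ∂ν)}
      ≤ ENNReal.ofReal (Real.exp (-a)) := by
  -- The bound `R j` is random, so the exponent is switched off where `l * R j > 1`. Each factor
  -- then has conditional mean at most 1 on every path, and on the event in question nothing is
  -- switched off.
  set F : ℕ → Ω × 𝒵 → ℝ := fun j p => {ω | l * R j ω ≤ 1}.indicator
    (fun ω => l * (f j ω p.2 - ∫ z, f j ω z ∂ν) - l ^ 2 * ∫ z, f j ω z ^ 2 ∂ν) p.1 with hF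
  have hFm : ∀ j, j < m → Measurable[(ℱ (t j)).prod inferInstance] (F j) := fun j hj =>
    @measurable_exp_sub_sq Ω 𝒵 (ℱ (t j)) _ ν _ (f j) (hf j hj) (R j) (hR j hj) l
  have hF1 : ∀ j, j < m → ∀ ω, ∫⁻ z, ENNReal.ofReal (Real.exp (F j (ω, z))) ∂ν ≤ 1 := by
    intro j hj ω
    by_cases h : l * R j ω ≤ 1
    · simp only [hF, Set.indicator, Set.mem_ofPred_eq, h, if_true]
      exact lintegral_exp_le_one
        ((hf j hj).comp (@measurable_prodMk_left Ω 𝒵 (ℱ (t j)) _ ω)) (hfR j hj ω) hl h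
    · simp [hF, Set.indicator, h]
  have main : ∀ k, k ≤ m → Measurable[ℱ (t k)] (fun ω => ENNReal.ofReal (Real.exp
        (∑ j ∈ Finset.range k, ∑ i ∈ Finset.Ioc (t j) (t (j + 1)), F j (ω, Z i ω)))) ∧
      ∫⁻ ω, ENNReal.ofReal (Real.exp
        (∑ j ∈ Finset.range k, ∑ i ∈ Finset.Ioc (t j) (t (j + 1)), F j (ω, Z i ω))) ∂μ ≤ 1 := by
    intro k
    induction k with
    | zero => intro _; simp
    | succ k ih =>
      intro hk
      obtain ⟨ihm, ihl⟩ := ih (by omega)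
      obtain ⟨h1, h2⟩ := lintegral_mul_exp_sum_le hZm hZi hZl (ht k hk) (htn k hk) ihm
        (hFm k hk) (hF1 k hk)
      simp_rw [Finset.sum_range_succ, Real.exp_add, ENNReal.ofReal_mul (Real.exp_pos _).le]
      exact ⟨h1, h2.trans ihl⟩
  obtain ⟨hm1, hm2⟩ := main m le_rfl
  have hmark := mul_meas_ge_le_lintegral (μ := μ) (hm1.mono (ℱ.le _) le_rfl)
    (ENNReal.ofReal (Real.exp a))
  refine le_trans (measure_mono (t := {ω | ENNReal.ofReal (Real.exp a) ≤ ENNReal.ofReal (Real.exp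
        (∑ j ∈ Finset.range m, ∑ i ∈ Finset.Ioc (t j) (t (j + 1)), F j (ω, Z i ω)))}) ?_) ?_
  · rintro ω ⟨h1, h2⟩
    refine ENNReal.ofReal_le_ofReal (Real.exp_le_exp.2 ?_)
    have : ∑ j ∈ Finset.range m, ∑ i ∈ Finset.Ioc (t j) (t (j + 1)), F j (ω, Z i ω)
        = l * (∑ j ∈ Finset.range m, ∑ i ∈ Finset.Ioc (t j) (t (j + 1)), f j ω (Z i ω)
            - ∑ j ∈ Finset.range m, ((t (j + 1) : ℝ) - t j) * ∫ z, f j ω z ∂ν)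
          - l ^ 2 * ∑ j ∈ Finset.range m, ((t (j + 1) : ℝ) - t j) * ∫ z, f j ω z ^ 2 ∂ν := by
      rw [← Finset.sum_sub_distrib, Finset.mul_sum, Finset.mul_sum, ← Finset.sum_sub_distrib]
      refine Finset.sum_congr rfl fun j hj => ?_
      rw [Finset.mem_range] at hj
      simp only [hF, Set.indicator, Set.mem_ofPred_eq, h1 j hj, if_true]
      rw [Finset.sum_sub_distrib, ← Finset.mul_sum, Finset.sum_sub_distrib, Finset.sum_const,
        Finset.sum_const, Nat.card_Ioc, nsmul_eq_mul, nsmul_eq_mul, Nat.cast_sub (ht j hj)]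
      ring
    rw [this]
    linarith
  · have he : (0 : ℝ) < Real.exp a := Real.exp_pos a
    rw [Real.exp_neg, ENNReal.ofReal_inv_of_pos he]
    rw [ENNReal.le_inv_iff_mul_le, mul_comm]
    exact hmark.trans hm2

end Concentration

/-! ### Moments of the weighted loss within one epoch -/

section EpochLoss

variable {𝒳 : Type*}

/-- Indicator of the disagreement of two classifiers. -/
def disInd (h h' : 𝒳 → Bool) (x : 𝒳) : ℝ := if h x ≠ h' x then 1 else 0

/-- Indicator of an error of `h`. -/
def errInd (h : 𝒳 → Bool) (p : 𝒳 × Bool) : ℝ := if h p.1 ≠ p.2 then 1 else 0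

open Classical in
/-- Importance weighted loss of `h` in an epoch with query region `A`, predicted labels `g` outside
`A`, and weight `w x u` for the point `x ∈ A` when the coin shows `u`. -/
def epochLoss (A : Set 𝒳) (g : 𝒳 → Bool) (w : 𝒳 → ℝ → ℝ) (h : 𝒳 → Bool)
    (z : (𝒳 × Bool) × ℝ) : ℝ :=
  if z.1.1 ∈ A then w z.1.1 z.2 * errInd h z.1 else disInd h g z.1.1

/-- The uniform distribution on `[0, 1]`. -/
abbrev coinLaw : Measure ℝ := volume.restrict (Set.Icc (0 : ℝ) 1)

instance : IsProbabilityMeasure coinLaw := ⟨by simp [coinLaw]⟩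

theorem disInd_mem (h h' : 𝒳 → Bool) (x : 𝒳) : 0 ≤ disInd h h' x ∧ disInd h h' x ≤ 1 := by
  unfold disInd; split_ifs <;> norm_num

theorem abs_disInd_le (h h' : 𝒳 → Bool) (x : 𝒳) : |disInd h h' x| ≤ 1 := by
  unfold disInd; split_ifs <;> norm_num

theorem errInd_mem (h : 𝒳 → Bool) (p : 𝒳 × Bool) : 0 ≤ errInd h p ∧ errInd h p ≤ 1 := by
  unfold errInd; split_ifs <;> norm_num

theorem sq_errInd_sub (h h' : 𝒳 → Bool) (p : 𝒳 × Bool) :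
    (errInd h p - errInd h' p) ^ 2 = disInd h h' p.1 := by
  unfold errInd disInd
  cases h p.1 <;> cases h' p.1 <;> cases p.2 <;> simp

theorem sq_disInd_sub (h h' g : 𝒳 → Bool) (x : 𝒳) :
    (disInd h g x - disInd h' g x) ^ 2 = disInd h h' x := by
  unfold disInd
  cases h x <;> cases h' x <;> cases g x <;> simp

theorem disInd_triangle (h h' g : 𝒳 → Bool) (x : 𝒳) :
    disInd h h' x ≤ disInd h g x + disInd h' g x := by
  unfold disInd
  cases h x <;> cases h' x <;> cases g x <;> simp

theorem disInd_le_errInd_add (h h' : 𝒳 → Bool) (p : 𝒳 × Bool) :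
    disInd h h' p.1 ≤ errInd h p + errInd h' p := by
  unfold disInd errInd
  cases h p.1 <;> cases h' p.1 <;> cases p.2 <;> simp

theorem errInd_sub_le_disInd (h h' : 𝒳 → Bool) (p : 𝒳 × Bool) :
    errInd h p - errInd h' p ≤ disInd h h' p.1 := by
  unfold disInd errInd
  cases h p.1 <;> cases h' p.1 <;> cases p.2 <;> simp

theorem disInd_self (h : 𝒳 → Bool) (x : 𝒳) : disInd h h x = 0 := by simp [disInd]

theorem disInd_congr_right {h g g' : 𝒳 → Bool} {x : 𝒳} (e : g x = g' x) :
    disInd h g x = disInd h g' x := by simp [disInd, e]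

section Measurability

variable [MeasurableSpace 𝒳]

theorem measurableSet_ne {h h' : 𝒳 → Bool} (hh : Measurable h) (hh' : Measurable h') :
    MeasurableSet {x | h x ≠ h' x} :=
  (measurableSet_eq_fun hh hh').compl

@[fun_prop]
theorem measurable_disInd {h h' : 𝒳 → Bool} (hh : Measurable h) (hh' : Measurable h') :
    Measurable (disInd h h') :=
  Measurable.ite (measurableSet_ne hh hh') measurable_const measurable_const

@[fun_prop]
theorem measurable_errInd {h : 𝒳 → Bool} (hh : Measurable h) : Measurable (errInd h) :=
  Measurable.ite (measurableSet_eq_fun (hh.comp measurable_fst) measurable_snd).compl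
    measurable_const measurable_const

variable {D : Measure (𝒳 × Bool)} [IsProbabilityMeasure D]

omit [IsProbabilityMeasure D] in
theorem integral_fst {f : 𝒳 → ℝ} (hf : Measurable f) :
    ∫ x, f x ∂D.fst = ∫ p, f p.1 ∂D := by
  rw [Measure.fst, integral_map measurable_fst.aemeasurable hf.aestronglyMeasurable]

omit [IsProbabilityMeasure D] in
theorem err_eq_integral {h : 𝒳 → Bool} (hh : Measurable h) : err D h = ∫ p, errInd h p ∂D := by
  have : MeasurableSet {p : 𝒳 × Bool | h p.1 ≠ p.2} :=
    (measurableSet_eq_fun (hh.comp measurable_fst) measurable_snd).compl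
  rw [err, ← integral_indicator_one this]
  refine integral_congr_ae (Filter.Eventually.of_forall fun p => ?_)
  simp [errInd, Set.indicator]

omit [IsProbabilityMeasure D] in
theorem fst_real_eq_integral {s : Set 𝒳} (hs : MeasurableSet s) :
    D.fst.real s = ∫ p, s.indicator (fun _ => (1 : ℝ)) p.1 ∂D := by
  rw [← integral_fst (measurable_const.indicator hs)]
  exact (integral_indicator_one hs).symm

theorem integrable_of_mem_Icc {f : 𝒳 × Bool → ℝ} (hf : Measurable f)
    (h01 : ∀ p, 0 ≤ f p ∧ f p ≤ 1) : Integrable f D :=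
  integrable_of_abs_le hf (R := 1) fun p => abs_le.2 ⟨by linarith [(h01 p).1], (h01 p).2⟩

theorem integrable_errInd {h : 𝒳 → Bool} (hh : Measurable h) : Integrable (errInd h) D :=
  integrable_of_mem_Icc (measurable_errInd hh) (errInd_mem h)

theorem integrable_disInd {h h' : 𝒳 → Bool} (hh : Measurable h) (hh' : Measurable h') :
    Integrable (fun p => disInd h h' p.1) D :=
  integrable_of_mem_Icc ((measurable_disInd hh hh').comp measurable_fst)
    fun p => disInd_mem h h' p.1

open Classical in
/-- Integrating out the coin. -/
theorem integral_ite_mul {A : Set 𝒳} (hA : MeasurableSet A) {φ : 𝒳 → ℝ → ℝ}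
    (hφ : Measurable fun q : 𝒳 × ℝ => φ q.1 q.2) {R : ℝ}
    (hφR : ∀ x ∈ A, ∀ u, |φ x u| ≤ R) {Q : 𝒳 → ℝ} (hQ : ∀ x ∈ A, ∫ u, φ x u ∂coinLaw = Q x)
    {c d : 𝒳 × Bool → ℝ} (hc : Measurable c) (hd : Measurable d) (hc1 : ∀ p, |c p| ≤ 1)
    (hd1 : ∀ p, |d p| ≤ 1) :
    ∫ z : (𝒳 × Bool) × ℝ, (if z.1.1 ∈ A then φ z.1.1 z.2 * c z.1 else d z.1) ∂(D.prod coinLaw)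
      = ∫ p, (if p.1 ∈ A then Q p.1 * c p else d p) ∂D := by
  have hm : Measurable fun z : (𝒳 × Bool) × ℝ =>
      if z.1.1 ∈ A then φ z.1.1 z.2 * c z.1 else d z.1 := by
    refine Measurable.ite (hA.preimage (by fun_prop)) ?_ (by fun_prop)
    exact (hφ.comp (by fun_prop : Measurable fun z : (𝒳 × Bool) × ℝ => (z.1.1, z.2))).mul
      (by fun_prop)
  rw [integral_prod _ (integrable_of_abs_le hm (R := max R 1) fun z => ?_)]
  · refine integral_congr_ae (Filter.Eventually.of_forall fun p => ?_)
    by_cases hp : p.1 ∈ A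
    · simp only [hp, if_true]
      rw [integral_mul_const, hQ _ hp]
    · simp [hp]
  · split_ifs with hz
    · rw [abs_mul]
      calc |φ z.1.1 z.2| * |c z.1| ≤ R * 1 :=
            mul_le_mul (hφR _ hz _) (hc1 _) (abs_nonneg _) ((abs_nonneg _).trans (hφR _ hz z.2))
        _ ≤ max R 1 := by rw [mul_one]; exact le_max_left _ _
    · exact (hd1 _).trans (le_max_right _ _)

end Measurability

/-- Conditions on the query weights of an epoch: bounded by `R` and unbiased on the query region,
with second moment `q`. -/
structure IsQueryWeight [MeasurableSpace 𝒳] (A : Set 𝒳) (w : 𝒳 → ℝ → ℝ) (q : 𝒳 → ℝ) (R : ℝ) :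
    Prop where
  measurableSet : MeasurableSet A
  measurable : Measurable fun z : 𝒳 × ℝ => w z.1 z.2
  nonneg : ∀ x ∈ A, ∀ u, 0 ≤ w x u
  le : ∀ x ∈ A, ∀ u, w x u ≤ R
  one_le : 1 ≤ R
  integral_eq : ∀ x ∈ A, ∫ u, w x u ∂coinLaw = 1
  measurable_sq : Measurable q
  integral_sq : ∀ x ∈ A, ∫ u, w x u ^ 2 ∂coinLaw = q x

namespace IsQueryWeight

variable [MeasurableSpace 𝒳] {D : Measure (𝒳 × Bool)} [IsProbabilityMeasure D]
  {A : Set 𝒳} {w : 𝒳 → ℝ → ℝ} {q : 𝒳 → ℝ} {R : ℝ} (hw : IsQueryWeight A w q R)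
  {g h hs : 𝒳 → Bool}

include hw

theorem epochLoss_mem (g h : 𝒳 → Bool) (z : (𝒳 × Bool) × ℝ) :
    0 ≤ epochLoss A g w h z ∧ epochLoss A g w h z ≤ R := by
  unfold epochLoss
  split_ifs with hz
  · have h1 := errInd_mem h z.1
    have h2 := hw.nonneg _ hz z.2
    exact ⟨mul_nonneg h2 h1.1, (mul_le_of_le_one_right h2 h1.2).trans (hw.le _ hz _)⟩
  · have h1 := disInd_mem h g z.1.1
    exact ⟨h1.1, h1.2.trans hw.one_le⟩

theorem measurable_epochLoss (hg : Measurable g) (hh : Measurable h) :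
    Measurable (epochLoss A g w h) := by
  refine Measurable.ite (hw.measurableSet.preimage (by fun_prop)) ?_ (by fun_prop)
  exact (hw.measurable.comp (by fun_prop : Measurable fun z : (𝒳 × Bool) × ℝ => (z.1.1, z.2))).mul
      (by fun_prop)

theorem integrable_epochLoss (hg : Measurable g) (hh : Measurable h) :
    Integrable (epochLoss A g w h) (D.prod coinLaw) :=
  integrable_of_abs_le (hw.measurable_epochLoss hg hh) (R := R) fun z =>
    abs_le.2 ⟨by linarith [(hw.epochLoss_mem g h z).1, hw.one_le], (hw.epochLoss_mem g h z).2⟩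

open Classical in
theorem integral_epochLoss (hg : Measurable g) (hh : Measurable h) :
    ∫ z, epochLoss A g w h z ∂(D.prod coinLaw)
      = ∫ p, (if p.1 ∈ A then errInd h p else disInd h g p.1) ∂D := by
  have := integral_ite_mul (D := D) hw.measurableSet hw.measurable (R := R) (Q := fun _ => 1)
    (fun x hx u => abs_le.2 ⟨by linarith [hw.nonneg x hx u, hw.one_le], hw.le x hx u⟩)
    hw.integral_eq (measurable_errInd hh) (d := fun p => disInd h g p.1) (by fun_prop)
    (fun p => abs_le.2 ⟨by linarith [(errInd_mem h p).1], (errInd_mem h p).2⟩)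
    (fun p => abs_disInd_le h g p.1)
  simp only [one_mul] at this
  exact this

open Classical in
theorem integrable_reduced (hg : Measurable g) (hh : Measurable h) :
    Integrable (fun p : 𝒳 × Bool => if p.1 ∈ A then errInd h p else disInd h g p.1) D := by
  refine integrable_of_mem_Icc (Measurable.ite (hw.measurableSet.preimage (by fun_prop))
    (by fun_prop) (by fun_prop)) fun p => ?_
  split_ifs
  exacts [errInd_mem _ _, disInd_mem _ _ _]

/-- Filling in the labels predicted by `g` outside the query region is favorable to `hs` if `g` and
`hs` agree there. -/
theorem reg_le (hg : Measurable g) (hh : Measurable h) (hhs : Measurable hs)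
    (hgs : ∀ x, x ∉ A → g x = hs x) :
    reg D h hs ≤ ∫ z, epochLoss A g w h z ∂(D.prod coinLaw)
      - ∫ z, epochLoss A g w hs z ∂(D.prod coinLaw) := by
  classical
  rw [hw.integral_epochLoss hg hh, hw.integral_epochLoss hg hhs, reg, err_eq_integral hh,
    err_eq_integral hhs, ← integral_sub (integrable_errInd hh) (integrable_errInd hhs),
    ← integral_sub (hw.integrable_reduced hg hh) (hw.integrable_reduced hg hhs)]
  refine integral_mono ((integrable_errInd hh).sub (integrable_errInd hhs))
    ((hw.integrable_reduced hg hh).sub (hw.integrable_reduced hg hhs)) fun p => ?_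
  by_cases hp : p.1 ∈ A
  · simp [hp]
  · simp only [hp, if_false]
    rw [disInd_congr_right (h := h) (hgs _ hp), disInd_congr_right (h := hs) (hgs _ hp),
      disInd_self, sub_zero]
    exact errInd_sub_le_disInd h hs p

/-- Outside `A`, `g` and `hs` coincide, so neither incurs loss there and their true errors are the
same; inside `A` the weights are unbiased. For the predictor itself the bound `reg_le` is therefore
an equality. -/
theorem integral_epochLoss_predicted (hg : Measurable g) (hhs : Measurable hs)
    (hgs : ∀ x, x ∉ A → g x = hs x) :
    ∫ z, epochLoss A g w g z ∂(D.prod coinLaw) - ∫ z, epochLoss A g w hs z ∂(D.prod coinLaw)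
      = reg D g hs := by
  classical
  rw [hw.integral_epochLoss hg hg, hw.integral_epochLoss hg hhs, reg, err_eq_integral hg,
    err_eq_integral hhs, ← integral_sub (integrable_errInd hg) (integrable_errInd hhs),
    ← integral_sub (hw.integrable_reduced hg hg) (hw.integrable_reduced hg hhs)]
  refine integral_congr_ae (Filter.Eventually.of_forall fun p => ?_)
  by_cases hp : p.1 ∈ A
  · simp [hp]
  · simp [hp, disInd, errInd, hgs _ hp]

/-- At a point of `A`, two disagreeing classifiers cannot both match the label; elsewhere this is
the triangle inequality through `g`. -/
theorem real_ne_le (hg : Measurable g) (hh : Measurable h) (hhs : Measurable hs) :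
    D.fst.real {x | h x ≠ hs x} ≤ ∫ z, epochLoss A g w h z ∂(D.prod coinLaw)
      + ∫ z, epochLoss A g w hs z ∂(D.prod coinLaw) := by
  classical
  rw [hw.integral_epochLoss hg hh, hw.integral_epochLoss hg hhs,
    ← integral_add (hw.integrable_reduced hg hh) (hw.integrable_reduced hg hhs),
    fst_real_eq_integral (measurableSet_ne hh hhs)]
  have he : (fun p : 𝒳 × Bool => {x | h x ≠ hs x}.indicator (fun _ => (1 : ℝ)) p.1)
      = fun p => disInd h hs p.1 := by
    ext p; simp [disInd, Set.indicator]
  rw [he]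
  refine integral_mono (integrable_disInd hh hhs)
    ((hw.integrable_reduced hg hh).add (hw.integrable_reduced hg hhs)) fun p => ?_
  by_cases hp : p.1 ∈ A
  · simp only [hp, if_true]
    exact disInd_le_errInd_add h hs p
  · simp only [hp, if_false]
    exact disInd_triangle h hs g p.1

/-- Since `g` agrees with `hs` outside `A`, the loss of `hs` lives on `A`. This is how a small
disagreement region makes the empirical errors small. -/
theorem integral_epochLoss_le_real (hg : Measurable g) (hhs : Measurable hs)
    (hgs : ∀ x, x ∉ A → g x = hs x) :
    ∫ z, epochLoss A g w hs z ∂(D.prod coinLaw) ≤ D.fst.real A := by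
  classical
  rw [hw.integral_epochLoss hg hhs, fst_real_eq_integral hw.measurableSet]
  refine integral_mono (hw.integrable_reduced hg hhs) (integrable_of_mem_Icc
    ((measurable_const.indicator hw.measurableSet).comp measurable_fst) fun p => ?_) fun p => ?_
  · by_cases hp : p.1 ∈ A <;> simp [hp]
  · by_cases hp : p.1 ∈ A
    · simp only [hp, if_true, Set.indicator_of_mem]; exact (errInd_mem hs p).2
    · simp [hp, disInd, hgs _ hp]

theorem integral_sq_epochLoss_le (hg : Measurable g) (hhs : Measurable hs) :
    ∫ z, epochLoss A g w hs z ^ 2 ∂(D.prod coinLaw)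
      ≤ R * ∫ z, epochLoss A g w hs z ∂(D.prod coinLaw) := by
  rw [← integral_const_mul]
  have hb := hw.epochLoss_mem g hs
  refine integral_mono (integrable_of_abs_le ((hw.measurable_epochLoss hg hhs).pow_const 2)
    (R := R ^ 2) fun z => ?_) ((hw.integrable_epochLoss hg hhs).const_mul R) fun z => ?_
  · rw [abs_of_nonneg (sq_nonneg _)]
    exact pow_le_pow_left₀ (hb z).1 (hb z).2 2
  · have := mul_le_mul_of_nonneg_right (hb z).2 (hb z).1
    simpa only [pow_two] using this

open Classical in
-- The error indicators of two binary classifiers differ by ±1 exactly where the classifiers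
-- disagree, so the label drops out of the square.
theorem integral_sq_sub_epochLoss (g : 𝒳 → Bool) (hh : Measurable h) (hhs : Measurable hs) :
    ∫ z, (epochLoss A g w h z - epochLoss A g w hs z) ^ 2 ∂(D.prod coinLaw)
      = ∫ p, (if p.1 ∈ A then q p.1 * disInd h hs p.1 else disInd h hs p.1) ∂D := by
  have hR0 : 0 ≤ R := by linarith [hw.one_le]
  have := integral_ite_mul (D := D) hw.measurableSet (φ := fun x u => w x u ^ 2)
    (hw.measurable.pow_const 2) (R := R ^ 2) (Q := q)
    (fun x hx u => by
      rw [abs_of_nonneg (sq_nonneg _)]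
      exact pow_le_pow_left₀ (hw.nonneg x hx u) (hw.le x hx u) 2)
    hw.integral_sq (c := fun p => disInd h hs p.1) (d := fun p => disInd h hs p.1)
    (by fun_prop) (by fun_prop)
    (fun p => abs_disInd_le h hs p.1) (fun p => abs_disInd_le h hs p.1)
  rw [← this]
  congr 1
  ext z
  unfold epochLoss
  split_ifs
  · rw [← mul_sub, mul_pow, sq_errInd_sub]
  · rw [sq_disInd_sub]

theorem second_moment_mem (x : 𝒳) (hx : x ∈ A) : 0 ≤ q x ∧ q x ≤ R ^ 2 := by
  rw [← hw.integral_sq x hx]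
  refine ⟨integral_nonneg fun u => sq_nonneg _, ?_⟩
  have hb : ∀ u, w x u ^ 2 ≤ R ^ 2 := fun u => pow_le_pow_left₀ (hw.nonneg x hx u) (hw.le x hx u) 2
  calc ∫ u, w x u ^ 2 ∂coinLaw ≤ ∫ u, R ^ 2 ∂coinLaw :=
        integral_mono (integrable_of_abs_le
          ((hw.measurable.comp measurable_prodMk_left).pow_const 2) (R := R ^ 2) fun u => by
            rw [abs_of_nonneg (sq_nonneg _)]; exact hb u) (integrable_const _) hb
    _ = R ^ 2 := by simp

theorem integrable_fst_indicator {s : Set 𝒳} (hs : MeasurableSet s) (hsA : s ⊆ A) :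
    Integrable (fun p : 𝒳 × Bool => s.indicator q p.1) D := by
  refine integrable_of_abs_le ((hw.measurable_sq.indicator hs).comp measurable_fst) (R := R ^ 2)
    fun p => ?_
  by_cases hp : p.1 ∈ s
  · rw [Set.indicator_of_mem hp]
    have := hw.second_moment_mem p.1 (hsA hp)
    rw [abs_of_nonneg this.1]; exact this.2
  · rw [Set.indicator_of_notMem hp, abs_zero]; positivity

/-- Inside `A` the disagreement of `h` and `hs` is split through `g`, because the optimization
problem controls inverse probabilities only on disagreements with the empirical minimizer. -/
theorem integral_sq_sub_epochLoss_le (hg : Measurable g) (hh : Measurable h)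
    (hhs : Measurable hs) :
    ∫ z, (epochLoss A g w h z - epochLoss A g w hs z) ^ 2 ∂(D.prod coinLaw)
      ≤ ∫ x, {x | h x ≠ g x ∧ x ∈ A}.indicator q x ∂D.fst
        + ∫ x, {x | hs x ≠ g x ∧ x ∈ A}.indicator q x ∂D.fst
        + D.fst.real {x | h x ≠ hs x ∧ x ∉ A} := by
  classical
  have hA := hw.measurableSet
  have m1 : MeasurableSet {x | h x ≠ g x ∧ x ∈ A} := (measurableSet_ne hh hg).inter hA
  have m2 : MeasurableSet {x | hs x ≠ g x ∧ x ∈ A} := (measurableSet_ne hhs hg).inter hA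
  have m3 : MeasurableSet {x | h x ≠ hs x ∧ x ∉ A} := (measurableSet_ne hh hhs).inter hA.compl
  have i1 := hw.integrable_fst_indicator (D := D) m1 fun x hx => hx.2
  have i2 := hw.integrable_fst_indicator (D := D) m2 fun x hx => hx.2
  have i3 : Integrable (fun p : 𝒳 × Bool =>
      {x | h x ≠ hs x ∧ x ∉ A}.indicator (fun _ => (1 : ℝ)) p.1) D := by
    refine integrable_of_mem_Icc ((measurable_const.indicator m3).comp measurable_fst) fun p => ?_
    by_cases hp : p.1 ∈ {x | h x ≠ hs x ∧ x ∉ A}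
    · rw [Set.indicator_of_mem hp]; norm_num
    · rw [Set.indicator_of_notMem hp]; norm_num
  rw [hw.integral_sq_sub_epochLoss g hh hhs, integral_fst (hw.measurable_sq.indicator m1),
    integral_fst (hw.measurable_sq.indicator m2), fst_real_eq_integral m3,
    ← integral_add i1 i2, ← integral_add (f := fun p : 𝒳 × Bool => _ + _) (i1.add i2) i3]
  refine integral_mono_of_nonneg (Filter.Eventually.of_forall fun p => ?_) ((i1.add i2).add i3)
    (Filter.Eventually.of_forall fun p => ?_)
  · have h1 := (disInd_mem h hs p.1).1
    by_cases hp : p.1 ∈ A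
    · simpa [hp] using mul_nonneg (hw.second_moment_mem _ hp).1 h1
    · simpa [hp] using h1
  · by_cases hp : p.1 ∈ A
    · have h1 := (hw.second_moment_mem _ hp).1
      have h2 := mul_le_mul_of_nonneg_left (disInd_triangle h hs g p.1) h1
      simp only [hp, if_true, Set.indicator, Set.mem_ofPred_eq, not_true, and_false, if_false,
        and_true, add_zero]
      refine h2.trans (le_of_eq ?_)
      unfold disInd
      split_ifs <;> ring
    · simp [hp, Set.indicator, disInd]

end IsQueryWeight

end EpochLoss

/-! ### Arithmetic of the epoch schedule and the minimum query probability -/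

namespace Params.Admissible

variable {par : Params} {N : ℕ} (hp : par.Admissible N)

include hp

theorem τ_succ_le {m : ℕ} (hm : m < par.M) : par.τ m ≤ par.τ (m + 1) := by
  rcases Nat.eq_zero_or_pos m with rfl | h
  · rw [hp.τ_zero]; exact Nat.zero_le _
  · exact (hp.τ_lt m h hm).le

theorem τ_mono {j m : ℕ} (hjm : j ≤ m) (hm : m ≤ par.M) : par.τ j ≤ par.τ m := by
  induction m, hjm using Nat.le_induction with
  | base => exact le_rfl
  | succ m hjm ih => exact (ih (by omega)).trans (hp.τ_succ_le (by omega))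

theorem τ_le_n {m : ℕ} (hm : m ≤ par.M) : par.τ m ≤ par.n := hp.τ_mono hm le_rfl

theorem add_two_le_τ {m : ℕ} (h1 : 1 ≤ m) (hm : m ≤ par.M) : m + 2 ≤ par.τ m := by
  induction m, h1 using Nat.le_induction with
  | base => rw [hp.τ_one]
  | succ m h1 ih =>
    have := hp.τ_lt m h1 (by omega)
    have := ih (by omega)
    omega

theorem three_le_τ {m : ℕ} (h1 : 1 ≤ m) (hm : m ≤ par.M) : 3 ≤ par.τ m := by
  have := hp.add_two_le_τ h1 hm
  omega

theorem three_le_τ_cast {m : ℕ} (h1 : 1 ≤ m) (hm : m ≤ par.M) : (3 : ℝ) ≤ par.τ m := by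
  exact_mod_cast hp.three_le_τ h1 hm

theorem one_le_log_τ {m : ℕ} (h1 : 1 ≤ m) (hm : m ≤ par.M) : 1 ≤ Real.log (par.τ m) := by
  have h := hp.three_le_τ_cast h1 hm
  rw [Real.le_log_iff_exp_le (by linarith)]
  linarith [Real.exp_one_lt_d9]

theorem one_le_log_card_div : 1 ≤ Real.log (N / par.δ) := by
  have h1 : (3 : ℝ) ≤ Real.sqrt 192 := Real.le_sqrt_of_sq_le (by norm_num)
  have h2 := hp.card_div_δ
  rw [Real.le_log_iff_exp_le (by linarith)]
  linarith [Real.exp_one_lt_d9]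

theorem τ_mul_eps {m : ℕ} (h1 : 1 ≤ m) (hm : m ≤ par.M) :
    par.τ m * par.eps N m = 32 * (Real.log (N / par.δ) + Real.log (par.τ m)) := by
  have h := hp.three_le_τ_cast h1 hm
  rw [Params.eps]
  field_simp

theorem eps_pos {m : ℕ} (h1 : 1 ≤ m) (hm : m ≤ par.M) : 0 < par.eps N m := by
  have h := hp.three_le_τ_cast h1 hm
  have h2 := hp.one_le_log_τ h1 hm
  have h3 := hp.one_le_log_card_div
  rw [Params.eps]
  positivity

theorem τ_mul_eps_mono {j m : ℕ} (h1 : 1 ≤ j) (hjm : j ≤ m) (hm : m ≤ par.M) :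
    par.τ j * par.eps N j ≤ par.τ m * par.eps N m := by
  rw [hp.τ_mul_eps h1 (hjm.trans hm), hp.τ_mul_eps (h1.trans hjm) hm]
  have h := hp.three_le_τ_cast h1 (hjm.trans hm)
  have : (par.τ j : ℝ) ≤ par.τ m := by exact_mod_cast hp.τ_mono hjm hm
  have := Real.log_le_log (by linarith) this
  linarith

theorem le_n_mul_eps {m : ℕ} (h1 : 1 ≤ m) (hm : m ≤ par.M) :
    par.τ m * par.eps N m ≤ par.n * par.eps N par.M := hp.τ_mul_eps_mono h1 hm le_rfl

theorem n_mul_eps_ge : 64 ≤ par.n * par.eps N par.M := by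
  have h := hp.τ_mul_eps hp.one_le_M le_rfl
  have h2 := hp.one_le_log_τ hp.one_le_M le_rfl
  have h3 := hp.one_le_log_card_div
  rw [Params.n, h]
  linarith

theorem log_τ_mono {j m : ℕ} (h1 : 1 ≤ j) (hjm : j ≤ m) (hm : m ≤ par.M) :
    Real.log (par.τ j) ≤ Real.log (par.τ m) := by
  have h := hp.three_le_τ_cast h1 (hjm.trans hm)
  exact Real.log_le_log (by linarith) (by exact_mod_cast hp.τ_mono hjm hm)

end Params.Admissible

section PMin

variable {𝒳 : Type*} {par : Params} {H : Finset (𝒳 → Bool)} {m : ℕ}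
  {S : Multiset (𝒳 × Bool × ℝ)} {g : 𝒳 → Bool}

/-- The 2 in the maximum comes from the cutoff of `pMin` at 1/2, the other entry from c₃ ≥ 1. -/
theorem one_div_pMin_bounds (hp : par.Admissible H.card) (h1 : 1 ≤ m) (hm : m ≤ par.M) :
    0 < pMin par H m S g ∧ 1 ≤ 1 / pMin par H m S g ∧ 1 / pMin par H m S g ≤
      max 2 (Real.sqrt (par.τ m * empErr S g / (par.n * par.eps H.card par.M))
        + Real.log (par.τ m)) := by
  have hl := hp.one_le_log_τ h1 hm
  have hc := hp.c₃_ge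
  set s := Real.sqrt (par.τ m * empErr S g / (par.n * par.eps H.card par.M))
    + Real.log (par.τ m) with hs
  have hs1 : 1 ≤ s := by have := Real.sqrt_nonneg (par.τ m * empErr S g /
    (par.n * par.eps H.card par.M)); linarith
  have hdef : pMin par H m S g = min (par.c₃ / s) (1 / 2) := rfl
  have hpos : 0 < pMin par H m S g := by rw [hdef]; positivity
  refine ⟨hpos, ?_, ?_⟩
  · rw [le_div_iff₀ hpos, hdef]
    exact (by linarith [min_le_right (par.c₃ / s) (1 / 2)])
  · rw [div_le_iff₀ hpos, hdef]
    rcases min_choice (par.c₃ / s) (1 / 2) with h | h <;> rw [h]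
    · calc (1 : ℝ) ≤ par.c₃ := hc
        _ = s * (par.c₃ / s) := by field_simp
        _ ≤ max 2 s * (par.c₃ / s) := by gcongr; exact le_max_right _ _
    · linarith [le_max_left 2 s]

end PMin

/-! ### The weighted empirical error as a sum of epoch losses -/

namespace Realization

variable {𝒳 : Type*} (par : Params) (H : Finset (𝒳 → Bool)) (r : Realization 𝒳)

/-! For `j < M`, the index `j` refers to the epoch `j + 1`, which follows the first `τ j`
examples. -/

/-- The `i`-th draw. -/
def draw (i : ℕ) : (𝒳 × Bool) × ℝ := ((r.X i, r.Y i), r.U i)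

/-- The region in which labels may be queried after `τ j` examples. -/
def queryRegion (j : ℕ) : Set 𝒳 :=
  if j = 0 then Set.univ else region par H j (r.sample par H j) (r.h (j + 1))

/-- The labels which are filled in outside the query region. -/
def predictor (j : ℕ) : 𝒳 → Bool := if j = 0 then fun _ => true else r.h (j + 1)

/-- Weight of an example in the query region. -/
def weight (j : ℕ) (x : 𝒳) (u : ℝ) : ℝ :=
  if j = 0 then 1 else if u < r.P (j + 1) x then 1 / r.P (j + 1) x else 0

/-- Second moment of the weights. -/
def invProb (j : ℕ) (x : 𝒳) : ℝ := if j = 0 then 1 else 1 / r.P (j + 1) x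

/-- Upper bound for the weights. -/
def weightBound (j : ℕ) : ℝ :=
  if j = 0 then 1 else 1 / pMin par H j (r.sample par H j) (r.h (j + 1))

/-- Importance weighted loss of a draw among the examples after `τ j`. -/
def loss (j : ℕ) (h : 𝒳 → Bool) (z : (𝒳 × Bool) × ℝ) : ℝ :=
  epochLoss (r.queryRegion par H j) (r.predictor j) (r.weight j) h z

/-- Sum of the losses over the first `τ m` examples. -/
def cumLoss (m : ℕ) (h : 𝒳 → Bool) : ℝ :=
  ∑ j ∈ Finset.range m, ∑ i ∈ Finset.Ioc (par.τ j) (par.τ (j + 1)), r.loss par H j h (r.draw i)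

variable {par H r}

theorem card_sample (hp : par.Admissible H.card) {m : ℕ} (h1 : 1 ≤ m) (hm : m ≤ par.M) :
    Multiset.card (r.sample par H m) = par.τ m := by
  induction m, h1 using Nat.le_induction with
  | base => simp [sample, hp.τ_zero]
  | succ m h1 ih =>
    obtain ⟨m, rfl⟩ : ∃ k, m = k + 1 := ⟨m - 1, by omega⟩
    have h2 : par.τ (m + 1) ≤ par.τ (m + 2) := hp.τ_succ_le (m := m + 1) (by omega)
    rw [sample, Multiset.card_add, ih (by omega), Multiset.card_map, Finset.card_val,
      Nat.card_Ioc, Nat.add_sub_cancel' h2]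

/-- The terms match case by case: a point of the region whose coin fails counts zero on both sides,
and outside the region the stored label is the prediction, so the error indicator becomes a
disagreement indicator. The first epoch fits the scheme with the whole space as query region and
weight 1. -/
theorem sum_sample {m : ℕ} (h1 : 1 ≤ m) (h : 𝒳 → Bool) :
    ((r.sample par H m).map fun z => z.2.2 * (if h z.1 ≠ z.2.1 then (1 : ℝ) else 0)).sum
      = r.cumLoss par H m h := by
  induction m, h1 using Nat.le_induction with
  | base =>
    rw [sample, Multiset.map_map, cumLoss, Finset.sum_range_one]
    refine Finset.sum_congr rfl fun i _ => ?_
    simp only [Function.comp, loss, epochLoss, queryRegion, weight, errInd, draw, if_true,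
      Set.mem_univ]
    split_ifs <;> simp_all
  | succ m h1 ih =>
    obtain ⟨m, rfl⟩ : ∃ k, m = k + 1 := ⟨m - 1, by omega⟩
    rw [sample, Multiset.map_add, Multiset.sum_add, ih, cumLoss, cumLoss,
      Finset.sum_range_succ _ (m + 1), Multiset.map_map]
    congr 1
    refine Finset.sum_congr rfl fun i _ => ?_
    simp only [Function.comp, loss, epochLoss, queryRegion, weight, errInd, draw, predictor,
      Nat.succ_ne_zero, if_false, disInd]
    split_ifs <;> simp_all

theorem empErr_eq (hp : par.Admissible H.card) {m : ℕ} (h1 : 1 ≤ m) (hm : m ≤ par.M)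
    (h : 𝒳 → Bool) : empErr (r.sample par H m) h = r.cumLoss par H m h / par.τ m := by
  rw [empErr, sum_sample h1, card_sample hp h1 hm]

theorem τ_mul_empErr (hp : par.Admissible H.card) {m : ℕ} (h1 : 1 ≤ m) (hm : m ≤ par.M)
    (h : 𝒳 → Bool) : par.τ m * empErr (r.sample par H m) h = r.cumLoss par H m h := by
  have := hp.three_le_τ_cast h1 hm
  rw [empErr_eq hp h1 hm]
  field_simp

end Realization

/-! ### Query weights: moments and measurability -/

theorem integral_coin {p : ℝ} (h0 : 0 ≤ p) (h1 : p ≤ 1) (c : ℝ) :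
    ∫ u, (if u < p then c else 0) ∂coinLaw = p * c := by
  have h : (fun u => if u < p then c else 0) = (Set.Iio p).indicator fun _ => c := by
    ext u; simp [Set.indicator]
  have h2 : Set.Iio p ∩ Set.Icc 0 1 = Set.Ico 0 p := by
    ext u; simp only [Set.mem_inter_iff, Set.mem_Iio, Set.mem_Icc, Set.mem_Ico]
    constructor
    · rintro ⟨a, b, _⟩; exact ⟨b, a⟩
    · rintro ⟨a, b⟩; exact ⟨b, a, by linarith⟩
  rw [h, integral_indicator_const c measurableSet_Iio, measureReal_restrict_apply measurableSet_Iio,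
    h2, Real.volume_real_Ico_of_le h0, sub_zero, smul_eq_mul]

theorem measurable_add_sum {Ω ι : Type*} [MeasurableSpace Ω] {a : Ω → ℝ} {s : Finset ι}
    {b : ι → Ω → ℝ} (ha : Measurable a) (hb : ∀ i ∈ s, Measurable (b i)) :
    Measurable fun ω => a ω + ∑ i ∈ s, b i ω :=
  ha.add (Finset.measurable_fun_sum _ hb)

theorem measurable_comp_prodMk_id {Ω 𝒵 γ : Type*} [MeasurableSpace 𝒵] [MeasurableSpace γ]
    {m m' : MeasurableSpace Ω} (hm : m ≤ m') {G : Ω → 𝒵 → γ}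
    (hG : Measurable[m.prod inferInstance] fun p : Ω × 𝒵 => G p.1 p.2) {Z : Ω → 𝒵}
    (hZ : Measurable[m'] Z) : Measurable[m'] fun ω => G ω (Z ω) := by
  have h : @Measurable Ω (Ω × 𝒵) m' (m.prod inferInstance) fun ω => (ω, Z ω) :=
    @Measurable.prodMk Ω m' Ω 𝒵 m _ _ _ hm hZ
  exact hG.comp h

section Selector

variable {α β : Type*} [MeasurableSpace α] {H : Finset β} {G : α → β}

/-- Because `G` takes values in a finite set, the set splits into the pieces on which `G` is
constant. No σ-algebra on the space of classifiers is needed. -/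
theorem measurableSet_selector (hG : ∀ a, G a ∈ H)
    (hGm : ∀ f ∈ H, MeasurableSet {a | G a = f}) {S : β → Set α}
    (hS : ∀ f ∈ H, MeasurableSet (S f)) : MeasurableSet {a | a ∈ S (G a)} := by
  have : {a | a ∈ S (G a)} = ⋃ f ∈ H, {a | G a = f} ∩ S f := by
    ext a
    simp only [Set.mem_ofPred_eq, Set.mem_iUnion, Set.mem_inter_iff, exists_prop]
    constructor
    · intro h; exact ⟨G a, hG a, rfl, h⟩
    · rintro ⟨f, _, hf, h⟩; rw [hf]; exact h
  rw [this]
  exact Finset.measurableSet_biUnion _ fun f hf => (hGm f hf).inter (hS f hf)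

theorem measurable_selector {γ : Type*} [MeasurableSpace γ] (hG : ∀ a, G a ∈ H)
    (hGm : ∀ f ∈ H, MeasurableSet {a | G a = f}) {F : β → α → γ}
    (hF : ∀ f ∈ H, Measurable (F f)) : Measurable fun a => F (G a) a := fun _ ht =>
  measurableSet_selector hG hGm fun f hf => hF f hf ht

end Selector

section QueryWeight

variable {𝒳 : Type*} [MeasurableSpace 𝒳] {par : Params} {H : Finset (𝒳 → Bool)}

theorem measurableSet_DIS (hH : ∀ h ∈ H, Measurable h) {A : Set (𝒳 → Bool)} (hA : ∀ h ∈ A, h ∈ H) :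
    MeasurableSet (DIS A) := by
  classical
  have : DIS A = ⋃ h ∈ H.filter (· ∈ A), ⋃ h' ∈ H.filter (· ∈ A), {x | h x ≠ h' x} := by
    ext x
    simp only [DIS, Set.mem_ofPred_eq, Set.mem_iUnion, Finset.mem_filter, exists_prop]
    constructor
    · rintro ⟨h, hh, h', hh', hx⟩; exact ⟨h, ⟨hA h hh, hh⟩, h', ⟨hA h' hh', hh'⟩, hx⟩
    · rintro ⟨h, ⟨_, hh⟩, h', ⟨_, hh'⟩, hx⟩; exact ⟨h, hh, h', hh', hx⟩
  rw [this]
  refine Finset.measurableSet_biUnion _ fun h hh => Finset.measurableSet_biUnion _ fun h' hh' => ?_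
  exact measurableSet_ne (hH h (Finset.mem_filter.1 hh).1) (hH h' (Finset.mem_filter.1 hh').1)

/-- On the region P ≥ `pMin` > 0, so a coin of parameter P with payoff 1/P has mean 1, second moment
1/P, and values at most 1/`pMin`. -/
theorem Realization.isQueryWeight (hp : par.Admissible H.card) (hH : ∀ h ∈ H, Measurable h)
    {ν : Measure 𝒳} {r : Realization 𝒳} {j : ℕ} (hj : j < par.M)
    (hsol : 1 ≤ j → OPFeasible par H ν j (r.sample par H j) (r.h (j + 1)) (r.P (j + 1))) :
    IsQueryWeight (r.queryRegion par H j) (r.weight j) (r.invProb j) (r.weightBound par H j) := by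
  rcases Nat.eq_zero_or_pos j with rfl | h1
  · have hw : r.weight 0 = fun _ _ => 1 := by ext; simp [weight]
    have hq : r.invProb 0 = fun _ => 1 := by ext; simp [invProb]
    rw [hw, hq, queryRegion, if_pos rfl, weightBound, if_pos rfl]
    exact ⟨MeasurableSet.univ, measurable_const, fun _ _ _ => zero_le_one, fun _ _ _ => le_rfl,
      le_rfl, by simp, measurable_const, by simp⟩
  · have hj0 : j ≠ 0 := by omega
    have hs := hsol h1
    obtain ⟨b1, b2, -⟩ := one_div_pMin_bounds (S := r.sample par H j) (g := r.h (j + 1)) hp h1 hj.le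
    have hPpos : ∀ x ∈ r.queryRegion par H j, 0 < r.P (j + 1) x := fun x hx => by
      rw [queryRegion, if_neg hj0] at hx
      exact b1.trans_le (hs.pMin_le x hx)
    have hPle : ∀ x ∈ r.queryRegion par H j, 1 / r.P (j + 1) x ≤ r.weightBound par H j :=
      fun x hx => by
        rw [queryRegion, if_neg hj0] at hx
        rw [weightBound, if_neg hj0]
        exact one_div_le_one_div_of_le b1 (hs.pMin_le x hx)
    refine ⟨?_, ?_, ?_, ?_, ?_, ?_, ?_, ?_⟩
    · rw [queryRegion, if_neg hj0]
      exact measurableSet_DIS hH fun h hh => hh.1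
    · simp only [weight, if_neg hj0]
      have hP := hs.measurable
      refine Measurable.ite (measurableSet_lt measurable_snd (hP.comp measurable_fst)) ?_
        measurable_const
      exact (hP.comp measurable_fst).const_div 1
    · intro x hx u
      have := hPpos x hx
      simp only [weight, if_neg hj0]
      split_ifs <;> positivity
    · intro x hx u
      have := hPle x hx
      have h0 := hPpos x hx
      simp only [weight, if_neg hj0]
      split_ifs
      · exact this
      · exact le_trans (by positivity) this
    · rw [weightBound, if_neg hj0]; exact b2
    · intro x hx
      have h0 := hPpos x hx
      simp only [weight, if_neg hj0]
      rw [integral_coin h0.le (hs.mem_Icc x).2]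
      field_simp
    · have : r.invProb j = fun x => 1 / r.P (j + 1) x := by ext x; rw [invProb, if_neg hj0]
      rw [this]
      exact hs.measurable.const_div 1
    · intro x hx
      have h0 := hPpos x hx
      simp only [weight, invProb, if_neg hj0, ite_pow]
      rw [zero_pow two_ne_zero, integral_coin h0.le (hs.mem_Icc x).2]
      field_simp

end QueryWeight

section PastMeasurability

variable {𝒳 Ω : Type*} [MeasurableSpace 𝒳] [MeasurableSpace Ω] {par : Params}
  {H : Finset (𝒳 → Bool)} {r : Ω → Realization 𝒳} {j : ℕ}

omit [MeasurableSpace 𝒳] in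
theorem measurable_empErr_predictor
    (hemp : ∀ f ∈ H, Measurable fun ω => empErr ((r ω).sample par H j) f)
    (hmem : ∀ ω, (r ω).h (j + 1) ∈ H)
    (hsel : ∀ f ∈ H, MeasurableSet {ω | (r ω).h (j + 1) = f}) :
    Measurable fun ω => empErr ((r ω).sample par H j) ((r ω).h (j + 1)) :=
  measurable_selector hmem hsel (F := fun f ω => empErr ((r ω).sample par H j) f) hemp

omit [MeasurableSpace 𝒳] in
theorem measurable_weightBound (hj : j ≠ 0)
    (hemp : ∀ f ∈ H, Measurable fun ω => empErr ((r ω).sample par H j) f)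
    (hmem : ∀ ω, (r ω).h (j + 1) ∈ H)
    (hsel : ∀ f ∈ H, MeasurableSet {ω | (r ω).h (j + 1) = f}) :
    Measurable fun ω => (r ω).weightBound par H j := by
  have h := measurable_empErr_predictor hemp hmem hsel
  simp only [Realization.weightBound, if_neg hj, pMin]
  fun_prop

theorem measurable_loss (hj : j ≠ 0) (hH : ∀ h ∈ H, Measurable h)
    (hemp : ∀ f ∈ H, Measurable fun ω => empErr ((r ω).sample par H j) f)
    (hmem : ∀ ω, (r ω).h (j + 1) ∈ H)
    (hsel : ∀ f ∈ H, MeasurableSet {ω | (r ω).h (j + 1) = f})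
    (hP : Measurable fun p : Ω × 𝒳 => (r p.1).P (j + 1) p.2) {h : 𝒳 → Bool} (hh : h ∈ H) :
    Measurable fun p : Ω × ((𝒳 × Bool) × ℝ) => (r p.1).loss par H j h p.2 := by
  classical
  have hg := measurable_empErr_predictor hemp hmem hsel
  have hgood : ∀ f ∈ H, MeasurableSet
      {ω | f ∈ goodSet par H j ((r ω).sample par H j) ((r ω).h (j + 1))} := by
    intro f hf
    have : {ω | f ∈ goodSet par H j ((r ω).sample par H j) ((r ω).h (j + 1))} =
        {ω | empErr ((r ω).sample par H j) f - empErr ((r ω).sample par H j) ((r ω).h (j + 1))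
          ≤ par.γ * radius par H j ((r ω).sample par H j) ((r ω).h (j + 1))} := by
      ext ω; simp [goodSet, hf]
    rw [this]
    have := hemp f hf
    unfold radius
    exact measurableSet_le (by fun_prop) (by fun_prop)
  have hreg : MeasurableSet {p : Ω × ((𝒳 × Bool) × ℝ) | p.2.1.1 ∈ (r p.1).queryRegion par H j} := by
    have : {p : Ω × ((𝒳 × Bool) × ℝ) | p.2.1.1 ∈ (r p.1).queryRegion par H j} =
        ⋃ f ∈ H, ⋃ f' ∈ H,
          (Prod.fst ⁻¹' {ω | f ∈ goodSet par H j ((r ω).sample par H j) ((r ω).h (j + 1))} ∩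
          Prod.fst ⁻¹' {ω | f' ∈ goodSet par H j ((r ω).sample par H j) ((r ω).h (j + 1))}) ∩
          {p | f p.2.1.1 ≠ f' p.2.1.1} := by
      ext p
      simp only [Realization.queryRegion, if_neg hj, region, DIS, Set.mem_ofPred_eq,
        Set.mem_iUnion, Set.mem_inter_iff, Set.mem_preimage, exists_prop]
      constructor
      · rintro ⟨f, hf, f', hf', hx⟩; exact ⟨f, hf.1, f', hf'.1, ⟨hf, hf'⟩, hx⟩
      · rintro ⟨f, _, f', _, ⟨hf, hf'⟩, hx⟩; exact ⟨f, hf, f', hf', hx⟩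
    rw [this]
    refine Finset.measurableSet_biUnion _ fun f hf => Finset.measurableSet_biUnion _ fun f' hf' => ?_
    refine ((measurable_fst (hgood f hf)).inter (measurable_fst (hgood f' hf'))).inter ?_
    exact (measurableSet_ne (hH f hf) (hH f' hf')).preimage (by fun_prop)
  refine Measurable.ite hreg (Measurable.mul ?_ ?_) ?_
  · simp only [Realization.weight, if_neg hj]
    have hP' : Measurable fun p : Ω × ((𝒳 × Bool) × ℝ) => (r p.1).P (j + 1) p.2.1.1 :=
      hP.comp (by fun_prop : Measurable fun p : Ω × ((𝒳 × Bool) × ℝ) => (p.1, p.2.1.1))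
    exact Measurable.ite (measurableSet_lt (by fun_prop) hP') (hP'.const_div 1) measurable_const
  · exact (measurable_errInd (hH h hh)).comp (by fun_prop)
  · simp only [Realization.predictor, if_neg hj]
    exact measurable_selector (G := fun p : Ω × ((𝒳 × Bool) × ℝ) => (r p.1).h (j + 1))
      (fun p => hmem p.1) (fun f hf => measurable_fst (hsel f hf))
      (F := fun f p => disInd h f p.2.1.1)
      fun f hf => (measurable_disInd (hH h hh) (hH f hf)).comp (by fun_prop)

theorem measurable_loss_zero {h : 𝒳 → Bool} (hh : Measurable h) :
    Measurable fun p : Ω × ((𝒳 × Bool) × ℝ) => (r p.1).loss par H 0 h p.2 := by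
  have : (fun p : Ω × ((𝒳 × Bool) × ℝ) => (r p.1).loss par H 0 h p.2)
      = fun p => errInd h p.2.1 := by
    ext p; simp [Realization.loss, epochLoss, Realization.queryRegion, Realization.weight]
  rw [this]
  fun_prop

end PastMeasurability

/-! ### Adaptedness of the losses along a run -/

namespace IsRun

variable {𝒳 Ω : Type*} [MeasurableSpace 𝒳] [mΩ : MeasurableSpace Ω] {par : Params}
  {H : Finset (𝒳 → Bool)} {D : Measure (𝒳 × Bool)} {μ : Measure Ω} {ℱ : Filtration ℕ mΩ}
  {r : Ω → Realization 𝒳}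

/-- One half of a recursion over epochs. The region and the weight bound depend on the past sample
only through the empirical errors of the finitely many classifiers and the selected minimizer; the
other half, `measurable_cumLoss`, adds the new draws. -/
theorem measurable_loss_of_cumLoss (hr : IsRun par H D μ ℱ r) (hp : par.Admissible H.card)
    (hH : ∀ h ∈ H, Measurable h) {j : ℕ} (hj : j < par.M)
    (hcum : ∀ h ∈ H, Measurable[ℱ (par.τ j)] fun ω => (r ω).cumLoss par H j h) :
    (∀ h ∈ H, Measurable[(ℱ (par.τ j)).prod inferInstance]
      fun p : Ω × ((𝒳 × Bool) × ℝ) => (r p.1).loss par H j h p.2) ∧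
    Measurable[ℱ (par.τ j)] fun ω => (r ω).weightBound par H j := by
  rcases Nat.eq_zero_or_pos j with rfl | h1
  · refine ⟨fun h hh => @measurable_loss_zero 𝒳 Ω _ (ℱ (par.τ 0)) par H r h (hH h hh), ?_⟩
    simp only [Realization.weightBound, if_true]
    exact measurable_const
  · have hemp : ∀ f ∈ H, Measurable[ℱ (par.τ j)] fun ω => empErr ((r ω).sample par H j) f := by
      intro f hf
      simp only [Realization.empErr_eq hp h1 hj.le]
      exact (hcum f hf).div_const _
    have hmem := fun ω => (hr.erm ω j h1 hj.le).1
    have hsel := hr.erm_measurable j h1 hj.le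
    exact ⟨fun h hh => @measurable_loss 𝒳 Ω _ (ℱ (par.τ j)) par H r j (by omega) hH hemp hmem hsel
      (hr.solution_measurable j h1 hj) h hh,
      @measurable_weightBound 𝒳 Ω (ℱ (par.τ j)) par H r j (by omega) hemp hmem hsel⟩

theorem measurable_draw (hr : IsRun par H D μ ℱ r) {i : ℕ} (h1 : 1 ≤ i) (hi : i ≤ par.n) :
    Measurable[ℱ i] fun ω => (r ω).draw i := by
  obtain ⟨i, rfl⟩ : ∃ k, i = k + 1 := ⟨i - 1, by omega⟩
  exact hr.draw_measurable i (by omega)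

theorem measurable_cumLoss (hr : IsRun par H D μ ℱ r) (hp : par.Admissible H.card)
    (hH : ∀ h ∈ H, Measurable h) {m : ℕ} (hm : m ≤ par.M) :
    ∀ h ∈ H, Measurable[ℱ (par.τ m)] fun ω => (r ω).cumLoss par H m h := by
  induction m with
  | zero => intro h _; simp [Realization.cumLoss]
  | succ m ih =>
    intro h hh
    have ihm := ih (by omega)
    have hl := (hr.measurable_loss_of_cumLoss hp hH (by omega) ihm).1 h hh
    have hle := hp.τ_succ_le (m := m) (by omega)
    simp only [Realization.cumLoss, Finset.sum_range_succ]
    refine @measurable_add_sum Ω ℕ (ℱ (par.τ (m + 1))) _ _ _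
      ((ihm h hh).mono (ℱ.mono hle) le_rfl) fun i hi => ?_
    rw [Finset.mem_Ioc] at hi
    have hd := hr.measurable_draw (i := i) (by omega) (hi.2.trans (hp.τ_le_n hm))
    exact measurable_comp_prodMk_id (G := fun ω => (r ω).loss par H m h) (ℱ.mono hle) hl
      (hd.mono (ℱ.mono hi.2) le_rfl)

theorem measurable_loss (hr : IsRun par H D μ ℱ r) (hp : par.Admissible H.card)
    (hH : ∀ h ∈ H, Measurable h) {j : ℕ} (hj : j < par.M) :
    (∀ h ∈ H, Measurable[(ℱ (par.τ j)).prod inferInstance]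
      fun p : Ω × ((𝒳 × Bool) × ℝ) => (r p.1).loss par H j h p.2) ∧
    Measurable[ℱ (par.τ j)] fun ω => (r ω).weightBound par H j :=
  hr.measurable_loss_of_cumLoss hp hH hj (hr.measurable_cumLoss hp hH hj.le)

theorem isQueryWeight (hr : IsRun par H D μ ℱ r) (hp : par.Admissible H.card)
    (hH : ∀ h ∈ H, Measurable h) {j : ℕ} (hj : j < par.M) (ω : Ω) :
    IsQueryWeight ((r ω).queryRegion par H j) ((r ω).weight j) ((r ω).invProb j)
      ((r ω).weightBound par H j) :=
  Realization.isQueryWeight hp hH hj fun h1 => (hr.solution ω j h1 hj).1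

end IsRun

/-- Candidates for the inverse temperature in the exponential inequalities. -/
def Params.rate (par : Params) (k : ℕ) : ℝ := 36 / (par.η * par.c₂ * k)

/-! ### Constants and the total failure probability -/

namespace Params.Admissible

variable {par : Params} {N : ℕ} (hp : par.Admissible N)

include hp

theorem η_pos : 0 < par.η := by linarith [hp.η_ge]

theorem c₁_ge_four : 4 ≤ par.c₁ := by
  have h1 := hp.c₁_ge
  have h2 := hp.α_ge
  have h3 : (2 : ℝ) ≤ Real.sqrt 6 := Real.le_sqrt_of_sq_le (by norm_num)
  nlinarith

theorem c₁_sq_ge : 24 * par.α ^ 2 ≤ par.c₁ ^ 2 := by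
  have h1 := hp.c₁_ge
  have h2 := hp.α_ge
  have h3 : Real.sqrt 6 ^ 2 = 6 := Real.sq_sqrt (by norm_num)
  have h0 : 0 ≤ 2 * par.α * Real.sqrt 6 := by positivity
  have := pow_le_pow_left₀ h0 h1 2
  calc 24 * par.α ^ 2 = (2 * par.α * Real.sqrt 6) ^ 2 := by rw [mul_pow, h3]; ring
    _ ≤ _ := this

theorem c₂_ge_mul : 216 * par.c₁ ^ 2 ≤ par.c₂ := by
  have h1 := hp.c₂_ge
  have h2 := hp.η_ge
  nlinarith [sq_nonneg par.c₁]

theorem c₂_pos : 0 < par.c₂ := by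
  have := hp.c₁_ge_four
  have := hp.c₂_ge_mul
  nlinarith

/-- Since τ_m ≥ m + 1, the sum is dominated by the telescoping sum of 1/(m(m+1)). -/
theorem sum_inv_τ_sq_le : ∑ m ∈ Finset.Icc 1 par.M, ((par.τ m : ℝ) ^ 2)⁻¹ ≤ 1 := by
  have h : ∀ K, K ≤ par.M → ∑ m ∈ Finset.Icc 1 K, ((par.τ m : ℝ) ^ 2)⁻¹ ≤ 1 - 1 / ((K : ℝ) + 1) := by
    intro K
    induction K with
    | zero => intro _; simp
    | succ K ih =>
      intro hK
      rw [Finset.sum_Icc_succ_top (by omega)]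
      have h1 := ih (by omega)
      have h2 : ((K : ℝ) + 1) + 1 ≤ par.τ (K + 1) := by
        have := hp.add_two_le_τ (m := K + 1) (by omega) hK
        have : K + 1 + 1 ≤ par.τ (K + 1) := by omega
        exact_mod_cast this
      have hK0 : (0 : ℝ) ≤ K := Nat.cast_nonneg K
      have h3 : ((par.τ (K + 1) : ℝ) ^ 2)⁻¹ ≤ (((K : ℝ) + 1) * ((K + 1) + 1))⁻¹ := by
        apply inv_anti₀ (by positivity)
        nlinarith
      have h4 : (((K : ℝ) + 1) * ((K + 1) + 1))⁻¹ = 1 / ((K : ℝ) + 1) - 1 / ((K + 1) + 1) := by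
        field_simp
        ring
      push_cast
      linarith
  have := h par.M le_rfl
  have h0 : 0 ≤ 1 / ((par.M : ℝ) + 1) := by positivity
  linarith

/-- With x = N/δ the exponential is (x τ_m)⁻³. One factor 1/x turns N into δ, one factor 1/τ_m pays
for the τ_m rates, and the remaining τ_m⁻² is summable; x² > 192 absorbs the 4. -/
theorem sum_failure_le (hN : 0 < N) : ∑ m ∈ Finset.Icc 1 par.M,
    (N * (par.τ m * (4 * Real.exp (-(3 * (Real.log (N / par.δ) + Real.log (par.τ m)))))))
      ≤ par.δ := by
  have hN' : (0 : ℝ) < N := by exact_mod_cast hN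
  have hδ := hp.δ_pos
  set x := (N : ℝ) / par.δ with hx
  have hx0 : 0 < x := by positivity
  have hx2 : 192 < x ^ 2 := by
    have := hp.card_div_δ
    rw [← Real.sqrt_lt' hx0]
    exact this
  have hterm : ∀ m ∈ Finset.Icc 1 par.M,
      N * (par.τ m * (4 * Real.exp (-(3 * (Real.log x + Real.log (par.τ m))))))
        = (4 * par.δ / x ^ 2) * ((par.τ m : ℝ) ^ 2)⁻¹ := by
    intro m hm
    rw [Finset.mem_Icc] at hm
    have ht := hp.three_le_τ_cast hm.1 hm.2
    have ht0 : (0 : ℝ) < par.τ m := by linarith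
    have : Real.exp (-(3 * (Real.log x + Real.log (par.τ m)))) = ((x * par.τ m) ^ 3)⁻¹ := by
      rw [Real.exp_neg, ← Real.log_mul hx0.ne' ht0.ne', mul_comm (3 : ℝ),
        Real.exp_mul, Real.exp_log (by positivity)]
      norm_num
    rw [this]
    have : (N : ℝ) = x * par.δ := by rw [hx]; field_simp
    rw [this]
    field_simp
  rw [Finset.sum_congr rfl hterm, ← Finset.mul_sum]
  have h1 := hp.sum_inv_τ_sq_le
  have h2 : 4 * par.δ / x ^ 2 ≤ par.δ := by
    rw [div_le_iff₀ (by positivity)]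
    nlinarith
  calc _ ≤ 4 * par.δ / x ^ 2 * 1 := by gcongr
    _ ≤ par.δ := by linarith

end Params.Admissible

/-! ### Union bound over epochs, classifiers and rates -/

section DeviationEvent

variable {𝒳 : Type*} [MeasurableSpace 𝒳]

/-- Deviation inequalities for the empirical quantities of all epochs. -/
def Realization.Concentrated (par : Params) (H : Finset (𝒳 → Bool)) (D : Measure (𝒳 × Bool))
    (hs : 𝒳 → Bool) (r : Realization 𝒳) : Prop :=
  ∀ m, 1 ≤ m → m ≤ par.M → ∀ h ∈ H, ∀ k, 1 ≤ k → k ≤ par.τ m →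
    (∀ j, j < m → par.rate k * r.weightBound par H j ≤ 1) → ∀ c : ℝ, c = 0 ∨ c = 1 →
    par.rate k * |r.cumLoss par H m h - c * r.cumLoss par H m hs
        - ∑ j ∈ Finset.range m, ((par.τ (j + 1) : ℝ) - par.τ j)
          * ∫ z, (r.loss par H j h z - c * r.loss par H j hs z) ∂(D.prod coinLaw)|
      ≤ par.rate k ^ 2 * (∑ j ∈ Finset.range m, ((par.τ (j + 1) : ℝ) - par.τ j)
          * ∫ z, (r.loss par H j h z - c * r.loss par H j hs z) ^ 2 ∂(D.prod coinLaw))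
        + 3 * (Real.log (H.card / par.δ) + Real.log (par.τ m))

theorem measurable_mul_sub_mul {α : Type*} [MeasurableSpace α] {f g : α → ℝ} (hf : Measurable f)
    (hg : Measurable g) (s c : ℝ) : Measurable fun x => s * (f x - c * g x) :=
  (hf.sub (hg.const_mul c)).const_mul s

open scoped ENNReal in
-- For a fixed rate, each violation is a one-sided event covered by `measure_epochSum_deviation_le`.
-- The union over k is what later permits choosing the rate after seeing the data.
theorem IsRun.measure_not_concentrated_le {Ω : Type*} [mΩ : MeasurableSpace Ω] {par : Params}
    {H : Finset (𝒳 → Bool)} {D : Measure (𝒳 × Bool)} [IsProbabilityMeasure D] {μ : Measure Ω}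
    [IsProbabilityMeasure μ] {ℱ : Filtration ℕ mΩ} {r : Ω → Realization 𝒳}
    (hr : IsRun par H D μ ℱ r) (hp : par.Admissible H.card) (hH : ∀ h ∈ H, Measurable h)
    {hs : 𝒳 → Bool} (hsH : hs ∈ H) :
    μ {ω | ¬ (r ω).Concentrated par H D hs} ≤ ENNReal.ofReal par.δ := by
  set f : (𝒳 → Bool) → ℝ → ℝ → ℕ → Ω → (𝒳 × Bool) × ℝ → ℝ := fun h s c j ω z =>
    s * ((r ω).loss par H j h z - c * (r ω).loss par H j hs z) with hf
  set B : ℕ → (𝒳 → Bool) → ℕ → ℝ → ℝ → Set Ω := fun m h k s c =>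
    {ω | (∀ j, j < m → par.rate k * (r ω).weightBound par H j ≤ 1) ∧
      3 * (Real.log (H.card / par.δ) + Real.log (par.τ m))
          + par.rate k ^ 2 * ∑ j ∈ Finset.range m, ((par.τ (j + 1) : ℝ) - par.τ j)
            * ∫ z, f h s c j ω z ^ 2 ∂(D.prod coinLaw)
        ≤ par.rate k * (∑ j ∈ Finset.range m, ∑ i ∈ Finset.Ioc (par.τ j) (par.τ (j + 1)),
            f h s c j ω ((r ω).draw i)
          - ∑ j ∈ Finset.range m, ((par.τ (j + 1) : ℝ) - par.τ j)
            * ∫ z, f h s c j ω z ∂(D.prod coinLaw))} with hB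
  have hBle : ∀ m ∈ Finset.Icc 1 par.M, ∀ h ∈ H, ∀ k s c, s = 1 ∨ s = -1 → c = 0 ∨ c = 1 →
      μ (B m h k s c) ≤ ENNReal.ofReal
        (Real.exp (-(3 * (Real.log (H.card / par.δ) + Real.log (par.τ m))))) := by
    intro m hm h hh k s c hs1 hc
    rw [Finset.mem_Icc] at hm
    refine measure_epochSum_deviation_le (μ := μ) (ℱ := ℱ) (Z := fun i ω => (r ω).draw i)
      (ν := D.prod coinLaw) (n := par.n) hr.draw_measurable hr.draw_indep hr.draw_law
      (t := par.τ) (m := m) (fun j hj => hp.τ_succ_le (by omega)) (fun j hj => hp.τ_le_n (by omega))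
      (f := f h s c) ?_ (R := fun j ω => (r ω).weightBound par H j)
      (fun j hj => (hr.measurable_loss hp hH (by omega)).2) ?_ ?_ _
    · intro j hj
      have hl := (hr.measurable_loss hp hH (j := j) (by omega)).1
      exact @measurable_mul_sub_mul _ ((ℱ (par.τ j)).prod inferInstance) _ _ (hl h hh) (hl hs hsH) s c
    · intro j hj ω z
      have hq := hr.isQueryWeight hp hH (j := j) (by omega) ω
      have h1 := hq.epochLoss_mem ((r ω).predictor j) h z
      have h2 := hq.epochLoss_mem ((r ω).predictor j) hs z
      change |s * (epochLoss _ _ _ h z - c * epochLoss _ _ _ hs z)| ≤ _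
      rw [abs_le]
      -- Both losses lie in [0, R], so their difference is also bounded by R and not merely by 2R.
      rcases hs1 with rfl | rfl <;> rcases hc with rfl | rfl <;> constructor <;> linarith
    · have := hp.c₂_pos
      have := hp.η_pos
      rw [Params.rate]; positivity
  have hsub : {ω | ¬ (r ω).Concentrated par H D hs} ⊆ ⋃ m ∈ Finset.Icc 1 par.M, ⋃ h ∈ H,
      ⋃ k ∈ Finset.Icc 1 (par.τ m),
        ((B m h k 1 0 ∪ B m h k (-1) 0) ∪ (B m h k 1 1 ∪ B m h k (-1) 1)) := by
    intro ω hω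
    rw [Set.mem_ofPred_eq, Realization.Concentrated] at hω
    push Not at hω
    obtain ⟨m, h1, hm, h, hh, k, hk1, hk, hR, c, hc, hlt⟩ := hω
    simp only [Set.mem_iUnion, exists_prop]
    refine ⟨m, Finset.mem_Icc.2 ⟨h1, hm⟩, h, hh, k, Finset.mem_Icc.2 ⟨hk1, hk⟩, ?_⟩
    have key : ω ∈ B m h k 1 c ∨ ω ∈ B m h k (-1) c := by
      have e1 : ∀ s : ℝ, ∑ j ∈ Finset.range m, ∑ i ∈ Finset.Ioc (par.τ j) (par.τ (j + 1)),
            f h s c j ω ((r ω).draw i) =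
          s * ((r ω).cumLoss par H m h - c * (r ω).cumLoss par H m hs) := by
        intro s
        simp only [hf, Realization.cumLoss, ← Finset.mul_sum, Finset.sum_sub_distrib]
      have e2 : ∀ s : ℝ, ∑ j ∈ Finset.range m, ((par.τ (j + 1) : ℝ) - par.τ j)
            * ∫ z, f h s c j ω z ∂(D.prod coinLaw)
          = s * ∑ j ∈ Finset.range m, ((par.τ (j + 1) : ℝ) - par.τ j)
          * ∫ z, ((r ω).loss par H j h z - c * (r ω).loss par H j hs z) ∂(D.prod coinLaw) := by
        intro s
        rw [Finset.mul_sum]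
        refine Finset.sum_congr rfl fun j _ => ?_
        simp only [hf]
        rw [integral_const_mul]
        ring
      have e3 : ∀ s : ℝ, s ^ 2 = 1 → ∀ j, ∫ z, f h s c j ω z ^ 2 ∂(D.prod coinLaw) =
          ∫ z, ((r ω).loss par H j h z - c * (r ω).loss par H j hs z) ^ 2 ∂(D.prod coinLaw) := by
        intro s hs2 j
        simp only [hf, mul_pow, hs2, one_mul]
      have hl : 0 ≤ par.rate k := by
        have := hp.c₂_pos
        have := hp.η_pos
        rw [Params.rate]; positivity
      rcases abs_cases ((r ω).cumLoss par H m h - c * (r ω).cumLoss par H m hs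
        - ∑ j ∈ Finset.range m, ((par.τ (j + 1) : ℝ) - par.τ j)
          * ∫ z, ((r ω).loss par H j h z - c * (r ω).loss par H j hs z) ∂(D.prod coinLaw))
        with ⟨habs, -⟩ | ⟨habs, -⟩
      · left
        refine ⟨hR, ?_⟩
        rw [e1, e2]
        simp only [e3 1 (by norm_num)]
        rw [habs] at hlt
        linarith
      · right
        refine ⟨hR, ?_⟩
        rw [e1, e2]
        simp only [e3 (-1) (by norm_num)]
        rw [habs] at hlt
        refine le_trans ?_ (hlt.le.trans (le_of_eq ?_))
        · linarith
        · ring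
    rcases hc with rfl | rfl
    · exact Or.inl key
    · exact Or.inr key
  have hcard : 0 < H.card := Finset.card_pos.2 ⟨hs, hsH⟩
  refine (measure_mono hsub).trans ?_
  calc _ ≤ ∑ m ∈ Finset.Icc 1 par.M, ∑ h ∈ H, ∑ k ∈ Finset.Icc 1 (par.τ m),
        ENNReal.ofReal (4 *
          Real.exp (-(3 * (Real.log (H.card / par.δ) + Real.log (par.τ m))))) := by
        refine (measure_biUnion_finset_le _ _).trans (Finset.sum_le_sum fun m hm => ?_)
        refine (measure_biUnion_finset_le _ _).trans (Finset.sum_le_sum fun h hh => ?_)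
        refine (measure_biUnion_finset_le _ _).trans (Finset.sum_le_sum fun k hk => ?_)
        have hb := hBle m hm h hh k
        set e := Real.exp (-(3 * (Real.log (H.card / par.δ) + Real.log (par.τ m)))) with he
        have he0 : 0 ≤ e := (Real.exp_pos _).le
        -- Four events for each triple (m, h, k): two signs, for the loss itself (c = 0) and the
        -- excess loss over `hs` (c = 1).
        have hfour : ENNReal.ofReal (4 * e) = (ENNReal.ofReal e + ENNReal.ofReal e)
            + (ENNReal.ofReal e + ENNReal.ofReal e) := by
          rw [← ENNReal.ofReal_add he0 he0, ← ENNReal.ofReal_add (by linarith) (by linarith)]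
          congr 1; ring
        rw [hfour]
        refine (measure_union_le _ _).trans (add_le_add ?_ ?_) <;>
          refine (measure_union_le _ _).trans (add_le_add ?_ ?_) <;>
          apply hb <;> norm_num
    _ = ENNReal.ofReal (∑ m ∈ Finset.Icc 1 par.M, (H.card * (par.τ m * (4 *
          Real.exp (-(3 * (Real.log (H.card / par.δ) + Real.log (par.τ m)))))))) := by
        rw [ENNReal.ofReal_sum_of_nonneg fun m _ => by positivity]
        refine Finset.sum_congr rfl fun m _ => ?_
        rw [Finset.sum_const, Finset.sum_const, Nat.card_Icc, Nat.add_sub_cancel, nsmul_eq_mul,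
          nsmul_eq_mul, ENNReal.ofReal_mul (Nat.cast_nonneg _), ENNReal.ofReal_mul (p := (par.τ m : ℝ))
          (Nat.cast_nonneg _), ENNReal.ofReal_natCast, ENNReal.ofReal_natCast]
    _ ≤ ENNReal.ofReal par.δ := ENNReal.ofReal_le_ofReal (hp.sum_failure_le hcard)

end DeviationEvent

/-! ### Sums over the epoch schedule -/

namespace Params.Admissible

variable {par : Params} {N : ℕ} (hp : par.Admissible N)

include hp

theorem γ_pos : 0 < par.γ := by linarith [hp.γ_ge, hp.η_ge]

theorem τ_step_nonneg {j : ℕ} (hj : j < par.M) : 0 ≤ (par.τ (j + 1) : ℝ) - par.τ j := by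
  have : (par.τ j : ℝ) ≤ par.τ (j + 1) := by exact_mod_cast hp.τ_succ_le hj
  linarith

/-- Since b ≤ 2a for consecutive epoch ends a < b, (b - a)/a ≤ 2(1 - a/b) ≤ 2 log(b/a), and the
logarithms telescope. The sum starts at 1 because τ_0 = 0. -/
theorem sum_step_div_le {m : ℕ} (h1 : 1 ≤ m) (hm : m ≤ par.M) :
    ∑ j ∈ Finset.Ico 1 m, ((par.τ (j + 1) : ℝ) - par.τ j) / par.τ j ≤ 2 * Real.log (par.τ m) := by
  induction m, h1 using Nat.le_induction with
  | base =>
    have := hp.one_le_log_τ le_rfl hm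
    simp only [Finset.Ico_self, Finset.sum_empty]
    linarith
  | succ m h1 ih =>
    rw [Finset.sum_Ico_succ_top h1]
    have h3 := ih (by omega)
    have ht := hp.three_le_τ_cast h1 (by omega)
    have ht' := hp.three_le_τ_cast (m := m + 1) (by omega) hm
    have h2 : (par.τ (m + 1) : ℝ) ≤ 2 * par.τ m := by exact_mod_cast hp.τ_le m h1 (by omega)
    have h0 := hp.τ_step_nonneg (j := m) (by omega)
    have hlog := Real.one_sub_inv_le_log_of_pos
      (x := (par.τ (m + 1) : ℝ) / par.τ m) (by positivity)
    rw [Real.log_div (by positivity) (by positivity), inv_div] at hlog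
    have : ((par.τ (m + 1) : ℝ) - par.τ m) / par.τ m ≤ 2 * (1 - par.τ m / par.τ (m + 1)) := by
      have e : 2 * (1 - (par.τ m : ℝ) / par.τ (m + 1))
        = (2 * (par.τ (m + 1) - par.τ m)) / par.τ (m + 1) := by field_simp
      rw [e, div_le_div_iff₀ (by linarith) (by linarith)]
      nlinarith
    linarith

end Params.Admissible

section DisagreementOnRegion

variable {𝒳 : Type*} [MeasurableSpace 𝒳] {ν : Measure 𝒳} [IsFiniteMeasure ν]

theorem real_ne_inter_add {h hs : 𝒳 → Bool} {A : Set 𝒳} (hA : MeasurableSet A) :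
    ν.real {x | h x ≠ hs x ∧ x ∈ A} + ν.real {x | h x ≠ hs x ∧ x ∉ A} = ν.real {x | h x ≠ hs x} :=
  measureReal_inter_add_sdiff (μ := ν) (s := {x | h x ≠ hs x}) hA

theorem real_ne_inter_triangle (h hs g : 𝒳 → Bool) (A : Set 𝒳) :
    ν.real {x | h x ≠ g x ∧ x ∈ A}
      ≤ ν.real {x | h x ≠ hs x ∧ x ∈ A} + ν.real {x | hs x ≠ g x ∧ x ∈ A} := by
  refine (measureReal_mono ?_).trans (measureReal_union_le _ _)
  rintro x ⟨h1, h2⟩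
  by_cases h3 : h x = hs x
  · exact Or.inr ⟨fun h4 => h1 (h3.trans h4), h2⟩
  · exact Or.inl ⟨h3, h2⟩

end DisagreementOnRegion

/-! ### Deterministic estimates along one path -/

namespace Realization

variable {𝒳 : Type*} [MeasurableSpace 𝒳] {par : Params} {H : Finset (𝒳 → Bool)}
  {D : Measure (𝒳 × Bool)} {hs h : 𝒳 → Bool} {r : Realization 𝒳} {j m : ℕ}

/-- The properties of a realization of a run which hold surely. -/
structure IsPath (par : Params) (H : Finset (𝒳 → Bool)) (D : Measure (𝒳 × Bool))
    (r : Realization 𝒳) : Prop where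
  erm : ∀ m, 1 ≤ m → m ≤ par.M → r.h (m + 1) ∈ H ∧
    ∀ f ∈ H, empErr (r.sample par H m) (r.h (m + 1)) ≤ empErr (r.sample par H m) f
  feasible : ∀ j, 1 ≤ j → j < par.M →
    OPFeasible par H D.fst j (r.sample par H j) (r.h (j + 1)) (r.P (j + 1))

/-- Expected loss of a draw among the examples after `τ j`. -/
def meanLoss (par : Params) (H : Finset (𝒳 → Bool)) (D : Measure (𝒳 × Bool)) (r : Realization 𝒳)
    (j : ℕ) (h : 𝒳 → Bool) : ℝ :=
  ∫ z, r.loss par H j h z ∂(D.prod coinLaw)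

/-- Sum of the expected losses over the first `τ m` examples. -/
def cumMean (par : Params) (H : Finset (𝒳 → Bool)) (D : Measure (𝒳 × Bool)) (r : Realization 𝒳)
    (m : ℕ) (h : 𝒳 → Bool) : ℝ :=
  ∑ j ∈ Finset.range m, ((par.τ (j + 1) : ℝ) - par.τ j) * r.meanLoss par H D j h

/-- `τ m * Δ m`. -/
def cumRadius (par : Params) (H : Finset (𝒳 → Bool)) (r : Realization 𝒳) (m : ℕ) : ℝ :=
  par.τ m * radius par H m (r.sample par H m) (r.h (m + 1))

namespace IsPath

variable (hr : r.IsPath par H D) (hp : par.Admissible H.card) (hH : ∀ h ∈ H, Measurable h)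

include hr hp

theorem isQueryWeight (hH : ∀ h ∈ H, Measurable h) (hj : j < par.M) :
    IsQueryWeight (r.queryRegion par H j) (r.weight j) (r.invProb j) (r.weightBound par H j) :=
  Realization.isQueryWeight hp hH hj fun h1 => hr.feasible j h1 hj

omit hp in
theorem measurable_predictor (hH : ∀ h ∈ H, Measurable h) (hj : j < par.M) :
    Measurable (r.predictor j) := by
  unfold predictor
  split_ifs with h0
  · exact measurable_const
  · exact hH _ (hr.erm j (by omega) hj.le).1

theorem loss_nonneg (hH : ∀ h ∈ H, Measurable h) (hj : j < par.M) (h : 𝒳 → Bool)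
    (z : (𝒳 × Bool) × ℝ) : 0 ≤ r.loss par H j h z :=
  ((hr.isQueryWeight hp hH hj).epochLoss_mem _ h z).1

theorem loss_le (hH : ∀ h ∈ H, Measurable h) (hj : j < par.M) (h : 𝒳 → Bool)
    (z : (𝒳 × Bool) × ℝ) : r.loss par H j h z ≤ r.weightBound par H j :=
  ((hr.isQueryWeight hp hH hj).epochLoss_mem _ h z).2

theorem cumLoss_mono (hH : ∀ h ∈ H, Measurable h) (h : 𝒳 → Bool) (hjm : j ≤ m) (hm : m ≤ par.M) :
    r.cumLoss par H j h ≤ r.cumLoss par H m h := by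
  refine Finset.sum_le_sum_of_subset_of_nonneg (Finset.range_mono hjm) fun i hi _ => ?_
  rw [Finset.mem_range] at hi
  exact Finset.sum_nonneg fun k _ => hr.loss_nonneg hp hH (by omega) h _

theorem cumLoss_nonneg (hH : ∀ h ∈ H, Measurable h) (h : 𝒳 → Bool) (hm : m ≤ par.M) :
    0 ≤ r.cumLoss par H m h := by
  have := hr.cumLoss_mono hp hH h (Nat.zero_le m) hm
  rwa [cumLoss, Finset.range_zero, Finset.sum_empty] at this

theorem cumLoss_erm_le (h1 : 1 ≤ m) (hm : m ≤ par.M) (hh : h ∈ H) :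
    r.cumLoss par H m (r.h (m + 1)) ≤ r.cumLoss par H m h := by
  rw [← τ_mul_empErr hp h1 hm, ← τ_mul_empErr hp h1 hm]
  exact mul_le_mul_of_nonneg_left ((hr.erm m h1 hm).2 h hh) (Nat.cast_nonneg _)

theorem cumLoss_erm_mono (hH : ∀ h ∈ H, Measurable h) (h1 : 1 ≤ j) (hjm : j ≤ m)
    (hm : m ≤ par.M) :
    r.cumLoss par H j (r.h (j + 1)) ≤ r.cumLoss par H m (r.h (m + 1)) :=
  (hr.cumLoss_erm_le hp h1 (hjm.trans hm) (hr.erm m (h1.trans hjm) hm).1).trans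
    (hr.cumLoss_mono hp hH _ hjm hm)

omit hr [MeasurableSpace 𝒳] in
theorem cumRadius_eq (h1 : 1 ≤ m) (hm : m ≤ par.M) :
    r.cumRadius par H m = par.c₁ * Real.sqrt (par.τ m * par.eps H.card m
        * r.cumLoss par H m (r.h (m + 1)))
      + par.c₂ * (par.τ m * par.eps H.card m) * Real.log (par.τ m) := by
  have ht := hp.three_le_τ_cast h1 hm
  have : Real.sqrt (par.τ m * par.eps H.card m * r.cumLoss par H m (r.h (m + 1)))
      = par.τ m * Real.sqrt (par.eps H.card m * empErr (r.sample par H m) (r.h (m + 1))) := by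
    rw [← τ_mul_empErr hp h1 hm]
    conv_rhs => rw [← Real.sqrt_sq (show (0 : ℝ) ≤ par.τ m by linarith)]
    rw [← Real.sqrt_mul (by positivity)]
    congr 1; ring
  rw [this, cumRadius, radius]
  ring

theorem cumRadius_mono (hH : ∀ h ∈ H, Measurable h) (h1 : 1 ≤ j) (hjm : j ≤ m) (hm : m ≤ par.M) :
    r.cumRadius par H j ≤ r.cumRadius par H m := by
  rw [cumRadius_eq hp h1 (hjm.trans hm), cumRadius_eq hp (h1.trans hjm) hm]
  have a1 := hr.cumLoss_erm_mono hp hH h1 hjm hm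
  have a2 := hp.τ_mul_eps_mono h1 hjm hm
  have a3 := hp.log_τ_mono h1 hjm hm
  have a4 := hp.c₂_pos
  have a5 := hp.c₁_ge_four
  have a6 := hp.eps_pos h1 (hjm.trans hm)
  have a7 := hp.eps_pos (h1.trans hjm) hm
  have a8 := hp.one_le_log_τ h1 (hjm.trans hm)
  have a9 := hr.cumLoss_nonneg hp hH (r.h (j + 1)) (hjm.trans hm)
  gcongr

omit hr [MeasurableSpace 𝒳] in
theorem cumRadius_ge (h1 : 1 ≤ m) (hm : m ≤ par.M) :
    par.c₂ * (par.τ m * par.eps H.card m) * Real.log (par.τ m) ≤ r.cumRadius par H m := by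
  rw [cumRadius_eq hp h1 hm]
  have a5 := hp.c₁_ge_four
  have := Real.sqrt_nonneg (par.τ m * par.eps H.card m * r.cumLoss par H m (r.h (m + 1)))
  nlinarith

omit hr [MeasurableSpace 𝒳] in
theorem cumRadius_pos (h1 : 1 ≤ m) (hm : m ≤ par.M) : 0 < r.cumRadius par H m := by
  refine lt_of_lt_of_le ?_ (cumRadius_ge hp h1 hm)
  have a4 := hp.c₂_pos
  have a7 := hp.eps_pos h1 hm
  have a8 := hp.one_le_log_τ h1 hm
  have ht := hp.three_le_τ_cast h1 hm
  positivity

omit hr [MeasurableSpace 𝒳] in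
theorem mem_versionSpace_iff (h1 : 1 ≤ m) (hm : m ≤ par.M) :
    h ∈ r.versionSpace par H m ↔ h ∈ H ∧ r.cumLoss par H m h - r.cumLoss par H m (r.h (m + 1))
      ≤ par.γ * r.cumRadius par H m := by
  have ht := hp.three_le_τ_cast h1 hm
  rw [versionSpace, goodSet, Set.mem_ofPred_eq, ← τ_mul_empErr hp h1 hm, ← τ_mul_empErr hp h1 hm,
    cumRadius, ← mul_sub, mul_left_comm, mul_le_mul_iff_right₀ (by linarith)]

theorem erm_mem_versionSpace (h1 : 1 ≤ m) (hm : m ≤ par.M) :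
    r.h (m + 1) ∈ r.versionSpace par H m := by
  rw [mem_versionSpace_iff hp h1 hm, sub_self]
  exact ⟨(hr.erm m h1 hm).1, mul_nonneg hp.γ_pos.le (cumRadius_pos hp h1 hm).le⟩

/-- The predictor is itself in the version space, so a disagreement with `hs` at x would put x into
the region. -/
theorem predictor_eq (hj : j < par.M) (hv : 1 ≤ j → hs ∈ r.versionSpace par H j) (x : 𝒳)
    (hx : x ∉ r.queryRegion par H j) : r.predictor j x = hs x := by
  rcases Nat.eq_zero_or_pos j with rfl | h1
  · simp [queryRegion] at hx
  · have hj0 : j ≠ 0 := by omega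
    rw [queryRegion, if_neg hj0] at hx
    rw [predictor, if_neg hj0]
    by_contra hne
    exact hx ⟨_, hr.erm_mem_versionSpace hp h1 hj.le, _, hv h1, hne⟩

/-- The minimal cumulative loss grows with the epoch, so one bound at time m serves all earlier
epochs, as a single rate for the whole sum requires. The summand 2 covers the cutoff at 1/2. -/
theorem weightBound_le (hH : ∀ h ∈ H, Measurable h) (hm : m ≤ par.M) (hj : j < m) :
    r.weightBound par H j ≤ 2 + Real.sqrt (r.cumLoss par H m (r.h (m + 1))
        / (par.n * par.eps H.card par.M)) + Real.log (par.τ m) := by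
  have hl := hp.one_le_log_τ (m := m) (by omega) hm
  have hs0 := Real.sqrt_nonneg (r.cumLoss par H m (r.h (m + 1)) / (par.n * par.eps H.card par.M))
  rcases Nat.eq_zero_or_pos j with rfl | h1
  · rw [weightBound, if_pos rfl]
    linarith
  · rw [weightBound, if_neg (by omega)]
    refine (one_div_pMin_bounds hp h1 (by omega)).2.2.trans (max_le (by linarith) ?_)
    have h2 := hp.log_τ_mono h1 hj.le hm
    have h3 := hr.cumLoss_erm_mono hp hH h1 hj.le hm
    have h4 := hp.n_mul_eps_ge
    rw [τ_mul_empErr hp h1 (by omega)]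
    have h5 := Real.sqrt_le_sqrt (div_le_div_of_nonneg_right h3
      (show 0 ≤ par.n * par.eps H.card par.M by linarith))
    linarith

/-- A crude bound which serves to keep the set of rates finite. -/
theorem cumLoss_le_sq (hH : ∀ h ∈ H, Measurable h) (hm : m ≤ par.M) (h : 𝒳 → Bool) :
    r.cumLoss par H m h ≤ (par.τ m : ℝ) ^ 2 := by
  induction m generalizing h with
  | zero =>
    simp only [cumLoss, Finset.range_zero, Finset.sum_empty]
    positivity
  | succ m ih =>
    have hw : r.weightBound par H m ≤ par.τ (m + 1) := by
      have ht := hp.three_le_τ_cast (m := m + 1) (by omega) hm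
      rcases Nat.eq_zero_or_pos m with rfl | h1
      · rw [weightBound, if_pos rfl]
        linarith
      · have ht' := hp.three_le_τ_cast h1 (by omega)
        have h0 := hp.τ_step_nonneg (j := m) (by omega)
        rw [weightBound, if_neg (by omega)]
        refine (one_div_pMin_bounds hp h1 (by omega)).2.2.trans (max_le (by linarith) ?_)
        rw [τ_mul_empErr hp h1 (by omega)]
        have h4 := hp.n_mul_eps_ge
        have h5 : Real.sqrt (r.cumLoss par H m (r.h (m + 1)) / (par.n * par.eps H.card par.M))
            ≤ par.τ m / 8 := by
          rw [Real.sqrt_le_left (by positivity), div_le_iff₀ (by linarith)]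
          have := ih (by omega) (r.h (m + 1))
          nlinarith [sq_nonneg (par.τ m : ℝ)]
        -- Applied at τ/2 rather than τ, this gives log τ ≤ τ/2 because log 2 < 1, leaving room for
        -- the term τ/8.
        have h6 := Real.log_le_sub_one_of_pos (x := (par.τ m : ℝ) / 2) (by linarith)
        rw [Real.log_div (by linarith) (by norm_num)] at h6
        linarith [Real.log_two_lt_d9]
    have hle : ∑ i ∈ Finset.Ioc (par.τ m) (par.τ (m + 1)), r.loss par H m h (r.draw i)
        ≤ ((par.τ (m + 1) : ℝ) - par.τ m) * par.τ (m + 1) := by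
      refine (Finset.sum_le_card_nsmul _ _ _ fun i _ =>
        (hr.loss_le hp hH (by omega) h _).trans hw).trans (le_of_eq ?_)
      rw [Nat.card_Ioc, nsmul_eq_mul, Nat.cast_sub (hp.τ_succ_le (by omega))]
    have h0 := hp.τ_step_nonneg (j := m) (by omega)
    have h7 := ih (by omega) h
    rw [cumLoss, Finset.sum_range_succ]
    rw [cumLoss] at h7
    have : (0 : ℝ) ≤ par.τ m := Nat.cast_nonneg _
    nlinarith

variable [IsProbabilityMeasure D]

theorem reg_le_meanLoss_sub (hH : ∀ h ∈ H, Measurable h) (hj : j < par.M)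
    (hv : 1 ≤ j → hs ∈ r.versionSpace par H j) (hh : h ∈ H) (hsH : hs ∈ H) :
    reg D h hs ≤ r.meanLoss par H D j h - r.meanLoss par H D j hs :=
  (hr.isQueryWeight hp hH hj).reg_le (hr.measurable_predictor hH hj) (hH h hh) (hH hs hsH)
    (hr.predictor_eq hp hj hv)

omit [IsProbabilityMeasure D] in
theorem meanLoss_nonneg (hH : ∀ h ∈ H, Measurable h) (hj : j < par.M) (h : 𝒳 → Bool) :
    0 ≤ r.meanLoss par H D j h :=
  integral_nonneg fun z => hr.loss_nonneg hp hH hj h z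

theorem meanLoss_le_real (hH : ∀ h ∈ H, Measurable h) (hj : j < par.M)
    (hv : 1 ≤ j → hs ∈ r.versionSpace par H j) (hsH : hs ∈ H) :
    r.meanLoss par H D j hs ≤ D.fst.real (r.queryRegion par H j) :=
  (hr.isQueryWeight hp hH hj).integral_epochLoss_le_real (hr.measurable_predictor hH hj)
    (hH hs hsH) (hr.predictor_eq hp hj hv)

/-- The feasibility constraint is applied to `h` and to `hs` and the results are added. The masses
of disagreement it produces are then traded for mean losses by `real_ne_le`. -/
theorem second_moment_le (hH : ∀ h ∈ H, Measurable h) (h1 : 1 ≤ j) (hj : j < par.M)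
    (hv : hs ∈ r.versionSpace par H j) (hh : h ∈ H) (hsH : hs ∈ H) :
    ∫ z, (r.loss par H j h z - r.loss par H j hs z) ^ 2 ∂(D.prod coinLaw)
      ≤ 2 * par.α ^ 2 * ((r.meanLoss par H D j h - r.meanLoss par H D j hs)
          + 2 * reg D (r.h (j + 1)) hs + 6 * r.meanLoss par H D j hs)
        + 2 * par.β ^ 2 * par.γ * (empErr (r.sample par H j) h
            + empErr (r.sample par H j) hs - 2 * empErr (r.sample par H j) (r.h (j + 1)))
          * r.cumRadius par H j
        + 2 * par.ξ * (r.cumRadius par H j ^ 2 / par.τ j) := by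
  have hj0 : j ≠ 0 := by omega
  have hq := hr.isQueryWeight hp hH hj
  have hgm := hr.measurable_predictor hH hj
  have hagree := hr.predictor_eq hp hj fun _ => hv
  have ht := hp.three_le_τ_cast h1 hj.le
  have key := hq.integral_sq_sub_epochLoss_le (D := D) hgm (hH h hh) (hH hs hsH)
  have hpred : r.predictor j = r.h (j + 1) := by rw [predictor, if_neg hj0]
  have hreg : r.queryRegion par H j
      = region par H j (r.sample par H j) (r.h (j + 1)) := by rw [queryRegion, if_neg hj0]
  have hinv : r.invProb j = fun x => 1 / r.P (j + 1) x := by ext x; rw [invProb, if_neg hj0]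
  have f1 := (hr.feasible j h1 hj).variance_le h hh
  have f2 := (hr.feasible j h1 hj).variance_le hs hsH
  rw [← hinv, ← hreg] at f1 f2
  rw [hpred] at key
  unfold budget at f1 f2
  rw [← hreg] at f1 f2
  have t1 := real_ne_inter_triangle (ν := D.fst) h hs (r.h (j + 1)) (r.queryRegion par H j)
  have t2 := real_ne_inter_add (ν := D.fst) (h := h) (hs := hs) hq.measurableSet
  have n1 := hq.real_ne_le (D := D) hgm (hH h hh) (hH hs hsH)
  have n2 := hq.real_ne_le (D := D) hgm hgm (hH hs hsH)
  have n3 := hq.integral_epochLoss_predicted (D := D) hgm (hH hs hsH) hagree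
  have n4 : D.fst.real {x | hs x ≠ r.h (j + 1) x ∧ x ∈ r.queryRegion par H j}
      ≤ D.fst.real {x | r.predictor j x ≠ hs x} := by
    refine measureReal_mono fun x hx => ?_
    rw [hpred]
    exact fun h => hx.1 h.symm
  have n5 : 0 ≤ D.fst.real {x | h x ≠ hs x ∧ x ∉ r.queryRegion par H j} := measureReal_nonneg
  have hα := hp.α_ge
  set a := D.fst.real {x | h x ≠ r.h (j + 1) x ∧ x ∈ r.queryRegion par H j}
  set b := D.fst.real {x | hs x ≠ r.h (j + 1) x ∧ x ∈ r.queryRegion par H j}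
  set c := D.fst.real {x | h x ≠ hs x ∧ x ∈ r.queryRegion par H j}
  set d := D.fst.real {x | h x ≠ hs x ∧ x ∉ r.queryRegion par H j}
  have em : ∀ f, r.meanLoss par H D j f = ∫ z, epochLoss (r.queryRegion par H j) (r.predictor j)
      (r.weight j) f z ∂(D.prod coinLaw) := fun f => rfl
  rw [← em, ← em] at n1 n2 n3
  rw [hpred] at n2 n3 n4
  have hΔ : radius par H j (r.sample par H j) (r.h (j + 1)) = r.cumRadius par H j / par.τ j := by
    rw [cumRadius]; field_simp
  rw [hΔ] at f1 f2
  have hsplit : ∫ z, (r.loss par H j h z - r.loss par H j hs z) ^ 2 ∂(D.prod coinLaw)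
      ≤ 2 * par.α ^ 2 * (a + b) + d
        + 2 * par.β ^ 2 * par.γ * (empErr (r.sample par H j) h
            + empErr (r.sample par H j) hs - 2 * empErr (r.sample par H j) (r.h (j + 1)))
          * r.cumRadius par H j
        + 2 * par.ξ * (r.cumRadius par H j ^ 2 / par.τ j) := by
    have e1 : ∀ E : ℝ, 2 * par.β ^ 2 * par.γ * E * par.τ j * (r.cumRadius par H j / par.τ j)
        = 2 * par.β ^ 2 * par.γ * E * r.cumRadius par H j := by
      intro E; field_simp
    have e2 : par.ξ * par.τ j * (r.cumRadius par H j / par.τ j) ^ 2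
        = par.ξ * (r.cumRadius par H j ^ 2 / par.τ j) := by field_simp
    rw [e1, e2] at f1 f2
    unfold loss
    rw [hpred]
    linarith
  have hfin : 2 * par.α ^ 2 * (a + b) + d ≤ 2 * par.α ^ 2 *
      ((r.meanLoss par H D j h - r.meanLoss par H D j hs)
          + 2 * reg D (r.h (j + 1)) hs + 6 * r.meanLoss par H D j hs) := by
    have hα2 : 1 ≤ par.α ^ 2 := one_le_pow₀ hα
    -- Here a ≤ c + b, and c + d is at most the sum of the mean losses of `h` and `hs`. Moreover b
    -- is at most the regret of the minimizer plus twice the mean loss of `hs`. As b occurs twice,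
    -- the mean loss of `hs` is counted 2 + 4 = 6 times.
    have : a + b + d ≤ (r.meanLoss par H D j h - r.meanLoss par H D j hs)
          + 2 * reg D (r.h (j + 1)) hs + 6 * r.meanLoss par H D j hs := by linarith
    nlinarith
  linarith

theorem second_moment_zero_le (hH : ∀ h ∈ H, Measurable h) (hh : h ∈ H) (hsH : hs ∈ H) :
    ∫ z, (r.loss par H 0 h z - r.loss par H 0 hs z) ^ 2 ∂(D.prod coinLaw)
      ≤ r.meanLoss par H D 0 h + r.meanLoss par H D 0 hs := by
  have hq := hr.isQueryWeight hp hH (j := 0) hp.one_le_M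
  have hgm := hr.measurable_predictor hH (j := 0) hp.one_le_M
  have n1 := hq.real_ne_le (D := D) hgm (hH h hh) (hH hs hsH)
  have e := hq.integral_sq_sub_epochLoss (D := D) (r.predictor 0) (hH h hh) (hH hs hsH)
  refine le_trans (le_of_eq ?_) n1
  refine e.trans ?_
  rw [fst_real_eq_integral (measurableSet_ne (hH h hh) (hH hs hsH))]
  refine integral_congr_ae (Filter.Eventually.of_forall fun p => ?_)
  simp [queryRegion, invProb, disInd, Set.indicator]

end IsPath

end Realization

/-! ### Numerical inequalities between radius, scale and rate -/

section Arithmetic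

variable {α η c₁ c₂ e Λ y X l : ℝ}

/-- Relations between the radius `X`, the scale `e` and the rate `l` of an epoch, all multiplied by
the number of examples. -/
structure RateBounds (α η c₁ c₂ e Λ y X l : ℝ) : Prop where
  η_ge : 864 ≤ η
  α_ge : 1 ≤ α
  c₁_ge : 4 ≤ c₁
  c₁_sq_ge : 24 * α ^ 2 ≤ c₁ ^ 2
  c₂_ge : η * c₁ ^ 2 / 4 ≤ c₂
  e_pos : 0 < e
  Λ_ge : 1 ≤ Λ
  y_nonneg : 0 ≤ y
  X_eq : X = c₁ * Real.sqrt (e * y) + c₂ * e * Λ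
  l_nonneg : 0 ≤ l
  le_rate : 18 * e ≤ l * η * X
  rate_le : l * η * X ≤ 36 * e

namespace RateBounds

variable (hb : RateBounds α η c₁ c₂ e Λ y X l)

include hb

theorem radius_ge : 6 * η * α ^ 2 * e * Λ ≤ X := by
  have h1 := hb.c₁_sq_ge
  have h2 := hb.c₂_ge
  have h3 := hb.η_ge
  have h4 := hb.e_pos
  have h5 := hb.Λ_ge
  have h6 := hb.c₁_ge
  have h7 : 6 * η * α ^ 2 ≤ c₂ := by nlinarith
  have h8 : 6 * η * α ^ 2 * (e * Λ) ≤ c₂ * (e * Λ) := by gcongr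
  have h9 : 0 ≤ c₁ * Real.sqrt (e * y) := by positivity
  rw [hb.X_eq]
  linarith

theorem radius_pos : 0 < X := by
  have h3 := hb.η_ge
  have h4 := hb.e_pos
  have h5 := hb.Λ_ge
  have h6 := hb.α_ge
  exact lt_of_lt_of_le (by positivity) hb.radius_ge

theorem c₂_nonneg : 0 ≤ c₂ := by
  have h2 := hb.c₂_ge
  have h3 := hb.η_ge
  nlinarith [sq_nonneg c₁]

theorem radius_sq_ge : 24 * α ^ 2 * (e * y) ≤ X ^ 2 := by
  have h1 := hb.c₁_sq_ge
  have h2 := hb.c₂_nonneg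
  have h4 := hb.e_pos
  have h5 := hb.Λ_ge
  have h6 := hb.c₁_ge
  have h7 := hb.y_nonneg
  have h8 : c₁ * Real.sqrt (e * y) ≤ X := by
    rw [hb.X_eq]
    have : 0 ≤ c₂ * e * Λ := by positivity
    linarith
  have h9 := pow_le_pow_left₀ (by positivity) h8 2
  rw [mul_pow, Real.sq_sqrt (by positivity)] at h9
  have : 24 * α ^ 2 * (e * y) ≤ c₁ ^ 2 * (e * y) := by gcongr
  linarith

/-- Inserting X ≥ 6ηα²e into lηX ≤ 36e gives lα²η² ≤ 6. -/
theorem rate_mul_α_sq : l * α ^ 2 ≤ 6 / 864 ^ 2 := by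
  have hX := hb.radius_pos
  have h1 := hb.radius_ge
  have h2 := hb.rate_le
  have h3 := hb.η_ge
  have h4 := hb.e_pos
  have h5 := hb.Λ_ge
  have h6 : 0 ≤ η * α ^ 2 := by positivity
  have h7 : 6 * η * α ^ 2 * e ≤ X := by
    refine le_trans ?_ h1
    exact le_mul_of_one_le_right (by positivity) h5
  have h8 : (l * α ^ 2) * η ^ 2 * X ≤ 6 * X := by
    have := mul_le_mul_of_nonneg_left h2 h6
    linarith
  have h9 : (l * α ^ 2) * η ^ 2 ≤ 6 := le_of_mul_le_mul_right h8 hX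
  have h10 : (864 : ℝ) ^ 2 ≤ η ^ 2 := by gcongr
  have h11 : 0 ≤ l * α ^ 2 := mul_nonneg hb.l_nonneg (sq_nonneg α)
  rw [le_div_iff₀ (by norm_num)]
  nlinarith

theorem rate_mul_α_sq_mul_y : l * α ^ 2 * y ≤ X / 500 := by
  have hX := hb.radius_pos
  have h1 := hb.radius_sq_ge
  have h2 := hb.rate_le
  have h3 := hb.η_ge
  have h7 := hb.y_nonneg
  have h8 : (l * α ^ 2 * y) * η * X ≤ 3 / 2 * X * X := by
    have := mul_le_mul_of_nonneg_left h2 (show 0 ≤ α ^ 2 * y by positivity)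
    linarith
  have h9 : (l * α ^ 2 * y) * η ≤ 3 / 2 * X := le_of_mul_le_mul_right h8 hX
  have h11 : 0 ≤ l * α ^ 2 * y := mul_nonneg (mul_nonneg hb.l_nonneg (sq_nonneg α)) h7
  nlinarith

theorem rate_mul_α_sq_mul_radius : l * α ^ 2 * (η * Λ * X) ≤ 6 / 864 * X := by
  have hX := hb.radius_pos
  have h1 := hb.radius_ge
  have h2 := hb.rate_le
  have h3 := hb.η_ge
  have h5 := hb.Λ_ge
  have h8 : (l * α ^ 2 * (η * Λ * X)) * η ≤ 6 * X := by
    have := mul_le_mul_of_nonneg_left h2 (show 0 ≤ η * α ^ 2 * Λ by positivity)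
    linarith
  have h11 : 0 ≤ l * α ^ 2 * (η * Λ * X) :=
    mul_nonneg (mul_nonneg hb.l_nonneg (sq_nonneg α)) (by positivity)
  nlinarith

/-- Multiplied by e, the bound on W becomes 2e + √(ey) + eΛ ≤ X, so lηX ≤ 36e yields lW ≤ 36/η ≤
1/24. This makes the rate admissible for the weights and also controls the variance of the loss of
`hs`. -/
theorem rate_mul_le {W : ℝ} (hW : W ≤ 2 + Real.sqrt (y / e) + Λ) : l * W ≤ 1 / 24 := by
  have hX := hb.radius_pos
  have h2 := hb.rate_le
  have h3 := hb.η_ge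
  have h4 := hb.e_pos
  have h5 := hb.Λ_ge
  have h6 := hb.c₁_ge
  have h7 := hb.y_nonneg
  have hl := hb.l_nonneg
  have hs : e * Real.sqrt (y / e) = Real.sqrt (e * y) := by
    have : e * y = e ^ 2 * (y / e) := by field_simp
    rw [this, Real.sqrt_mul (sq_nonneg e), Real.sqrt_sq h4.le]
  have hs0 := Real.sqrt_nonneg (e * y)
  have h8 : e * (2 + Real.sqrt (y / e) + Λ) ≤ X := by
    have h9 : 3 ≤ c₂ := by
      have := hb.c₂_ge
      nlinarith
    have h10 : 3 * (e * Λ) ≤ c₂ * (e * Λ) := by gcongr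
    have h11 : Real.sqrt (e * y) ≤ c₁ * Real.sqrt (e * y) :=
      le_mul_of_one_le_left hs0 (by linarith)
    have h12 : e ≤ e * Λ := le_mul_of_one_le_right h4.le h5
    rw [hb.X_eq, mul_add, mul_add, hs]
    linarith
  have h9 : l * W ≤ l * (2 + Real.sqrt (y / e) + Λ) := by gcongr
  refine h9.trans ?_
  set w := 2 + Real.sqrt (y / e) + Λ
  have hw : 0 ≤ w := by positivity
  have h10 : l * w * η * X ≤ 36 * X := by
    have := mul_le_mul_of_nonneg_right h2 hw
    linarith
  have h11 : l * w * η ≤ 36 := le_of_mul_le_mul_right h10 hX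
  have h12 : 0 ≤ l * w := mul_nonneg hl hw
  nlinarith

theorem rate_pos : 0 < l := by
  refine lt_of_le_of_ne hb.l_nonneg fun h => ?_
  have h1 := hb.le_rate
  have h2 := hb.e_pos
  rw [← h] at h1
  linarith

/-- Division by l, with 18e ≤ lηX turning (3/32)e into lηX/192. -/
theorem le_of_rate_mul_le {d V : ℝ} (h : l * d ≤ l ^ 2 * V + 3 / 32 * e) :
    d ≤ l * V + η * X / 192 := by
  refine le_of_mul_le_mul_left ?_ hb.rate_pos
  have := hb.le_rate
  linarith

theorem error_deviation {s μ W : ℝ} (hμ : 0 ≤ μ) (hW : W ≤ 2 + Real.sqrt (y / e) + Λ)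
    (h : l * |s - μ| ≤ l ^ 2 * (W * μ) + 3 / 32 * e) : |s - μ| ≤ μ / 24 + η * X / 192 := by
  have h1 := hb.le_of_rate_mul_le h
  have h2 := mul_le_mul_of_nonneg_right (hb.rate_mul_le hW) hμ
  linarith

/-- The main contribution to lV is the term with coefficient η/216: since lηX/e ≤ 36, it becomes ρ/4
+ ηX/8. The rest is small because η ≥ 864, and μ is replaced by the observed loss y + B of `hs`. The
excess B is still unknown but enters only with a tiny factor. -/
theorem regret_deviation {ρ μ B d V : ℝ} (hρ : 0 ≤ ρ) (hB : 0 ≤ B)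
    (hμ : |y + B - μ| ≤ μ / 24 + η * X / 192)
    (hV : V ≤ 2 * α ^ 2 * (ρ + 6 * μ) + 4 * α ^ 2 * η * Λ * X
      + η / 216 * (3 / 2 * ρ + 3 / 4 * (η * X)) * (X / e) + X ^ 2 / (2 * e))
    (h : l * d ≤ l ^ 2 * V + 3 / 32 * e) :
    d ≤ ρ / 2 + 3 / 20 * (η * X) + B / 1000 := by
  have h1 := hb.le_of_rate_mul_le h
  have h2 := hb.rate_mul_α_sq
  have h3 := hb.rate_mul_α_sq_mul_y
  have h4 := hb.rate_mul_α_sq_mul_radius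
  have hX := hb.radius_pos
  have hη := hb.η_ge
  have he := hb.e_pos
  have hΛ := hb.Λ_ge
  have hl := hb.l_nonneg
  have hα : 0 ≤ l * α ^ 2 := mul_nonneg hl (sq_nonneg α)
  have hμ' : μ ≤ 24 / 23 * (y + B + η * X / 192) := by linarith [(abs_le.1 hμ).1]
  have h5 := mul_le_mul_of_nonneg_left hV hl
  have h6 : l * α ^ 2 * ρ ≤ 6 / 864 ^ 2 * ρ := by gcongr
  have h7 : l * α ^ 2 * μ ≤ 24 / 23 * (X / 500 + 6 / 864 ^ 2 * B + 6 / 864 * X / 192) := by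
    have a1 : l * α ^ 2 * μ ≤ l * α ^ 2 * (24 / 23 * (y + B + η * X / 192)) := by gcongr
    have a2 : l * α ^ 2 * B ≤ 6 / 864 ^ 2 * B := by gcongr
    have a3 : l * α ^ 2 * (η * X) ≤ l * α ^ 2 * (η * Λ * X) := by
      gcongr
      exact le_mul_of_one_le_right (by linarith) hΛ
    linarith
  have h8 : l * η * X / e ≤ 36 := by rw [div_le_iff₀ he]; exact hb.rate_le
  have h9 : l * (η / 216 * (3 / 2 * ρ + 3 / 4 * (η * X)) * (X / e))
      ≤ 36 / 216 * (3 / 2 * ρ + 3 / 4 * (η * X)) := by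
    have := mul_le_mul_of_nonneg_right h8
      (show 0 ≤ (3 / 2 * ρ + 3 / 4 * (η * X)) / 216 by positivity)
    refine le_trans (le_of_eq ?_) (this.trans (le_of_eq ?_)) <;> ring
  have h10 : l * (X ^ 2 / (2 * e)) ≤ X / 48 := by
    have a1 := mul_le_mul_of_nonneg_right h8 (show 0 ≤ X / 2 by positivity)
    have a2 : l * (X ^ 2 / (2 * e)) * η = l * η * X / e * (X / 2) := by field_simp
    have a3 : 0 ≤ l * (X ^ 2 / (2 * e)) := by positivity
    nlinarith
  have h11 : 864 * X ≤ η * X := by gcongr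
  linarith

end RateBounds

end Arithmetic

/-! ### Consequences of the conditions on ξ and β -/

namespace Params.Admissible

variable {par : Params} {N : ℕ} (hp : par.Admissible N)

include hp

/-- No sign is imposed on ξ, and monotonicity arguments need a nonnegative coefficient, so ξ is
replaced by its upper bound. The factor log n in that bound pays for the logarithm from
`sum_step_div_le`. -/
theorem ξ_mul_log_le {m : ℕ} (h1 : 1 ≤ m) (hm : m ≤ par.M) :
    ∃ ξ₀, 0 ≤ ξ₀ ∧ par.ξ ≤ ξ₀ ∧
      ξ₀ * Real.log (par.τ m) ≤ 1 / (8 * (par.τ m * par.eps N m)) := by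
  have h2 := hp.le_n_mul_eps h1 hm
  have h3 := hp.log_τ_mono h1 hm le_rfl
  have h4 := hp.one_le_log_τ h1 hm
  have h5 := hp.eps_pos h1 hm
  have h6 := hp.three_le_τ_cast h1 hm
  have h7 : 0 < par.τ m * par.eps N m := by positivity
  have h8 : Real.log (par.τ m) ≤ Real.log par.n := h3
  refine ⟨_, ?_, hp.ξ_le, ?_⟩
  · rw [mul_assoc (8 : ℝ)]
    have : 0 ≤ par.n * par.eps N par.M := by linarith
    have : 0 ≤ Real.log par.n := by linarith
    positivity
  · have e : 1 / (8 * par.n * par.eps N par.M * Real.log par.n) * Real.log (par.τ m)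
        = Real.log (par.τ m) / (8 * (par.n * par.eps N par.M) * Real.log par.n) := by ring
    rw [e, div_le_div_iff₀ (by nlinarith) (by linarith), one_mul]
    have : par.τ m * par.eps N m * Real.log (par.τ m)
        ≤ par.n * par.eps N par.M * Real.log par.n := by gcongr; linarith
    linarith

theorem β_sq_mul_log_le {m : ℕ} (h1 : 1 ≤ m) (hm : m ≤ par.M) :
    par.β ^ 2 * par.γ * Real.log (par.τ m) ≤ par.η / (864 * (par.τ m * par.eps N m)) := by
  have h2 := hp.le_n_mul_eps h1 hm
  have h3 := hp.log_τ_mono h1 hm le_rfl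
  have h4 := hp.one_le_log_τ h1 hm
  have h5 := hp.eps_pos h1 hm
  have h6 := hp.three_le_τ_cast h1 hm
  have h7 : 0 < par.τ m * par.eps N m := by positivity
  have h8 : Real.log (par.τ m) ≤ Real.log par.n := h3
  have hγ := hp.γ_pos
  have hη := hp.η_pos
  have h9 := mul_le_mul_of_nonneg_right hp.β_le
    (show 0 ≤ par.γ * Real.log (par.τ m) by positivity)
  rw [← mul_assoc] at h9
  refine h9.trans ?_
  have h10 : 0 < par.n * par.eps N par.M := by linarith
  have h11 : 0 < Real.log par.n := by linarith
  have e : par.η / (864 * par.γ * par.n * par.eps N par.M * Real.log par.n)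
      * (par.γ * Real.log (par.τ m))
      = par.η * Real.log (par.τ m) / (864 * (par.n * par.eps N par.M * Real.log par.n)) := by
    have : par.n * par.eps N par.M ≠ 0 := h10.ne'
    have hn : (par.n : ℝ) ≠ 0 := left_ne_zero_of_mul this
    have hε : par.eps N par.M ≠ 0 := right_ne_zero_of_mul this
    field_simp
  rw [e, div_le_div_iff₀ (by positivity) (by positivity)]
  have : par.τ m * par.eps N m * Real.log (par.τ m)
        ≤ par.n * par.eps N par.M * Real.log par.n := by gcongr
  have := mul_le_mul_of_nonneg_left this hη.le
  linarith

end Params.Admissible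

/-! ### Induction over epochs: `hs` survives and empirical regrets are accurate -/

namespace Realization

variable {𝒳 : Type*} [MeasurableSpace 𝒳] {par : Params} {H : Finset (𝒳 → Bool)}
  {D : Measure (𝒳 × Bool)} {hs h : 𝒳 → Bool} {r : Realization 𝒳} {j m : ℕ}

/-- Excess of `cumMean` over that of `hs`. -/
def cumRegret (par : Params) (H : Finset (𝒳 → Bool)) (D : Measure (𝒳 × Bool)) (hs : 𝒳 → Bool)
    (r : Realization 𝒳) (m : ℕ) (h : 𝒳 → Bool) : ℝ :=
  ∑ j ∈ Finset.range m, ((par.τ (j + 1) : ℝ) - par.τ j)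
    * (r.meanLoss par H D j h - r.meanLoss par H D j hs)

/-- The version space contains `hs`, and empirical regrets are close to their expectations. -/
structure Accurate (par : Params) (H : Finset (𝒳 → Bool)) (D : Measure (𝒳 × Bool))
    (hs : 𝒳 → Bool) (r : Realization 𝒳) (m : ℕ) : Prop where
  mem : hs ∈ r.versionSpace par H m
  regret : ∀ h ∈ H, |r.cumLoss par H m h - r.cumLoss par H m hs - r.cumRegret par H D hs m h|
    ≤ r.cumRegret par H D hs m h / 2 + par.η / 4 * r.cumRadius par H m

namespace IsPath

variable [IsProbabilityMeasure D] (hr : r.IsPath par H D) (hp : par.Admissible H.card)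
  (hH : ∀ h ∈ H, Measurable h) (hmin : IsErrMinimizer D H hs)

include hr hp hH hmin

theorem meanLoss_sub_nonneg (hj : j < par.M) (hv : 1 ≤ j → hs ∈ r.versionSpace par H j)
    (hh : h ∈ H) : 0 ≤ r.meanLoss par H D j h - r.meanLoss par H D j hs := by
  have h1 := hr.reg_le_meanLoss_sub hp hH hj hv hh hmin.1
  have h2 : 0 ≤ reg D h hs := sub_nonneg.2 (hmin.2 h hh)
  linarith

theorem cumRegret_mono (hm : m ≤ par.M)
    (hv : ∀ i, 1 ≤ i → i < m → hs ∈ r.versionSpace par H i) (hh : h ∈ H) (hjm : j ≤ m) :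
    r.cumRegret par H D hs j h ≤ r.cumRegret par H D hs m h := by
  refine Finset.sum_le_sum_of_subset_of_nonneg (Finset.range_mono hjm) fun i hi _ => ?_
  rw [Finset.mem_range] at hi
  exact mul_nonneg (hp.τ_step_nonneg (by omega))
    (hr.meanLoss_sub_nonneg hp hH hmin (by omega) (fun h1 => hv i h1 hi) hh)

theorem cumRegret_nonneg (hm : m ≤ par.M)
    (hv : ∀ i, 1 ≤ i → i < m → hs ∈ r.versionSpace par H i) (hh : h ∈ H) :
    0 ≤ r.cumRegret par H D hs m h := by
  have := hr.cumRegret_mono hp hH hmin hm hv hh (Nat.zero_le m)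
  rwa [cumRegret, Finset.range_zero, Finset.sum_empty] at this

theorem τ_mul_reg_le (hm : m ≤ par.M)
    (hv : ∀ i, 1 ≤ i → i < m → hs ∈ r.versionSpace par H i) (hh : h ∈ H) :
    par.τ m * reg D h hs ≤ r.cumRegret par H D hs m h := by
  have h1 : (par.τ m : ℝ) * reg D h hs
      = ∑ j ∈ Finset.range m, ((par.τ (j + 1) : ℝ) - par.τ j) * reg D h hs := by
    rw [← Finset.sum_mul, Finset.sum_range_sub (fun i => (par.τ i : ℝ)), hp.τ_zero]
    simp
  rw [h1]
  refine Finset.sum_le_sum fun i hi => ?_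
  rw [Finset.mem_range] at hi
  exact mul_le_mul_of_nonneg_left
    (hr.reg_le_meanLoss_sub hp hH (by omega) (fun h1 => hv i h1 hi) hh hmin.1)
    (hp.τ_step_nonneg (by omega))

/-- The minimizer has nonpositive empirical excess over `hs`, so accuracy forces its expected
excess, and the empirical excess of `hs` over it, below the error term. -/
theorem erm_accuracy (h1 : 1 ≤ m) (hm : m ≤ par.M)
    (hv : ∀ i, 1 ≤ i → i < m → hs ∈ r.versionSpace par H i) (ha : r.Accurate par H D hs m) :
    par.τ m * reg D (r.h (m + 1)) hs ≤ par.η / 2 * r.cumRadius par H m ∧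
    r.cumLoss par H m hs - r.cumLoss par H m (r.h (m + 1)) ≤ par.η / 4 * r.cumRadius par H m := by
  have hg := (hr.erm m h1 hm).1
  have a1 := ha.regret _ hg
  have a2 := hr.cumRegret_nonneg hp hH hmin hm hv hg
  have a3 := hr.τ_mul_reg_le hp hH hmin hm hv hg
  have a4 := hr.cumLoss_erm_le hp h1 hm hmin.1
  have a5 := (abs_le.1 a1).1
  constructor <;> linarith

/-- Accuracy at time j turns empirical quantities into expected ones, and monotonicity replaces
radius and regret at time j by those at time m. Apart from the mean losses, j remains only in the
factor 1/τ_j, which sums to a logarithm. -/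
theorem second_moment_le_of_accurate (h1 : 1 ≤ j) (hjm : j < m) (hm : m ≤ par.M)
    (ha : ∀ i, 1 ≤ i → i < m → r.Accurate par H D hs i) (hh : h ∈ H) {ξ₀ : ℝ} (hξ₀ : 0 ≤ ξ₀)
    (hξ : par.ξ ≤ ξ₀) :
    ∫ z, (r.loss par H j h z - r.loss par H j hs z) ^ 2 ∂(D.prod coinLaw)
      ≤ 2 * par.α ^ 2 * ((r.meanLoss par H D j h - r.meanLoss par H D j hs)
          + 6 * r.meanLoss par H D j hs)
        + (2 * par.α ^ 2 * par.η * r.cumRadius par H m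
          + 2 * (par.β ^ 2 * par.γ) * (3 / 2 * r.cumRegret par H D hs m h
            + 3 / 4 * (par.η * r.cumRadius par H m)) * r.cumRadius par H m
          + 2 * ξ₀ * r.cumRadius par H m ^ 2) / par.τ j := by
  have hj : j < par.M := by omega
  have hv : ∀ i, 1 ≤ i → i < m → hs ∈ r.versionSpace par H i := fun i h1 hi => (ha i h1 hi).mem
  have hvj : ∀ i, 1 ≤ i → i < j → hs ∈ r.versionSpace par H i := fun i h1 hi => hv i h1 (by omega)
  have key := hr.second_moment_le hp hH h1 hj (hv j h1 hjm) hh hmin.1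
  have ht := hp.three_le_τ_cast h1 hj.le
  have ht0 : (0 : ℝ) < par.τ j := by linarith
  obtain ⟨b1, b2⟩ := hr.erm_accuracy hp hH hmin h1 hj.le hvj (ha j h1 hjm)
  have b3 := (abs_le.1 ((ha j h1 hjm).regret h hh)).2
  have b4 := hr.cumRegret_mono hp hH hmin hm hv hh hjm.le
  have b5 := hr.cumRadius_mono hp hH h1 hjm.le hm
  have b6 := cumRadius_pos (r := r) hp h1 hj.le
  have b7 := hr.cumRegret_nonneg hp hH hmin hj.le hvj hh
  have hη := hp.η_pos
  have hγ := hp.γ_pos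
  rw [empErr_eq hp h1 hj.le, empErr_eq hp h1 hj.le, empErr_eq hp h1 hj.le] at key
  set X := r.cumRadius par H j
  set X' := r.cumRadius par H m
  set ρ := r.cumRegret par H D hs j h
  set ρ' := r.cumRegret par H D hs m h
  have c1 : 2 * par.α ^ 2 * (2 * reg D (r.h (j + 1)) hs) ≤ 2 * par.α ^ 2 * par.η * X' / par.τ j := by
    rw [le_div_iff₀ ht0]
    have : 2 * (par.τ j * reg D (r.h (j + 1)) hs) ≤ par.η * X' := by
      have : par.η * X ≤ par.η * X' := by gcongr
      linarith
    have := mul_le_mul_of_nonneg_left this (show 0 ≤ 2 * par.α ^ 2 by positivity)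
    linarith
  have c2 : 2 * par.β ^ 2 * par.γ * (r.cumLoss par H j h / par.τ j + r.cumLoss par H j hs / par.τ j
      - 2 * (r.cumLoss par H j (r.h (j + 1)) / par.τ j)) * X
      ≤ 2 * (par.β ^ 2 * par.γ) * (3 / 2 * ρ' + 3 / 4 * (par.η * X')) * X' / par.τ j := by
    rw [le_div_iff₀ ht0]
    have e : 2 * par.β ^ 2 * par.γ * (r.cumLoss par H j h / par.τ j
        + r.cumLoss par H j hs / par.τ j - 2 * (r.cumLoss par H j (r.h (j + 1)) / par.τ j))
          * X * par.τ j
        = 2 * (par.β ^ 2 * par.γ) * (r.cumLoss par H j h + r.cumLoss par H j hs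
          - 2 * r.cumLoss par H j (r.h (j + 1))) * X := by field_simp
    rw [e]
    -- Write it as the excess of `h` over `hs` plus twice that of `hs` over the minimizer: 3/2 ρ +
    -- ηX/4, plus 2 · ηX/4.
    have : r.cumLoss par H j h + r.cumLoss par H j hs - 2 * r.cumLoss par H j (r.h (j + 1))
        ≤ 3 / 2 * ρ' + 3 / 4 * (par.η * X') := by
      have : par.η * X ≤ par.η * X' := by gcongr
      linarith
    have h0 : 0 ≤ 3 / 2 * ρ' + 3 / 4 * (par.η * X') := by
      have : 0 ≤ par.η * X' := mul_nonneg hη.le (b6.le.trans b5)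
      linarith
    gcongr
  have c3 : 2 * par.ξ * (X ^ 2 / par.τ j) ≤ 2 * ξ₀ * X' ^ 2 / par.τ j := by
    rw [mul_div_assoc]
    gcongr
  rw [add_div, add_div]
  linarith

/-- Summing the epochwise bounds costs a factor 2 log τ_m on the terms divided by τ_j. The
conditions on β and ξ cancel this factor in their terms; in the remaining one it is matched by the
log τ_m inside the radius. -/
theorem sum_second_moment_le (h1 : 1 ≤ m) (hm : m ≤ par.M)
    (ha : ∀ i, 1 ≤ i → i < m → r.Accurate par H D hs i) (hh : h ∈ H) :
    ∑ j ∈ Finset.range m, ((par.τ (j + 1) : ℝ) - par.τ j)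
        * ∫ z, (r.loss par H j h z - r.loss par H j hs z) ^ 2 ∂(D.prod coinLaw)
      ≤ 2 * par.α ^ 2 * (r.cumRegret par H D hs m h + 6 * r.cumMean par H D m hs)
        + 4 * par.α ^ 2 * par.η * Real.log (par.τ m) * r.cumRadius par H m
        + par.η / 216 * (3 / 2 * r.cumRegret par H D hs m h
            + 3 / 4 * (par.η * r.cumRadius par H m))
          * (r.cumRadius par H m / (par.τ m * par.eps H.card m))
        + r.cumRadius par H m ^ 2 / (2 * (par.τ m * par.eps H.card m)) := by
  obtain ⟨ξ₀, hξ₀, hξ, hξlog⟩ := hp.ξ_mul_log_le h1 hm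
  have hβ := hp.β_sq_mul_log_le h1 hm
  have hv : ∀ i, 1 ≤ i → i < m → hs ∈ r.versionSpace par H i := fun i h1 hi => (ha i h1 hi).mem
  have hX := cumRadius_pos (r := r) hp h1 hm
  have hρ := hr.cumRegret_nonneg hp hH hmin hm hv hh
  have hη := hp.η_pos
  have hγ := hp.γ_pos
  have hα := hp.α_ge
  have he : 0 < par.τ m * par.eps H.card m :=
    mul_pos (by linarith [hp.three_le_τ_cast h1 hm]) (hp.eps_pos h1 hm)
  have hstep := hp.sum_step_div_le h1 hm
  set X := r.cumRadius par H m
  set ρ := r.cumRegret par H D hs m h with hρdef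
  set K := 2 * par.α ^ 2 * par.η * X
    + 2 * (par.β ^ 2 * par.γ) * (3 / 2 * ρ + 3 / 4 * (par.η * X)) * X + 2 * ξ₀ * X ^ 2 with hK
  have hK0 : 0 ≤ K := by positivity
  set f : ℕ → ℝ := fun j => ((par.τ (j + 1) : ℝ) - par.τ j) * (2 * par.α ^ 2 *
    ((r.meanLoss par H D j h - r.meanLoss par H D j hs) + 6 * r.meanLoss par H D j hs)) with hf
  have hsum : ∑ j ∈ Finset.range m, f j
      = 2 * par.α ^ 2 * (ρ + 6 * r.cumMean par H D m hs) := by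
    rw [hρdef, cumRegret, cumMean, Finset.mul_sum, ← Finset.sum_add_distrib, Finset.mul_sum]
    exact Finset.sum_congr rfl fun j _ => by rw [hf]; ring
  have hle : ∑ j ∈ Finset.range m, ((par.τ (j + 1) : ℝ) - par.τ j)
        * ∫ z, (r.loss par H j h z - r.loss par H j hs z) ^ 2 ∂(D.prod coinLaw)
      ≤ ∑ j ∈ Finset.range m, f j
        + (∑ j ∈ Finset.Ico 1 m, ((par.τ (j + 1) : ℝ) - par.τ j) / par.τ j) * K := by
    rw [Finset.range_eq_Ico, Finset.sum_eq_sum_Ico_succ_bot (by omega),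
      Finset.sum_eq_sum_Ico_succ_bot (a := 0) (b := m) (by omega), add_assoc, Finset.sum_mul,
      ← Finset.sum_add_distrib]
    refine add_le_add ?_ (Finset.sum_le_sum fun j hj => ?_)
    · have a1 := hr.second_moment_zero_le hp hH hh hmin.1
      have a2 := hr.meanLoss_sub_nonneg hp hH hmin (j := 0) hp.one_le_M (by omega) hh
      have a3 := hr.meanLoss_nonneg hp hH (j := 0) hp.one_le_M hs
      refine mul_le_mul_of_nonneg_left (a1.trans ?_) (hp.τ_step_nonneg hp.one_le_M)
      have hα2 : 1 ≤ par.α ^ 2 := one_le_pow₀ hα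
      nlinarith
    · rw [Finset.mem_Ico] at hj
      have a1 := hr.second_moment_le_of_accurate hp hH hmin (by omega : 1 ≤ j) hj.2 hm ha hh hξ₀ hξ
      refine (mul_le_mul_of_nonneg_left a1 (hp.τ_step_nonneg (by omega))).trans (le_of_eq ?_)
      rw [hf]
      ring
  have hKle : 2 * Real.log (par.τ m) * K ≤ 4 * par.α ^ 2 * par.η * Real.log (par.τ m) * X
        + par.η / 216 * (3 / 2 * ρ + 3 / 4 * (par.η * X)) * (X / (par.τ m * par.eps H.card m))
        + X ^ 2 / (2 * (par.τ m * par.eps H.card m)) := by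
    have a1 := mul_le_mul_of_nonneg_left hβ
      (show 0 ≤ 4 * (3 / 2 * ρ + 3 / 4 * (par.η * X)) * X by positivity)
    have a2 := mul_le_mul_of_nonneg_left hξlog (show 0 ≤ 4 * X ^ 2 by positivity)
    have e1 : 4 * (3 / 2 * ρ + 3 / 4 * (par.η * X)) * X
        * (par.η / (864 * (par.τ m * par.eps H.card m)))
        = par.η / 216 * (3 / 2 * ρ + 3 / 4 * (par.η * X)) * (X / (par.τ m * par.eps H.card m)) := by
      field_simp; ring
    have e2 : 4 * X ^ 2 * (1 / (8 * (par.τ m * par.eps H.card m)))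
        = X ^ 2 / (2 * (par.τ m * par.eps H.card m)) := by field_simp; ring
    rw [e1] at a1
    rw [e2] at a2
    rw [hK]
    linarith
  have := mul_le_mul_of_nonneg_right hstep hK0
  rw [hsum] at hle
  linarith

omit hmin in
theorem sum_second_moment_hs_le (hsH : hs ∈ H) (hm : m ≤ par.M) {W : ℝ}
    (hW : ∀ j, j < m → r.weightBound par H j ≤ W) :
    ∑ j ∈ Finset.range m, ((par.τ (j + 1) : ℝ) - par.τ j)
        * ∫ z, r.loss par H j hs z ^ 2 ∂(D.prod coinLaw) ≤ W * r.cumMean par H D m hs := by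
  rw [cumMean, Finset.mul_sum]
  refine Finset.sum_le_sum fun j hj => ?_
  rw [Finset.mem_range] at hj
  have hjM : j < par.M := by omega
  have h1 := (hr.isQueryWeight hp hH hjM).integral_sq_epochLoss_le (D := D)
    (hr.measurable_predictor hH hjM) (hH hs hsH)
  have h2 := mul_le_mul_of_nonneg_right (hW j hj) (hr.meanLoss_nonneg hp hH hjM hs)
  have h3 := mul_le_mul_of_nonneg_left (h1.trans h2) (hp.τ_step_nonneg hjM)
  refine h3.trans (le_of_eq ?_)
  ring

omit hmin [IsProbabilityMeasure D] in
theorem cumMean_nonneg (hm : m ≤ par.M) (h : 𝒳 → Bool) : 0 ≤ r.cumMean par H D m h := by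
  refine Finset.sum_nonneg fun j hj => ?_
  rw [Finset.mem_range] at hj
  exact mul_nonneg (hp.τ_step_nonneg (by omega)) (hr.meanLoss_nonneg hp hH (by omega) h)

omit hmin [IsProbabilityMeasure D] in
/-- A rate in the finite set of candidates which suits the radius. -/
theorem exists_rate (h1 : 1 ≤ m) (hm : m ≤ par.M) : ∃ k, 1 ≤ k ∧ k ≤ par.τ m ∧
    RateBounds par.α par.η par.c₁ par.c₂ (par.τ m * par.eps H.card m) (Real.log (par.τ m))
      (r.cumLoss par H m (r.h (m + 1))) (r.cumRadius par H m) (par.rate k) := by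
  have hX := cumRadius_pos (r := r) hp h1 hm
  have hXge := cumRadius_ge (r := r) hp h1 hm
  have ht := hp.three_le_τ_cast h1 hm
  have hε := hp.eps_pos h1 hm
  have hc2 := hp.c₂_pos
  have hΛ := hp.one_le_log_τ h1 hm
  have hη := hp.η_pos
  have hy := hr.cumLoss_nonneg hp hH (r.h (m + 1)) hm
  have he64 : 64 ≤ par.τ m * par.eps H.card m := by
    rw [hp.τ_mul_eps h1 hm]
    linarith [hp.one_le_log_card_div]
  have hXeq := cumRadius_eq (r := r) hp h1 hm
  set e := par.τ m * par.eps H.card m with he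
  set X := r.cumRadius par H m
  have he0 : 0 < e := by linarith
  set q := X / (e * par.c₂) with hq
  have hq1 : 1 ≤ q := by
    rw [hq, le_div_iff₀ (by positivity)]
    have : par.c₂ * e ≤ par.c₂ * e * Real.log (par.τ m) :=
      le_mul_of_one_le_right (by positivity) hΛ
    linarith
  have hqτ : q ≤ par.τ m := by
    rw [hq, div_le_iff₀ (by positivity), hXeq]
    have a1 : Real.sqrt (e * r.cumLoss par H m (r.h (m + 1))) ≤ e * (par.τ m / 8) := by
      rw [Real.sqrt_le_left (by positivity)]
      have := hr.cumLoss_le_sq hp hH hm (r.h (m + 1))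
      have a2 : e * r.cumLoss par H m (r.h (m + 1)) ≤ e * (par.τ m : ℝ) ^ 2 := by gcongr
      have a3 : 64 * (e * (par.τ m : ℝ) ^ 2) ≤ e * (e * (par.τ m : ℝ) ^ 2) := by gcongr
      linarith
    have a2 : par.c₁ ≤ par.c₂ := by
      have := hp.c₁_ge_four
      have := hp.c₂_ge_mul
      nlinarith
    have a3 : par.c₁ * Real.sqrt (e * r.cumLoss par H m (r.h (m + 1)))
        ≤ par.c₂ * (e * (par.τ m / 8)) :=
      mul_le_mul a2 a1 (Real.sqrt_nonneg _) hc2.le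
    have h6 := Real.log_le_sub_one_of_pos (x := (par.τ m : ℝ) / 2) (by linarith)
    rw [Real.log_div (by linarith) (by norm_num)] at h6
    have a4 : Real.log (par.τ m) ≤ par.τ m / 2 := by linarith [Real.log_two_lt_d9]
    have a5 : par.c₂ * e * Real.log (par.τ m) ≤ par.c₂ * e * (par.τ m / 2) := by gcongr
    have a6 : 0 ≤ par.c₂ * e * par.τ m := by positivity
    linarith
  have hk1 : q ≤ ⌈q⌉₊ := Nat.le_ceil q
  have hk2 : (⌈q⌉₊ : ℝ) ≤ 2 * q := by
    have := Nat.ceil_lt_add_one (show 0 ≤ q by linarith)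
    linarith
  have hk0 : (0 : ℝ) < ⌈q⌉₊ := by linarith
  have hXq : X = q * (e * par.c₂) := by rw [hq]; field_simp
  have hrate : par.rate ⌈q⌉₊ * par.η * X = 36 * e * (q / ⌈q⌉₊) := by
    rw [Params.rate, hXq]
    field_simp
  refine ⟨⌈q⌉₊, Nat.one_le_iff_ne_zero.2 fun h0 => ?_, Nat.ceil_le.2 hqτ, hp.η_ge, hp.α_ge,
    hp.c₁_ge_four, hp.c₁_sq_ge, hp.c₂_ge, he0, hΛ, hy, hXeq, ?_, ?_, ?_⟩
  · rw [h0] at hk0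
    simp at hk0
  · rw [Params.rate]; positivity
  · rw [hrate]
    have : 1 / 2 ≤ q / ⌈q⌉₊ := by rw [div_le_div_iff₀ (by norm_num) hk0]; linarith
    have := mul_le_mul_of_nonneg_left this (show 0 ≤ 36 * e by positivity)
    linarith
  · rw [hrate]
    have : q / ⌈q⌉₊ ≤ 1 := by rw [div_le_one hk0]; exact hk1
    exact mul_le_of_le_one_right (by positivity) this

/-- Concentration with c = 0 ties the loss of `hs` to its mean, so the second moments can be
expressed by observed losses. Concentration with c = 1 then controls all excess losses at the same
rate. -/
theorem accurate_step (hc : r.Concentrated par H D hs) (h1 : 1 ≤ m) (hm : m ≤ par.M)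
    (ha : ∀ i, 1 ≤ i → i < m → r.Accurate par H D hs i) :
    r.Accurate par H D hs m ∧ r.cumLoss par H m (r.h (m + 1))
      ≤ 2 * r.cumMean par H D m hs + par.γ * r.cumRadius par H m := by
  obtain ⟨k, hk1, hk, hb⟩ := hr.exists_rate hp hH h1 hm
  have hv : ∀ i, 1 ≤ i → i < m → hs ∈ r.versionSpace par H i := fun i h1 hi => (ha i h1 hi).mem
  have hX := cumRadius_pos (r := r) hp h1 hm
  have hη := hp.η_pos
  have hconc := hc m h1 hm
  have hlog : 3 * (Real.log (H.card / par.δ) + Real.log (par.τ m))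
      = 3 / 32 * (par.τ m * par.eps H.card m) := by
    rw [hp.τ_mul_eps h1 hm]; ring
  have hsum := fun h hh => hr.sum_second_moment_le hp hH hmin h1 hm ha (h := h) hh
  have hy := hr.cumLoss_nonneg hp hH (r.h (m + 1)) hm
  have hB := hr.cumLoss_erm_le hp h1 hm hmin.1
  have hμ0 := hr.cumMean_nonneg hp hH hm hs
  set e := par.τ m * par.eps H.card m with he
  set W := 2 + Real.sqrt (r.cumLoss par H m (r.h (m + 1)) / e) + Real.log (par.τ m) with hW
  have hWj : ∀ j, j < m → r.weightBound par H j ≤ W := fun j hj => by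
    refine (hr.weightBound_le hp hH hm hj).trans ?_
    have h3 := hb.e_pos
    have h4 : e ≤ par.n * par.eps H.card par.M := hp.le_n_mul_eps h1 hm
    have := Real.sqrt_le_sqrt (div_le_div_of_nonneg_left hy h3 h4)
    linarith
  have hlW := hb.rate_mul_le (W := W) le_rfl
  have hRk : ∀ j, j < m → par.rate k * r.weightBound par H j ≤ 1 := fun j hj => by
    have := mul_le_mul_of_nonneg_left (hWj j hj) hb.l_nonneg
    linarith
  have herr : |r.cumLoss par H m hs - r.cumMean par H D m hs|
      ≤ r.cumMean par H D m hs / 24 + par.η * r.cumRadius par H m / 192 := by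
    have h0 := hconc hs hmin.1 k hk1 hk hRk 0 (Or.inl rfl)
    simp only [zero_mul, sub_zero] at h0
    refine hb.error_deviation hμ0 (W := W) le_rfl ?_
    rw [hlog] at h0
    refine h0.trans ?_
    have := hr.sum_second_moment_hs_le hp hH hmin.1 hm hWj
    gcongr
  set B := r.cumLoss par H m hs - r.cumLoss par H m (r.h (m + 1)) with hBdef
  have hB0 : 0 ≤ B := sub_nonneg.2 hB
  have hsB : r.cumLoss par H m hs = r.cumLoss par H m (r.h (m + 1)) + B := by rw [hBdef]; ring
  have hdev : ∀ h ∈ H, |r.cumLoss par H m h - r.cumLoss par H m hs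
      - r.cumRegret par H D hs m h| ≤ r.cumRegret par H D hs m h / 2
        + 3 / 20 * (par.η * r.cumRadius par H m) + B / 1000 := by
    intro h hh
    have h0 := hconc h hh k hk1 hk hRk 1 (Or.inr rfl)
    simp only [one_mul] at h0
    rw [hlog] at h0
    have hint : ∑ j ∈ Finset.range m, ((par.τ (j + 1) : ℝ) - par.τ j)
        * ∫ z, (r.loss par H j h z - r.loss par H j hs z) ∂(D.prod coinLaw)
        = r.cumRegret par H D hs m h := by
      refine Finset.sum_congr rfl fun j hj => ?_
      rw [Finset.mem_range] at hj
      have hq := hr.isQueryWeight hp hH (j := j) (by omega)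
      have hg := hr.measurable_predictor hH (j := j) (by omega)
      congr 1
      exact integral_sub (hq.integrable_epochLoss hg (hH h hh))
        (hq.integrable_epochLoss hg (hH hs hmin.1))
    rw [hint] at h0
    refine hb.regret_deviation (hr.cumRegret_nonneg hp hH hmin hm hv hh) hB0 ?_ (hsum h hh) h0
    rw [← hsB]
    exact herr
  -- Self-bounding: B occurs in its own deviation inequality, applied to the empirical minimizer,
  -- with coefficient 1/1000 and can be absorbed. As 4/25 < 1/4 and η/4 ≤ γ, this puts `hs` into the
  -- version space.
  have hBle : B ≤ 4 / 25 * (par.η * r.cumRadius par H m) := by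
    have hg := (hr.erm m h1 hm).1
    have a1 := (abs_le.1 (hdev _ hg)).1
    have a2 := hr.cumRegret_nonneg hp hH hmin hm hv hg
    have a3 : 0 < par.η * r.cumRadius par H m := mul_pos hη hX
    linarith
  have hηX : 0 < par.η * r.cumRadius par H m := mul_pos hη hX
  have hγX : par.η / 4 * r.cumRadius par H m ≤ par.γ * r.cumRadius par H m :=
    mul_le_mul_of_nonneg_right hp.γ_ge hX.le
  refine ⟨⟨(mem_versionSpace_iff hp h1 hm).2 ⟨hmin.1, ?_⟩, fun h hh => ?_⟩, ?_⟩
  · change B ≤ _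
    linarith
  · have := hdev h hh
    linarith
  · have := (abs_le.1 herr).2
    linarith

theorem accurate (hc : r.Concentrated par H D hs) (h1 : 1 ≤ m) (hm : m ≤ par.M) :
    r.Accurate par H D hs m := by
  induction m using Nat.strong_induction_on with
  | _ m ih => exact (hr.accurate_step hp hH hmin hc h1 hm fun i hi him => ih i him hi (by omega)).1

theorem cumLoss_erm_le_cumMean (hc : r.Concentrated par H D hs) (h1 : 1 ≤ m) (hm : m ≤ par.M) :
    r.cumLoss par H m (r.h (m + 1))
      ≤ 2 * r.cumMean par H D m hs + par.γ * r.cumRadius par H m :=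
  (hr.accurate_step hp hH hmin hc h1 hm
    fun _ hi him => hr.accurate hp hH hmin hc hi (by omega)).2

/-- Membership bounds the empirical excess over `hs` by γX. Accuracy loses half of the expected
excess and at most another γX, so the expected excess is at most 4γX. -/
theorem τ_mul_reg_le_of_mem (hc : r.Concentrated par H D hs) (h1 : 1 ≤ m) (hm : m ≤ par.M)
    (hh : h ∈ r.versionSpace par H m) :
    par.τ m * reg D h hs ≤ 4 * par.γ * r.cumRadius par H m := by
  have hv : ∀ i, 1 ≤ i → i < m → hs ∈ r.versionSpace par H i := fun i hi him =>
    (hr.accurate hp hH hmin hc hi (by omega)).mem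
  obtain ⟨hhH, hle⟩ := (mem_versionSpace_iff hp h1 hm).1 hh
  have a1 := (abs_le.1 ((hr.accurate hp hH hmin hc h1 hm).regret h hhH)).1
  have a2 := hr.τ_mul_reg_le hp hH hmin hm hv hhH
  have a3 := hr.cumLoss_erm_le hp h1 hm hmin.1
  have a4 := mul_le_mul_of_nonneg_right hp.γ_ge (cumRadius_pos (r := r) hp h1 hm).le
  linarith

end IsPath

end Realization

/-! ### Disagreement coefficient and low noise -/

section Disagreement

variable {𝒳 : Type*} [MeasurableSpace 𝒳] {D : Measure (𝒳 × Bool)} [IsProbabilityMeasure D]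
  {H : Finset (𝒳 → Bool)} {hs : 𝒳 → Bool}

omit [IsProbabilityMeasure D] in
open scoped ENNReal in
-- A union bound over the classifiers within distance r gives at most |H|. Finiteness matters
-- because an infinite supremum would become 0 as a real number.
theorem disagreement_iSup_ne_top : (⨆ (r : ℝ) (_ : 0 < r),
    D.fst {x | ∃ h ∈ H, hs x ≠ h x ∧ D.fst {x' | h x' ≠ hs x'} ≤ ENNReal.ofReal r}
      / ENNReal.ofReal r) ≠ ∞ := by
  classical
  refine ne_top_of_le_ne_top (b := (H.card : ℝ≥0∞)) (ENNReal.natCast_ne_top _)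
    (iSup_le fun r => iSup_le fun hr => ?_)
  refine ENNReal.div_le_of_le_mul ?_
  have hsub : {x | ∃ h ∈ H, hs x ≠ h x ∧ D.fst {x' | h x' ≠ hs x'} ≤ ENNReal.ofReal r}
      ⊆ ⋃ h ∈ H.filter (fun h => D.fst {x' | h x' ≠ hs x'} ≤ ENNReal.ofReal r),
        {x | h x ≠ hs x} := by
    rintro x ⟨h, hh, hx, hle⟩
    simp only [Set.mem_iUnion, exists_prop, Finset.mem_filter]
    exact ⟨h, ⟨hh, hle⟩, hx.symm⟩
  refine (measure_mono hsub).trans ((measure_biUnion_finset_le _ _).trans ?_)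
  refine (Finset.sum_le_card_nsmul _ _ _ fun h hh => (Finset.mem_filter.1 hh).2).trans ?_
  rw [nsmul_eq_mul]
  gcongr
  exact Finset.filter_subset _ _

omit [IsProbabilityMeasure D] in
theorem real_disagreement_le {ρ : ℝ} (hρ : 0 < ρ) :
    D.fst.real {x | ∃ h ∈ H, hs x ≠ h x ∧ D.fst {x' | h x' ≠ hs x'} ≤ ENNReal.ofReal ρ}
      ≤ disagreementCoeff D H hs * ρ := by
  have h1 := le_iSup₂ (f := fun (r : ℝ) (_ : 0 < r) =>
    D.fst {x | ∃ h ∈ H, hs x ≠ h x ∧ D.fst {x' | h x' ≠ hs x'} ≤ ENNReal.ofReal r}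
      / ENNReal.ofReal r) ρ hρ
  have h2 := ENNReal.toReal_mono disagreement_iSup_ne_top h1
  rw [ENNReal.toReal_div, ENNReal.toReal_ofReal hρ.le, div_le_iff₀ hρ] at h2
  exact h2

omit [IsProbabilityMeasure D] in
theorem disagreementCoeff_nonneg : 0 ≤ disagreementCoeff D H hs := ENNReal.toReal_nonneg

theorem err_mem_Icc (h : 𝒳 → Bool) : 0 ≤ err D h ∧ err D h ≤ 1 :=
  ⟨measureReal_nonneg, measureReal_le_one⟩

/-- The low-noise condition bounds the mass of the disagreement region of a set of classifiers of
small regret. -/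
theorem TsybakovCondition.real_DIS_le {ζ ω : ℝ} (hT : TsybakovCondition D H hs ζ ω 1) (hζ : 0 < ζ)
    (hω : 0 < ω) (hmin : IsErrMinimizer D H hs) {A : Set (𝒳 → Bool)} (hA : ∀ h ∈ A, h ∈ H)
    {b : ℝ} (hb : 0 < b) (hAb : ∀ h ∈ A, reg D h hs ≤ b) :
    D.fst.real (DIS A) ≤ disagreementCoeff D H hs * (ζ * b ^ ω) := by
  refine le_trans (measureReal_mono ?_) (real_disagreement_le (by positivity))
  have key : ∀ h ∈ A, D.fst {x' | h x' ≠ hs x'} ≤ ENNReal.ofReal (ζ * b ^ ω) := by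
    intro h hh
    have h0 : 0 ≤ err D h - err D hs := sub_nonneg.2 (hmin.2 h (hA h hh))
    have h1 := hT h (hA h hh) (by linarith [(err_mem_Icc (D := D) h).2, (err_mem_Icc (D := D) hs).1])
    have h2 : (err D h - err D hs) ^ ω ≤ b ^ ω := Real.rpow_le_rpow h0 (hAb h hh) hω.le
    rw [← ENNReal.ofReal_toReal (measure_ne_top D.fst {x' | h x' ≠ hs x'})]
    exact ENNReal.ofReal_le_ofReal (h1.trans (by gcongr))
  rintro x ⟨h, hh, h', hh', hx⟩
  -- Of two classifiers that disagree at x, at least one disagrees there with `hs`.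
  by_cases hxs : hs x = h x
  · exact ⟨h', hA h' hh', fun e => hx (hxs.symm.trans e), key h' hh'⟩
  · exact ⟨h, hA h hh, hxs, key h hh⟩

end Disagreement

/-! ### Solving the recursion for the radius -/

/-- Factor of the rate of decrease of the radius. -/
def rateConst (c₁ c₂ γ ζ θ : ℝ) : ℝ :=
  1 + 512 * c₁ ^ 2 * (3 + 8 * max θ 0 * |ζ| * |γ|) + 16384 * (c₁ ^ 4 * γ ^ 2 + c₂ ^ 2)

/-- The absolute values make the coefficient of θ nonnegative for arbitrary real parameters; the
truncation at 0 ensures that the constant is at least 1. -/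
theorem rateConst_mono (c₁ c₂ γ ζ : ℝ) : Monotone (rateConst c₁ c₂ γ ζ) := by
  intro θ θ' h
  unfold rateConst
  gcongr

theorem one_le_rateConst (c₁ c₂ γ ζ θ : ℝ) : 1 ≤ rateConst c₁ c₂ γ ζ θ := by
  unfold rateConst
  have : 0 ≤ max θ 0 := le_max_right _ _
  have : 0 ≤ 512 * c₁ ^ 2 * (3 + 8 * max θ 0 * |ζ| * |γ|) := by positivity
  have : 0 ≤ 16384 * (c₁ ^ 4 * γ ^ 2 + c₂ ^ 2) := by positivity
  linarith

/-- Solving the inequality satisfied by the radius. -/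
theorem sq_le_of_eq_sqrt_add {X c₁ c₂ γ e y μ Λ : ℝ} (he : 0 ≤ e) (hy : 0 ≤ y)
    (hX : X = c₁ * Real.sqrt (e * y) + c₂ * e * Λ) (hyle : y ≤ 2 * μ + γ * X) :
    X ^ 2 ≤ 8 * c₁ ^ 2 * e * μ + 4 * (c₁ ^ 4 * γ ^ 2 + c₂ ^ 2 * Λ ^ 2) * e ^ 2 := by
  have h1 : X ^ 2 ≤ 2 * c₁ ^ 2 * (e * y) + 2 * (c₂ * e * Λ) ^ 2 := by
    have hs : Real.sqrt (e * y) ^ 2 = e * y := Real.sq_sqrt (by positivity)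
    rw [← hs, hX]
    nlinarith [sq_nonneg (c₁ * Real.sqrt (e * y) - c₂ * e * Λ)]
  have h2 := mul_le_mul_of_nonneg_left hyle (show 0 ≤ 2 * c₁ ^ 2 * e by positivity)
  -- The term 2c₁²γeX, linear in X, is split into X²/2, which is absorbed on the left, and 2c₁⁴γ²e².
  nlinarith [sq_nonneg (X - 2 * c₁ ^ 2 * γ * e)]

/-- The bound on μ is affine in K, so X² is at most a multiple of K T²L²Λ⁴, and the definition of K
makes that multiple at most K. The claim is the square root. -/
theorem radius_recursion {X c₁ c₂ γ ζ θ e y μ Λ L T K : ℝ} (hγ : 0 ≤ γ) (hζ : 0 ≤ ζ) (hθ : 0 ≤ θ)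
    (hK : K = rateConst c₁ c₂ γ ζ θ) (he : 0 ≤ e) (heL : e ≤ 64 * (L * Λ)) (hL : 1 ≤ L)
    (hΛ : 1 ≤ Λ) (hT : 1 ≤ T) (hy : 0 ≤ y) (hX : X = c₁ * Real.sqrt (e * y) + c₂ * e * Λ)
    (hyle : y ≤ 2 * μ + γ * X) (hμ : μ ≤ 3 + 8 * (θ * ζ * γ * K) * (L * Λ ^ 3) * T ^ 2) :
    X ≤ K * T * L * Λ ^ 2 := by
  have h1 := sq_le_of_eq_sqrt_add he hy hX hyle
  have hK1 : 1 ≤ K := hK ▸ one_le_rateConst c₁ c₂ γ ζ θ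
  have hT2 : 1 ≤ T ^ 2 := one_le_pow₀ hT
  have hΛ2 : 1 ≤ Λ ^ 2 := one_le_pow₀ hΛ
  have hΛ3 : 1 ≤ Λ ^ 3 := one_le_pow₀ hΛ
  have hLΛ : 1 ≤ L * Λ ^ 3 := one_le_mul_of_one_le_of_one_le hL hΛ3
  have hLT : 1 ≤ L * Λ ^ 3 * T ^ 2 := one_le_mul_of_one_le_of_one_le hLΛ hT2
  have hG : 0 ≤ θ * ζ * γ := by positivity
  set G := θ * ζ * γ
  have hμ2 : μ ≤ (3 + 8 * G) * K * (L * Λ ^ 3 * T ^ 2) := by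
    have a1 : 3 ≤ 3 * K * (L * Λ ^ 3 * T ^ 2) := by
      have : 1 ≤ K * (L * Λ ^ 3 * T ^ 2) := one_le_mul_of_one_le_of_one_le hK1 hLT
      linarith
    linarith
  have h2 : 8 * c₁ ^ 2 * e * μ ≤ 8 * c₁ ^ 2 * (64 * (L * Λ)) * ((3 + 8 * G) * K
      * (L * Λ ^ 3 * T ^ 2)) := by
    calc 8 * c₁ ^ 2 * e * μ ≤ 8 * c₁ ^ 2 * e * ((3 + 8 * G) * K * (L * Λ ^ 3 * T ^ 2)) := by gcongr
      _ ≤ _ := by gcongr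
  have h3 : 4 * (c₁ ^ 4 * γ ^ 2 + c₂ ^ 2 * Λ ^ 2) * e ^ 2
      ≤ 16384 * (c₁ ^ 4 * γ ^ 2 + c₂ ^ 2) * (K * T ^ 2 * L ^ 2 * Λ ^ 4) := by
    have a1 : c₁ ^ 4 * γ ^ 2 ≤ c₁ ^ 4 * γ ^ 2 * Λ ^ 2 := le_mul_of_one_le_right (by positivity) hΛ2
    have a2 : e ^ 2 ≤ (64 * (L * Λ)) ^ 2 := by gcongr
    have a3 : 4 * (c₁ ^ 4 * γ ^ 2 + c₂ ^ 2 * Λ ^ 2) * e ^ 2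
        ≤ 4 * ((c₁ ^ 4 * γ ^ 2 + c₂ ^ 2) * Λ ^ 2) * (64 * (L * Λ)) ^ 2 := by
      gcongr; linarith
    refine a3.trans ?_
    have a4 : 1 ≤ K * T ^ 2 := one_le_mul_of_one_le_of_one_le hK1 hT2
    have a5 : 0 ≤ 16384 * (c₁ ^ 4 * γ ^ 2 + c₂ ^ 2) * (L ^ 2 * Λ ^ 4) := by positivity
    have a6 := mul_le_mul_of_nonneg_left a4 a5
    linarith
  have hKG : 512 * c₁ ^ 2 * (3 + 8 * G) + 16384 * (c₁ ^ 4 * γ ^ 2 + c₂ ^ 2) ≤ K := by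
    rw [hK, rateConst, max_eq_left hθ, abs_of_nonneg hζ, abs_of_nonneg hγ]
    simp only [G]
    linarith
  have h4 : X ^ 2 ≤ (K * T * L * Λ ^ 2) ^ 2 := by
    have a1 := mul_le_mul_of_nonneg_right hKG
      (show 0 ≤ K * T ^ 2 * L ^ 2 * Λ ^ 4 by positivity)
    calc X ^ 2 ≤ _ := h1
      _ ≤ (512 * c₁ ^ 2 * (3 + 8 * G) + 16384 * (c₁ ^ 4 * γ ^ 2 + c₂ ^ 2))
          * (K * T ^ 2 * L ^ 2 * Λ ^ 4) := by linarith
      _ ≤ K * (K * T ^ 2 * L ^ 2 * Λ ^ 4) := a1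
      _ = _ := by ring
  exact le_of_sq_le_sq h4 (by positivity)

/-! ### Rate of decrease of the regret under low noise -/

namespace Realization.IsPath

variable {𝒳 : Type*} [MeasurableSpace 𝒳] {par : Params} {H : Finset (𝒳 → Bool)}
  {D : Measure (𝒳 × Bool)} {hs h : 𝒳 → Bool} {r : Realization 𝒳} {j m : ℕ}
  [IsProbabilityMeasure D] (hr : r.IsPath par H D) (hp : par.Admissible H.card)
  (hH : ∀ h ∈ H, Measurable h) (hmin : IsErrMinimizer D H hs)

include hr hp hH hmin

/-- The loss of `hs` lives on the disagreement region of a version space whose members all have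
regret at most 4γX_j/τ_j. -/
theorem meanLoss_le_of_tsybakov {ζ ω : ℝ} (hT : TsybakovCondition D H hs ζ ω 1) (hζ : 0 < ζ)
    (hω : 0 < ω) (hc : r.Concentrated par H D hs) (h1 : 1 ≤ j) (hj : j < par.M) :
    r.meanLoss par H D j hs
      ≤ disagreementCoeff D H hs * (ζ * (4 * par.γ * r.cumRadius par H j / par.τ j) ^ ω) := by
  have ht := hp.three_le_τ_cast h1 hj.le
  have hX := cumRadius_pos (r := r) hp h1 hj.le
  have hγ := hp.γ_pos
  have hv := (hr.accurate hp hH hmin hc h1 hj.le).mem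
  refine (hr.meanLoss_le_real hp hH hj (fun _ => hv) hmin.1).trans ?_
  rw [queryRegion, if_neg (by omega)]
  refine hT.real_DIS_le hζ hω hmin (fun h hh => hh.1) (by positivity) fun h hh => ?_
  rw [le_div_iff₀ (by linarith), mul_comm]
  exact hr.τ_mul_reg_le_of_mem hp hH hmin hc h1 hj.le hh

/-- Strong induction with one constant for all epochs: earlier radii bound the expected loss of
`hs`, and `radius_recursion` converts this into the present radius. -/
theorem cumRadius_le {ζ ω : ℝ} (hT : TsybakovCondition D H hs ζ ω 1) (hζ : 0 < ζ)
    (hω : 0 < ω) (hω1 : ω ≤ 1) (hc : r.Concentrated par H D hs) (h1 : 1 ≤ m) (hm : m ≤ par.M) :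
    r.cumRadius par H m ≤ rateConst par.c₁ par.c₂ par.γ ζ (disagreementCoeff D H hs)
      * (par.τ m : ℝ) ^ (1 - 1 / (2 - ω)) * Real.log (H.card / par.δ)
      * Real.log (par.τ m) ^ 2 := by
  induction m using Nat.strong_induction_on with
  | _ m ih =>
  have ht := hp.three_le_τ_cast h1 hm
  have ht0 : (0 : ℝ) < par.τ m := by linarith
  have hL := hp.one_le_log_card_div
  have hΛ := hp.one_le_log_τ h1 hm
  have hγ := hp.γ_pos
  have hγ1 : 1 ≤ par.γ := by linarith [hp.γ_ge, hp.η_ge]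
  have hθ := disagreementCoeff_nonneg (D := D) (H := H) (hs := hs)
  have hK1 := one_le_rateConst par.c₁ par.c₂ par.γ ζ (disagreementCoeff D H hs)
  set θ := disagreementCoeff D H hs
  set K := rateConst par.c₁ par.c₂ par.γ ζ θ with hK
  set L := Real.log (H.card / par.δ)
  set Λ := Real.log (par.τ m)
  set s := 1 / (2 - ω) with hs_def
  have hs0 : 0 < s := by rw [hs_def]; apply one_div_pos.2; linarith
  have hs1 : s ≤ 1 := by rw [hs_def, div_le_one (by linarith)]; linarith
  -- The fixed point equation for the exponent: mean losses of order τ^(-sω) accumulate to τ^(1-sω),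
  -- which is exactly the square of the claimed order τ^(1-s) of the radius.
  have hsω : s * ω = 2 * s - 1 := by
    have : (2 - ω) * s = 1 := by rw [hs_def]; field_simp [show (2 - ω) ≠ 0 by linarith]
    linarith
  have hTsq : ((par.τ m : ℝ) ^ (1 - s)) ^ 2 = (par.τ m : ℝ) ^ (1 - s * ω) := by
    rw [← Real.rpow_natCast, ← Real.rpow_mul ht0.le, hsω]
    congr 1
    push_cast
    ring
  refine radius_recursion (c₁ := par.c₁) (c₂ := par.c₂) (γ := par.γ) (ζ := ζ) (θ := θ)
    (e := par.τ m * par.eps H.card m) (y := r.cumLoss par H m (r.h (m + 1)))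
    (μ := r.cumMean par H D m hs) hγ.le hζ.le hθ hK
    (mul_pos ht0 (hp.eps_pos h1 hm)).le ?_ hL hΛ (Real.one_le_rpow (by linarith) (by linarith))
    (hr.cumLoss_nonneg hp hH _ hm) (cumRadius_eq hp h1 hm)
    (hr.cumLoss_erm_le_cumMean hp hH hmin hc h1 hm) ?_
  · rw [hp.τ_mul_eps h1 hm]
    change 32 * (L + Λ) ≤ _
    nlinarith
  · rw [cumMean, Finset.range_eq_Ico, Finset.sum_eq_sum_Ico_succ_bot (by omega)]
    refine add_le_add ?_ ?_
    -- The first epoch has three examples, each with mean loss at most 1; this is the summand 3.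
    · have a1 := hr.meanLoss_le_real hp hH (j := 0) hp.one_le_M (fun h => by omega) hmin.1
      have a2 : D.fst.real (r.queryRegion par H 0) ≤ 1 := measureReal_le_one
      rw [zero_add, hp.τ_zero, hp.τ_one]
      push_cast
      linarith
    · have hterm : ∀ j ∈ Finset.Ico (0 + 1) m,
          ((par.τ (j + 1) : ℝ) - par.τ j) * r.meanLoss par H D j hs
            ≤ (((par.τ (j + 1) : ℝ) - par.τ j) / par.τ j)
              * (4 * (θ * ζ * par.γ * K) * (L * Λ ^ 2) * ((par.τ m : ℝ) ^ (1 - s)) ^ 2) := by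
        intro j hj
        rw [Finset.mem_Ico] at hj
        have hj1 : 1 ≤ j := by omega
        have htj := hp.three_le_τ_cast hj1 (by omega)
        have htj0 : (0 : ℝ) < par.τ j := by linarith
        have hjm : (par.τ j : ℝ) ≤ par.τ m := by exact_mod_cast hp.τ_mono hj.2.le hm
        have hΛj : Real.log (par.τ j) ≤ Λ := hp.log_τ_mono hj1 hj.2.le hm
        have hΛj1 := hp.one_le_log_τ hj1 (by omega)
        have b1 := hr.meanLoss_le_of_tsybakov hp hH hmin hT hζ hω hc hj1 (by omega)
        have b2 := ih j hj.2 hj1 (by omega)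
        have hXj := cumRadius_pos (r := r) hp hj1 (by omega)
        have b3 : 4 * par.γ * r.cumRadius par H j / par.τ j
            ≤ (4 * par.γ * K * (L * Λ ^ 2)) * (par.τ j : ℝ) ^ (-s) := by
          rw [div_le_iff₀ htj0]
          have c1 : (par.τ j : ℝ) ^ (-s) * par.τ j = (par.τ j : ℝ) ^ (1 - s) := by
            rw [sub_eq_neg_add, Real.rpow_add htj0, Real.rpow_one]
          have c2 : r.cumRadius par H j ≤ K * (par.τ j : ℝ) ^ (1 - s) * L * Λ ^ 2 :=
            b2.trans (by gcongr)
          rw [mul_assoc _ _ (par.τ j : ℝ), c1]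
          have := mul_le_mul_of_nonneg_left c2 (show 0 ≤ 4 * par.γ by positivity)
          linarith
        have b4 : (4 * par.γ * r.cumRadius par H j / par.τ j) ^ ω
            ≤ (4 * par.γ * K * (L * Λ ^ 2)) * (((par.τ m : ℝ) ^ (1 - s)) ^ 2 / par.τ j) := by
          have hbig : 1 ≤ 4 * par.γ * K * (L * Λ ^ 2) := by
            have c1 : 1 ≤ L * Λ ^ 2 := one_le_mul_of_one_le_of_one_le hL (one_le_pow₀ hΛ)
            have c2 : 1 ≤ par.γ * K := one_le_mul_of_one_le_of_one_le hγ1 hK1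
            have c3 := one_le_mul_of_one_le_of_one_le c2 c1
            linarith
          refine (Real.rpow_le_rpow (by positivity) b3 hω.le).trans ?_
          rw [Real.mul_rpow (by positivity) (by positivity), ← Real.rpow_mul htj0.le]
          -- With base at least 1 and ω ≤ 1 the power may be dropped, which keeps the estimate
          -- linear in K and in L.
          have c1 : (4 * par.γ * K * (L * Λ ^ 2)) ^ ω ≤ 4 * par.γ * K * (L * Λ ^ 2) := by
            calc _ ≤ (4 * par.γ * K * (L * Λ ^ 2)) ^ (1 : ℝ) :=
                  Real.rpow_le_rpow_of_exponent_le hbig hω1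
              _ = _ := Real.rpow_one _
          -- All but a factor 1/τ_j is moved to time m, so that summation over epochs costs only 2
          -- log τ_m; this needs sω ≤ 1.
          have c2 : (par.τ j : ℝ) ^ (-s * ω) ≤ ((par.τ m : ℝ) ^ (1 - s)) ^ 2 / par.τ j := by
            rw [le_div_iff₀ htj0, hTsq]
            have c3 : (par.τ j : ℝ) ^ (-s * ω) * par.τ j = (par.τ j : ℝ) ^ (1 - s * ω) := by
              rw [sub_eq_neg_add, Real.rpow_add htj0, Real.rpow_one, neg_mul]
            rw [c3]
            exact Real.rpow_le_rpow htj0.le hjm (by nlinarith)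
          gcongr
        have b5 := mul_le_mul_of_nonneg_left b4 (show 0 ≤ θ * ζ by positivity)
        have b6 : r.meanLoss par H D j hs ≤ θ * ζ * ((4 * par.γ * K * (L * Λ ^ 2))
            * (((par.τ m : ℝ) ^ (1 - s)) ^ 2 / par.τ j)) := by
          rw [← mul_assoc] at b1
          exact b1.trans b5
        refine (mul_le_mul_of_nonneg_left b6 (hp.τ_step_nonneg (by omega))).trans (le_of_eq ?_)
        ring
      refine (Finset.sum_le_sum hterm).trans ?_
      rw [← Finset.sum_mul]
      have hstep := hp.sum_step_div_le h1 hm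
      refine (mul_le_mul_of_nonneg_right hstep (by positivity)).trans (le_of_eq ?_)
      ring

theorem reg_le_of_tsybakov {ζ ω : ℝ} (hT : TsybakovCondition D H hs ζ ω 1) (hζ : 0 < ζ)
    (hω : 0 < ω) (hω1 : ω ≤ 1) (hc : r.Concentrated par H D hs) (h1 : 1 ≤ m) (hm : m ≤ par.M)
    (hh : h ∈ r.versionSpace par H m) :
    reg D h hs ≤ 4 * |par.γ| * rateConst par.c₁ par.c₂ par.γ ζ (disagreementCoeff D H hs)
      * (par.τ m : ℝ) ^ (-(1 / (2 - ω))) * Real.log (H.card / par.δ)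
      * Real.log (par.τ m) ^ 2 := by
  have ht0 : (0 : ℝ) < par.τ m := by linarith [hp.three_le_τ_cast h1 hm]
  have hγ := hp.γ_pos
  have a1 := hr.τ_mul_reg_le_of_mem hp hH hmin hc h1 hm hh
  have a2 := mul_le_mul_of_nonneg_left (hr.cumRadius_le hp hH hmin hT hζ hω hω1 hc h1 hm)
    (show 0 ≤ 4 * par.γ by positivity)
  rw [sub_eq_add_neg, Real.rpow_add ht0, Real.rpow_one] at a2
  rw [abs_of_pos hγ]
  refine le_of_mul_le_mul_left (a1.trans (a2.trans (le_of_eq ?_))) ht0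
  ring

end Realization.IsPath

theorem IsRun.isPath {𝒳 Ω : Type*} [MeasurableSpace 𝒳] [mΩ : MeasurableSpace Ω] {par : Params}
    {H : Finset (𝒳 → Bool)} {D : Measure (𝒳 × Bool)} {μ : Measure Ω} {ℱ : Filtration ℕ mΩ}
    {r : Ω → Realization 𝒳} (hr : IsRun par H D μ ℱ r) (ω : Ω) : (r ω).IsPath par H D :=
  ⟨hr.erm ω, fun j h1 hj => (hr.solution ω j h1 hj).1⟩

end ActiveCover

end

theorem mainTheorem5 :
    ∃ C : (c₁ c₂ γ ζ ω θ : ℝ) → ℝ,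
      (∀ c₁ c₂ γ ζ ω, Monotone (C c₁ c₂ γ ζ ω)) ∧
      ∀ (𝒳 Ω : Type*) [MeasurableSpace 𝒳] [mΩ : MeasurableSpace Ω]
        (D : MeasureTheory.Measure (𝒳 × Bool)) [MeasureTheory.IsProbabilityMeasure D]
        (μ : MeasureTheory.Measure Ω) [MeasureTheory.IsProbabilityMeasure μ]
        (ℱ : MeasureTheory.Filtration ℕ mΩ)
        (H : Finset (𝒳 → Bool)) (_ : ∀ h ∈ H, Measurable h)
        (hstar : 𝒳 → Bool) (_ : ActiveCover.IsErrMinimizer D H hstar)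
        (ζ ω : ℝ) (_ : 0 < ζ) (_ : 0 < ω) (_ : ω ≤ 1)
        (_ : ActiveCover.TsybakovCondition D H hstar ζ ω 1)
        (par : ActiveCover.Params) (_ : par.Admissible H.card)
        (r : Ω → ActiveCover.Realization 𝒳) (_ : ActiveCover.IsRun par H D μ ℱ r),
        ENNReal.ofReal (1 - par.δ) ≤
          μ {s | ∀ m, 1 ≤ m → m ≤ par.M → ∀ h ∈ (r s).versionSpace par H m,
            ActiveCover.reg D h hstar ≤
              C par.c₁ par.c₂ par.γ ζ ω (ActiveCover.disagreementCoeff D H hstar)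
                * (par.τ m : ℝ) ^ (-(1 / (2 - ω)))
                * Real.log (H.card / par.δ) * Real.log (par.τ m) ^ 2} := by
  refine ⟨fun c₁ c₂ γ ζ _ θ => 4 * |γ| * ActiveCover.rateConst c₁ c₂ γ ζ θ,
    fun c₁ c₂ γ ζ _ => (ActiveCover.rateConst_mono c₁ c₂ γ ζ).const_mul (by positivity), ?_⟩
  intro 𝒳 Ω _ mΩ D _ μ _ ℱ H hH hstar hmin ζ ω hζ hω hω1 hT par hp r hr
  have hbad := hr.measure_not_concentrated_le hp hH hmin.1
  refine le_trans ?_ (measure_mono (s := {s | (r s).Concentrated par H D hstar})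
    fun s hs m h1 hm h hh =>
      (hr.isPath s).reg_le_of_tsybakov hp hH hmin hT hζ hω hω1 hs h1 hm hh)
  -- Subadditivity over the event and its complement is enough here, so measurability of the
  -- concentration event is never required.
  rw [ENNReal.ofReal_sub _ hp.δ_pos.le, ENNReal.ofReal_one, tsub_le_iff_right]
  calc (1 : ENNReal) = μ Set.univ := measure_univ.symm
    _ ≤ μ ({s | (r s).Concentrated par H D hstar} ∪ {s | ¬ (r s).Concentrated par H D hstar}) :=
        measure_mono fun s _ => em _
    _ ≤ _ := (measure_union_le _ _).trans (add_le_add le_rfl hbad)
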